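/- **Setting.** Let $\mathcal H$ be an infinite-dimensional separable complex Hilbert space and let $a\mapsto\mathfrak A(a)$ assign to every open double cone $a$ of four-dimensional Minkowski space a von Neumann algebra on $\mathcal H$ such that $\mathfrak A(a)\subseteq\mathfrak A(b)$ if $a\subseteq b$, $\mathfrak A(a)\subseteq\mathfrak A(b)'$ if $a\perp b$ (spacelike separation), $\big(\bigcup_{b\perp a}\mathfrak A(b)\big)'=\mathfrak A(a)$ for all $a$ (Haag duality), and $\big(\bigcup_a\mathfrak A(a)\big)'=\mathbb C1$. Let $\mathfrak A$ be the $C^*$-algebra generated by all $\mathfrak A(a)$. A (not necessarily unital) $*$-morphism $\rho:\mathfrak A\to\mathfrak B(\mathcal H)\otimes M_{n_\rho}$ is *localized in* $o$ if $\rho(A)=(A\otimes1)\rho(1)$ for $A\in\mathfrak A(a)$, $a\perp o$. The arrows $T\in(\rho,\sigma)$ are the operator matrices with $T\rho(1)=T=\sigma(1)T$ and $T\rho(A)=\sigma(A)T$ for $A\in\mathfrak A$; $1_\rho=\rho(1)$; $T^+$ is the adjoint; $V\in(\rho,\sigma)$ is an isometry if $V^+V=1_\rho$, and unitary if also $VV^+=1_\sigma$.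 *Objects* are the localized morphisms $\rho$ (they have values in $\mathfrak A\otimes M_{n_\rho}$) that are *transportable*: for each double cone $o$ there is a unitary in $(\rho,\tau)$ for some $\tau$ localized in $o$. The tensor product is $\rho\sigma(A)_{ij}=\rho(\sigma(A)_{i_2j_2})_{i_1j_1}$, with $i=(i_1,i_2)$, $j=(j_1,j_2)$, and $(T\times S)_{ij}=\sum_kT_{i_1k}\,\rho(S_{i_2j_2})_{kj_1}$ for $T\in(\rho,\rho')$, with unit object $\iota=\mathrm{id}_{\mathfrak A}$. The symmetry is $\varepsilon(\rho,\sigma)=(V^+\times U^+)\,\theta\,(U\times V)\in(\rho\sigma,\sigma\rho)$, where $U\in(\rho,\rho_1)$, $V\in(\sigma,\sigma_1)$ are unitaries onto objects localized in spacelike separated double cones and $\theta$ is the permutation matrix exchanging the two indices. An object $\rho$ is *irreducible* if $(\rho,\rho)=\mathbb C1_\rho$, *faithful* if it is injective on $\mathfrak A$, and *simple* if $\varepsilon(\rho,\rho)=\pm1_{\rho^2}$. Let $\varepsilon^d_\rho$ be the representation of the group of permutations of $d$ elements in $(\rho^d,\rho^d)$ that sends the transposition of $i$ and $i+1$ to $1_{\rho^{i-1}}\times\varepsilon(\rho,\rho)\times1_{\rho^{d-i-1}}$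 ($1\le i<d$), and let $A_d=\frac1{d!}\sum_p\operatorname{sign}(p)\,\varepsilon^d_\rho(p)$ and $S_d=\frac1{d!}\sum_p\varepsilon^d_\rho(p)$. An object has *finite statistics* if it is a direct sum of finitely many (at least one) irreducible objects $\rho$ for each of which there are an integer $d\ge1$, a faithful simple object $\gamma$ and an isometry $V\in(\gamma,\rho^d)$ with $VV^+=A_d$ or $VV^+=S_d$. A *left inverse* $\Psi$ of $\rho$ is a family of linear maps $\Psi_{\sigma,\tau}:(\rho\sigma,\rho\tau)\to(\sigma,\tau)$, for objects $\sigma,\tau$, with $\Psi_{\sigma',\tau'}\big((1_\rho\times T)X(1_\rho\times S^+)\big)=T\,\Psi_{\sigma,\tau}(X)\,S^+$ for $S\in(\sigma,\sigma')$, $T\in(\tau,\tau')$, $\Psi_{\sigma\pi,\tau\pi}(X\times1_\pi)=\Psi_{\sigma,\tau}(X)\times1_\pi$, every $\Psi_{\sigma,\sigma}$ positive, and $\Psi_{\iota,\iota}(1_\rho)=1_\iota$. **Proposition.** Let $\rho$ be an irreducible object. The following assertions are equivalent: a) $\rho$ has finite statistics; b) $\rho$ is faithful, and for each left inverse $\Psi$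 of $\rho$ there is $\lambda\in\mathbb C$, $\lambda\ne0$, with $\Psi_{\rho,\rho}(\varepsilon(\rho,\rho))=\lambda\cdot1_\rho$. -/

import Mathlib

open scoped Matrix

noncomputable section

/-! ## Bimodules of a *-algebra and their intertwiners -/

/-- A bimodule of the *-algebra `A`: a (not necessarily unital) *-morphism
`ρ : A → A ⊗ M_n`, the matrix units being labelled by a finite type `ι` with `n` elements.
Labelling by finite types makes the lexicographic order of the tensor product a product of
label types. -/
structure Bimodule (A : Type*) [Ring A] [StarRing A] [Algebra ℂ A] where
  ι : Type
  [fin : Fintype ι]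
  hom : A →⋆ₙₐ[ℂ] Matrix ι ι A

attribute [instance] Bimodule.fin

namespace Bimodule

variable {A : Type*} [Ring A] [StarRing A] [Algebra ℂ A]

/-- The arrows `(ρ, σ)`: matrices `T` over `A` with `T ρ(1) = T = σ(1) T` and
`T ρ(a) = σ(a) T` for all `a`. -/
def Hom (ρ σ : Bimodule A) : Submodule ℂ (Matrix σ.ι ρ.ι A) where
  carrier := {T | T * ρ.hom 1 = T ∧ σ.hom 1 * T = T ∧ ∀ a, T * ρ.hom a = σ.hom a * T}
  add_mem' := by
    rintro S T ⟨h1, h2, h3⟩ ⟨k1, k2, k3⟩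
    exact ⟨by rw [Matrix.add_mul, h1, k1], by rw [Matrix.mul_add, h2, k2],
      fun a => by rw [Matrix.add_mul, Matrix.mul_add, h3, k3]⟩
  zero_mem' := ⟨Matrix.zero_mul _, Matrix.mul_zero _,
    fun a => by rw [Matrix.zero_mul, Matrix.mul_zero]⟩
  smul_mem' := by
    rintro c T ⟨h1, h2, h3⟩
    exact ⟨by rw [Matrix.smul_mul, h1], by rw [Matrix.mul_smul, h2],
      fun a => by rw [Matrix.smul_mul, Matrix.mul_smul, h3]⟩

/-- The identity arrow `1_ρ = ρ(1)`. -/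
def one (ρ : Bimodule A) : Hom ρ ρ :=
  ⟨ρ.hom 1, by rw [← map_mul, one_mul], by rw [← map_mul, one_mul],
    fun a => by rw [← map_mul, ← map_mul, one_mul, mul_one]⟩

/-- Composition of arrows, `comp S T = S · T`. -/
def comp {ρ σ τ : Bimodule A} (S : Hom σ τ) (T : Hom ρ σ) : Hom ρ τ :=
  ⟨S.1 * T.1, by rw [Matrix.mul_assoc, T.2.1], by rw [← Matrix.mul_assoc, S.2.2.1],
    fun a => by rw [Matrix.mul_assoc, T.2.2.2, ← Matrix.mul_assoc, S.2.2.2, Matrix.mul_assoc]⟩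

/-- The adjoint arrow `T⁺`. -/
def adj {ρ σ : Bimodule A} (T : Hom ρ σ) : Hom σ ρ :=
  ⟨T.1ᴴ,
    by
      have h := congrArg Matrix.conjTranspose T.2.2.1
      rwa [Matrix.conjTranspose_mul, ← Matrix.star_eq_conjTranspose (σ.hom 1), ← map_star,
        star_one] at h,
    by
      have h := congrArg Matrix.conjTranspose T.2.1
      rwa [Matrix.conjTranspose_mul, ← Matrix.star_eq_conjTranspose (ρ.hom 1), ← map_star,
        star_one] at h,
    fun a => by
      have h := congrArg Matrix.conjTranspose (T.2.2.2 (star a))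
      rw [Matrix.conjTranspose_mul, Matrix.conjTranspose_mul,
        ← Matrix.star_eq_conjTranspose (σ.hom _), ← map_star,
        ← Matrix.star_eq_conjTranspose (ρ.hom _), ← map_star, star_star] at h
      exact h.symm⟩

/-- The identity object `ι(a) = a`. -/
abbrev unit (A : Type*) [Ring A] [StarRing A] [Algebra ℂ A] : Bimodule A where
  ι := Unit
  hom :=
    { toFun := fun a => Matrix.of fun _ _ => a
      map_smul' := fun _ _ => rfl
      map_zero' := rfl
      map_add' := fun _ _ => rfl
      map_mul' := fun a b => by ext; simp [Matrix.mul_apply]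
      map_star' := fun a => by ext; simp [Matrix.star_apply] }

/-- The tensor product of objects, `ρσ(a)_{ij} = ρ(σ(a)_{i₂j₂})_{i₁j₁}`. -/
abbrev tensor (ρ σ : Bimodule A) : Bimodule A where
  ι := ρ.ι × σ.ι
  hom :=
    { toFun := fun a => Matrix.of fun i j => ρ.hom (σ.hom a i.2 j.2) i.1 j.1
      map_smul' := fun c a => by ext; simp
      map_zero' := by ext; simp
      map_add' := fun a b => by ext; simp
      map_mul' := fun a b => by
        ext i j
        simp only [map_mul, Matrix.of_apply, Matrix.mul_apply, map_sum, Matrix.sum_apply]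
        rw [Fintype.sum_prod_type_right]
      map_star' := fun a => by
        ext i j
        simp only [Matrix.of_apply, Matrix.star_apply, map_star] }

/-- The `(i₂, j₂)` block of a matrix indexed by products. -/
def block {A : Type*} {κ κ' l l' : Type} (M : Matrix (κ' × l') (κ × l) A) (i : l') (j : l) : Matrix κ' κ A :=
  M.submatrix (fun x => (x, i)) (fun x => (x, j))

theorem block_ext {A : Type*} {κ κ' l l' : Type} {M N : Matrix (κ' × l') (κ × l) A}
    (h : ∀ i j, block M i j = block N i j) : M = N := by
  ext ⟨i1, i2⟩ ⟨j1, j2⟩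
  exact congrFun (congrFun (h i2 j2) i1) j1

theorem block_mul {A : Type*} [Ring A] {κ κ' κ'' l l' l'' : Type} [Fintype κ'] [Fintype l']
    (M : Matrix (κ'' × l'') (κ' × l') A) (N : Matrix (κ' × l') (κ × l) A) (i : l'') (j : l) :
    block (M * N) i j = ∑ k, block M i k * block N k j := by
  ext x y
  simp [block, Matrix.mul_apply, Matrix.sum_apply, Fintype.sum_prod_type_right]

theorem block_tensor (ρ σ : Bimodule A) (a : A) (i j : σ.ι) :
    block ((tensor ρ σ).hom a) i j = ρ.hom (σ.hom a i j) := rfl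

/-- The matrix of `T × S`, `(T × S)_{ij} = ∑ₖ T_{i₁k} ρ(S_{i₂j₂})_{k j₁}` for `T ∈ (ρ, ρ')`. -/
def timesMatrix {ρ ρ' σ σ' : Bimodule A} (T : Hom ρ ρ') (S : Hom σ σ') :
    Matrix (tensor ρ' σ').ι (tensor ρ σ).ι A :=
  Matrix.of fun i j => ∑ k, T.1 i.1 k * ρ.hom (S.1 i.2 j.2) k j.1

theorem block_times {ρ ρ' σ σ' : Bimodule A} (T : Hom ρ ρ') (S : Hom σ σ') (i : σ'.ι) (j : σ.ι) :
    block (timesMatrix T S) i j = T.1 * ρ.hom (S.1 i j) := by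
  ext x y
  exact (Matrix.mul_apply (M := T.1) (N := ρ.hom (S.1 i j))).symm

theorem times_intertwines {ρ ρ' σ σ' : Bimodule A} (T : Hom ρ ρ') (S : Hom σ σ') (a : A) :
    timesMatrix T S * (tensor ρ σ).hom a = (tensor ρ' σ').hom a * timesMatrix T S := by
  refine block_ext fun i j => ?_
  rw [block_mul (κ' := ρ.ι) (l' := σ.ι), block_mul (κ' := ρ'.ι) (l' := σ'.ι)]
  have h := congrFun (congrFun (S.2.2.2 a) i) j
  rw [Matrix.mul_apply, Matrix.mul_apply] at h
  have h' := congrArg (fun x => T.1 * ρ.hom x) h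
  simp only [map_sum, map_mul, Matrix.mul_sum] at h'
  calc _ = ∑ k, T.1 * (ρ.hom (S.1 i k) * ρ.hom (σ.hom a k j)) := by
        refine Finset.sum_congr rfl fun k _ => ?_
        rw [block_times, block_tensor, Matrix.mul_assoc]
    _ = ∑ k, T.1 * (ρ.hom (σ'.hom a i k) * ρ.hom (S.1 k j)) := h'
    _ = _ := by
        refine Finset.sum_congr rfl fun k _ => ?_
        rw [block_times, block_tensor, ← Matrix.mul_assoc, T.2.2.2, Matrix.mul_assoc]

/-- The tensor product `T × S` of arrows. -/
def times {ρ ρ' σ σ' : Bimodule A} (T : Hom ρ ρ') (S : Hom σ σ') :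
    Hom (tensor ρ σ) (tensor ρ' σ') :=
  ⟨timesMatrix T S,
    by
      refine block_ext fun i j => ?_
      rw [block_mul (κ' := ρ.ι) (l' := σ.ι)]
      have h := congrFun (congrFun S.2.1 i) j
      rw [Matrix.mul_apply] at h
      have h' := congrArg (fun x => T.1 * ρ.hom x) h
      simp only [map_sum, map_mul, Matrix.mul_sum] at h'
      rw [block_times, ← h']
      refine Finset.sum_congr rfl fun k _ => ?_
      rw [block_times, block_tensor, Matrix.mul_assoc],
    by
      refine block_ext fun i j => ?_
      rw [block_mul (κ' := ρ'.ι) (l' := σ'.ι)]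
      have h := congrFun (congrFun S.2.2.1 i) j
      rw [Matrix.mul_apply] at h
      have h' := congrArg (fun x => T.1 * ρ.hom x) h
      simp only [map_sum, map_mul, Matrix.mul_sum] at h'
      rw [block_times, ← h']
      refine Finset.sum_congr rfl fun k _ => ?_
      rw [block_times, block_tensor, ← Matrix.mul_assoc, ← T.2.2.2, Matrix.mul_assoc],
    times_intertwines T S⟩

/-- The tensor product is associative up to relabelling `(κ × l) × m ≃ κ × (l × m)`; this is the
corresponding identification of arrows. -/
def reassoc {ρ σ τ ρ' σ' τ' : Bimodule A}
    (T : Hom (tensor (tensor ρ σ) τ) (tensor (tensor ρ' σ') τ')) :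
    Hom (tensor ρ (tensor σ τ)) (tensor ρ' (tensor σ' τ')) :=
  have key : ∀ (α β γ : Bimodule A) (a : A), (tensor α (tensor β γ)).hom a =
      ((tensor (tensor α β) γ).hom a).submatrix (Equiv.prodAssoc _ _ _).symm
        (Equiv.prodAssoc _ _ _).symm := fun _ _ _ _ => rfl
  ⟨T.1.submatrix (Equiv.prodAssoc _ _ _).symm (Equiv.prodAssoc _ _ _).symm,
    by rw [key, Matrix.submatrix_mul_equiv, T.2.1],
    by rw [key, Matrix.submatrix_mul_equiv, T.2.2.1],
    fun a => by rw [key, key, Matrix.submatrix_mul_equiv, Matrix.submatrix_mul_equiv, T.2.2.2]⟩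

/-- The powers `ρ^n`. -/
def pow (ρ : Bimodule A) : ℕ → Bimodule A
  | 0 => unit A
  | n + 1 => tensor ρ (pow ρ n)

/-- `V` is an isometry: `V⁺ V = 1_ρ`. -/
def IsIsometry {ρ σ : Bimodule A} (V : Hom ρ σ) : Prop := comp (adj V) V = one ρ

/-- `V` is unitary: `V⁺ V = 1_ρ` and `V V⁺ = 1_σ`. -/
def IsUnitary {ρ σ : Bimodule A} (V : Hom ρ σ) : Prop :=
  comp (adj V) V = one ρ ∧ comp V (adj V) = one σ

/-- `ρ` is irreducible: `(ρ, ρ) = ℂ 1_ρ`. -/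
def IsIrreducible (ρ : Bimodule A) : Prop := ∀ T : Hom ρ ρ, ∃ c : ℂ, T = c • one ρ

/-- `ρ` is faithful: it is an injective morphism of `A`. -/
def IsFaithful (ρ : Bimodule A) : Prop := Function.Injective ρ.hom

end Bimodule

namespace Bimodule

variable {A : Type*} [Ring A] [StarRing A] [Algebra ℂ A]

theorem comp_times {ρ ρ' ρ'' σ σ' σ'' : Bimodule A} (T' : Hom ρ' ρ'') (T : Hom ρ ρ')
    (S' : Hom σ' σ'') (S : Hom σ σ') :
    comp (times T' S') (times T S) = times (comp T' T) (comp S' S) := by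
  refine Subtype.ext (block_ext fun i j => ?_)
  refine (block_mul (κ' := ρ'.ι) (l' := σ'.ι) _ _ i j).trans ?_
  refine Eq.trans ?_ (block_times (comp T' T) (comp S' S) i j).symm
  refine Eq.trans (Finset.sum_congr (g := fun k =>
    T'.1 * T.1 * (ρ.hom (S'.1 i k) * ρ.hom (S.1 k j))) rfl fun k _ => ?_) ?_
  · refine (congrArg₂ (· * ·) (block_times T' S' i k) (block_times T S k j)).trans ?_
    show T'.1 * ρ'.hom (S'.1 i k) * (T.1 * ρ.hom (S.1 k j)) = _
    rw [Matrix.mul_assoc, ← Matrix.mul_assoc (ρ'.hom _), ← T.2.2.2]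
    simp only [Matrix.mul_assoc]
  · rw [← Matrix.mul_sum]
    simp only [← map_mul]
    rw [← map_sum, ← Matrix.mul_apply]
    rfl

theorem adj_times {ρ ρ' σ σ' : Bimodule A} (T : Hom ρ ρ') (S : Hom σ σ') :
    adj (times T S) = times (adj T) (adj S) := by
  refine Subtype.ext (block_ext fun i j => ?_)
  refine Eq.trans ?_ (block_times (adj T) (adj S) i j).symm
  have h : block (adj (times T S)).1 i j = (block (times T S).1 j i)ᴴ := rfl
  refine (h.trans (congrArg _ (block_times T S j i))).trans ?_
  rw [Matrix.conjTranspose_mul, ← Matrix.star_eq_conjTranspose (ρ.hom _), ← map_star]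
  exact ((adj T).2.2.2 _).symm

theorem isUnitary_one (ρ : Bimodule A) : IsUnitary (one ρ) := by
  have h : adj (one ρ) = one ρ := Subtype.ext (by
    show (ρ.hom 1)ᴴ = ρ.hom 1
    rw [← Matrix.star_eq_conjTranspose, ← map_star, star_one])
  have h' : comp (one ρ) (one ρ) = one ρ := Subtype.ext (by
    show ρ.hom 1 * ρ.hom 1 = ρ.hom 1
    rw [← map_mul, one_mul])
  exact ⟨by rw [h, h'], by rw [h, h']⟩

theorem times_one (ρ σ : Bimodule A) : times (one ρ) (one σ) = one (tensor ρ σ) := by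
  refine Subtype.ext (block_ext fun i j => ?_)
  refine (block_times (one ρ) (one σ) i j).trans ?_
  show ρ.hom 1 * ρ.hom _ = _
  rw [← map_mul, one_mul]
  rfl

theorem IsUnitary.times {ρ ρ' σ σ' : Bimodule A} {T : Hom ρ ρ'} {S : Hom σ σ'}
    (hT : IsUnitary T) (hS : IsUnitary S) : IsUnitary (times T S) :=
  ⟨by rw [adj_times, comp_times, hT.1, hS.1, times_one],
    by rw [adj_times, comp_times, hT.2, hS.2, times_one]⟩

end Bimodule

/-! ## Double cones in Minkowski space -/

/-- Four-dimensional Minkowski space, as time and space coordinates. -/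
abbrev Minkowski := ℝ × EuclideanSpace ℝ (Fin 3)

/-- The open forward light cone. -/
def forwardCone : Set Minkowski := {v | ‖v.2‖ < v.1}

/-- Spacelike vectors. -/
def IsSpacelike (v : Minkowski) : Prop := |v.1| < ‖v.2‖

/-- Open double cones `(x + V₊) ∩ (y - V₊)` with `y - x ∈ V₊`. -/
def DoubleCone : Type :=
  {s : Set Minkowski // ∃ x y : Minkowski, y - x ∈ forwardCone ∧
    s = {z | z - x ∈ forwardCone ∧ y - z ∈ forwardCone}}

namespace DoubleCone

/-- Spacelike separation `a ⊥ b`. -/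
def Perp (a b : DoubleCone) : Prop := ∀ x ∈ a.1, ∀ y ∈ b.1, IsSpacelike (x - y)

theorem Perp.symm {a b : DoubleCone} (h : Perp a b) : Perp b a := fun x hx y hy => by
  have := h y hy x hx
  rwa [IsSpacelike, ← neg_sub x y, Prod.fst_neg, Prod.snd_neg, abs_neg, norm_neg] at this

theorem Perp.mono {a b a' b' : DoubleCone} (h : Perp a b) (ha : a'.1 ⊆ a.1) (hb : b'.1 ⊆ b.1) :
    Perp a' b' := fun x hx y hy => h x (ha hx) y (hb hy)

/-- The double cone with base the ball of centre `x` and radius `r` at time zero. -/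
def diamond (x : EuclideanSpace ℝ (Fin 3)) (r : ℝ) (hr : 0 < r) : DoubleCone :=
  ⟨{z | |z.1| + ‖z.2 - x‖ < r}, (-r, x), (r, x), by simp [forwardCone, hr], by
    ext z
    simp only [forwardCone, Set.mem_ofPred_eq, Prod.fst_sub, Prod.snd_sub]
    rw [norm_sub_rev x z.2]
    constructor
    · intro h
      have := abs_le.1 (le_refl |z.1|)
      constructor <;> linarith
    · rintro ⟨h1, h2⟩
      rcases abs_cases z.1 with h | h <;> linarith⟩

theorem diamond_subset {x y : EuclideanSpace ℝ (Fin 3)} {r s : ℝ} (hr : 0 < r) (hs : 0 < s)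
    (h : ‖x - y‖ + r ≤ s) : (diamond x r hr).1 ⊆ (diamond y s hs).1 := fun z hz => by
  have hz' : |z.1| + ‖z.2 - x‖ < r := hz
  have := norm_sub_le_norm_sub_add_norm_sub z.2 x y
  show |z.1| + ‖z.2 - y‖ < s
  linarith

theorem diamond_perp {x y : EuclideanSpace ℝ (Fin 3)} {r s : ℝ} (hr : 0 < r) (hs : 0 < s)
    (h : r + s ≤ ‖x - y‖) : Perp (diamond x r hr) (diamond y s hs) := fun z hz w hw => by
  have hz' : |z.1| + ‖z.2 - x‖ < r := hz
  have hw' : |w.1| + ‖w.2 - y‖ < s := hw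
  have h1 := norm_sub_le_norm_sub_add_norm_sub x z.2 y
  have h2 := norm_sub_le_norm_sub_add_norm_sub z.2 w.2 y
  have h3 := abs_sub z.1 w.1
  rw [norm_sub_rev x z.2] at h1
  show |z.1 - w.1| < ‖z.2 - w.2‖
  linarith

theorem exists_subset_diamond (a : DoubleCone) :
    ∃ R : ℝ, 0 < R ∧ ∀ s (hs : 0 < s), R ≤ s → a.1 ⊆ (diamond 0 s hs).1 := by
  obtain ⟨s, x, y, hxy, rfl⟩ := a
  have hxy' : ‖y.2 - x.2‖ < y.1 - x.1 := hxy
  have h0 := norm_nonneg (y.2 - x.2)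
  refine ⟨|x.1| + |y.1| + ‖x.2‖ + (y.1 - x.1), by linarith [abs_nonneg x.1, abs_nonneg y.1, norm_nonneg x.2], ?_⟩
  rintro s hs hR z ⟨h1, h2⟩
  have h1' : ‖z.2 - x.2‖ < z.1 - x.1 := h1
  have h2' : ‖y.2 - z.2‖ < y.1 - z.1 := h2
  show |z.1| + ‖z.2 - 0‖ < s
  have h3 := norm_sub_le_norm_sub_add_norm_sub z.2 x.2 0
  have h4 := norm_nonneg (y.2 - z.2)
  have h5 := norm_nonneg (z.2 - x.2)
  rw [sub_zero x.2] at h3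
  have h6 : |z.1| ≤ |x.1| + |y.1| := by
    have := neg_abs_le x.1
    have := le_abs_self y.1
    have := abs_nonneg x.1
    have := abs_nonneg y.1
    exact abs_le.2 ⟨by linarith, by linarith⟩
  linarith

theorem exists_union_subset (a b : DoubleCone) : ∃ c : DoubleCone, a.1 ⊆ c.1 ∧ b.1 ⊆ c.1 := by
  obtain ⟨R, hR, h⟩ := exists_subset_diamond a
  obtain ⟨S, hS, k⟩ := exists_subset_diamond b
  have : 0 < R + S := by linarith
  exact ⟨diamond 0 (R + S) this, h _ this (by linarith), k _ this (by linarith)⟩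

end DoubleCone

/-! ## Nets of local observables -/

/-- A net of local observables in an irreducible representation fulfilling Haag duality. -/
structure LocalNet (H : Type*) [NormedAddCommGroup H] [InnerProductSpace ℂ H]
    [CompleteSpace H] where
  /-- The von Neumann algebra of observables measurable within a double cone. -/
  alg : DoubleCone → VonNeumannAlgebra H
  isotony : ∀ a b : DoubleCone, a.1 ⊆ b.1 → (alg a : Set (H →L[ℂ] H)) ⊆ alg b
  locality : ∀ a b : DoubleCone, DoubleCone.Perp a b →
    (alg a : Set (H →L[ℂ] H)) ⊆ Set.centralizer (alg b)
  /-- The commutant of the algebra of the spacelike complement of `a` is the algebra of `a`. -/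
  haag_duality : ∀ a : DoubleCone,
    Set.centralizer (⋃ b ∈ {b | DoubleCone.Perp b a}, (alg b : Set (H →L[ℂ] H))) = alg a
  irreducible : Set.centralizer (⋃ a, (alg a : Set (H →L[ℂ] H))) =
    Set.range fun c : ℂ => c • (1 : H →L[ℂ] H)

namespace LocalNet

variable {H : Type*} [NormedAddCommGroup H] [InnerProductSpace ℂ H] [CompleteSpace H]
variable (N : LocalNet H)

/-- The C*-algebra generated by all the local algebras. -/
def globalAlg : StarSubalgebra ℂ (H →L[ℂ] H) :=
  (⨆ a, (N.alg a).toStarSubalgebra).topologicalClosure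

/-- Morphisms of the C*-algebra into `B(H) ⊗ M_n`, with `n` the number of elements of `κ`. -/
abbrev Mor (κ : Type) [Fintype κ] := N.globalAlg →⋆ₙₐ[ℂ] Matrix κ κ (H →L[ℂ] H)

variable {N}

/-- `τ` is localized in `o`: `τ(A) = (A ⊗ 1) τ(1)` for `A` in the algebra of any `a ⊥ o`. -/
def IsLocalizedIn {κ : Type} [Fintype κ] (τ : N.Mor κ) (o : DoubleCone) : Prop :=
  ∀ a, DoubleCone.Perp a o → ∀ A : N.globalAlg, (A : H →L[ℂ] H) ∈ N.alg a →
    ∀ i j, τ A i j = A * τ 1 i j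

/-- `T` is an intertwiner between the morphisms `τ` and `τ'`. -/
def IsIntertwiner {κ κ' : Type} [Fintype κ] [Fintype κ'] (τ : N.Mor κ) (τ' : N.Mor κ')
    (T : Matrix κ' κ (H →L[ℂ] H)) : Prop :=
  T * τ 1 = T ∧ τ' 1 * T = T ∧ ∀ A, T * τ A = τ' A * T

/-- `τ` is transportable: for each `o` there are a morphism localized in `o` and a unitary
intertwiner from `τ` to it. -/
def IsTransportable {κ : Type} [Fintype κ] (τ : N.Mor κ) : Prop :=
  ∀ o : DoubleCone, ∃ (κ' : Type) (_ : Fintype κ') (τ' : N.Mor κ') (U : Matrix κ' κ (H →L[ℂ] H)),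
    IsLocalizedIn τ' o ∧ IsIntertwiner τ τ' U ∧ Uᴴ * U = τ 1 ∧ U * Uᴴ = τ' 1

/-- The inclusion of matrices over the C*-algebra in matrices of operators. -/
def ops {κ κ' : Type} (T : Matrix κ' κ N.globalAlg) : Matrix κ' κ (H →L[ℂ] H) :=
  Matrix.of fun i j => (T i j : H →L[ℂ] H)

theorem ops_injective {κ κ' : Type} {S T : Matrix κ' κ N.globalAlg} (h : ops S = ops T) :
    S = T := by
  ext1 i j
  exact Subtype.ext (congrFun (congrFun h i) j)

theorem ops_mul {κ κ' κ'' : Type} [Fintype κ'] (S : Matrix κ'' κ' N.globalAlg)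
    (T : Matrix κ' κ N.globalAlg) : ops (S * T) = ops S * ops T := by
  ext1 i j
  simp [ops, Matrix.mul_apply]

theorem ops_conjTranspose {κ κ' : Type} (T : Matrix κ' κ N.globalAlg) : ops Tᴴ = (ops T)ᴴ := by
  ext1 i j
  rfl

/-- A bimodule regarded as a morphism into `B(H) ⊗ M_n`. -/
def toMor (ρ : Bimodule N.globalAlg) : N.Mor ρ.ι where
  toFun A := ops (ρ.hom A)
  map_smul' c A := by ext1 i j; simp [ops]
  map_zero' := by ext1 i j; simp [ops]
  map_add' A B := by ext1 i j; simp [ops]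
  map_mul' A B := by rw [map_mul, ops_mul]
  map_star' A := by rw [map_star, Matrix.star_eq_conjTranspose, ops_conjTranspose]; rfl

theorem mem_globalAlg {a : DoubleCone} {A : H →L[ℂ] H} (h : A ∈ N.alg a) : A ∈ N.globalAlg :=
  StarSubalgebra.le_topologicalClosure _
    ((le_iSup (fun a => (N.alg a).toStarSubalgebra) a) h)

theorem isClosed_globalAlg (N : LocalNet H) : IsClosed (N.globalAlg : Set (H →L[ℂ] H)) :=
  StarSubalgebra.isClosed_topologicalClosure _

theorem dense_local (N : LocalNet H) : Dense {A : N.globalAlg | ∃ a, (A : H →L[ℂ] H) ∈ N.alg a} := by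
  have hne : Nonempty DoubleCone := ⟨DoubleCone.diamond 0 1 one_pos⟩
  have dir : Directed (· ≤ ·) fun a => (N.alg a).toStarSubalgebra := fun a b => by
    obtain ⟨c, hc, hc'⟩ := DoubleCone.exists_union_subset a b
    exact ⟨c, N.isotony a c hc, N.isotony b c hc'⟩
  rw [Subtype.dense_iff]
  intro A hA
  have hA' : A ∈ closure ((⨆ a, (N.alg a).toStarSubalgebra :
      StarSubalgebra ℂ (H →L[ℂ] H)) : Set (H →L[ℂ] H)) := hA
  refine closure_mono ?_ hA'
  rw [StarSubalgebra.coe_iSup_of_directed dir]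
  intro B hB
  obtain ⟨a, ha⟩ := Set.mem_iUnion.1 hB
  exact ⟨⟨B, mem_globalAlg ha⟩, ⟨a, ha⟩, rfl⟩

theorem Mor.continuous_entry {κ : Type} [Fintype κ] (τ : N.Mor κ) (i j : κ) :
    Continuous fun A => τ A i j := by
  classical
  let _ : CStarAlgebra N.globalAlg :=
    StarSubalgebra.cstarAlgebra N.globalAlg (h_closed := N.isClosed_globalAlg)
  let f : N.globalAlg →⋆ₙₐ[ℂ] CStarMatrix κ κ (H →L[ℂ] H) :=
    { toFun := fun A => CStarMatrix.ofMatrix (τ A)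
      map_smul' := fun c A => by rw [map_smul]; rfl
      map_zero' := by rw [map_zero]; rfl
      map_add' := fun A B => by rw [map_add]; rfl
      map_mul' := fun A B => by rw [map_mul]; rfl
      map_star' := fun A => by rw [map_star]; rfl }
  let g : N.globalAlg →+ (H →L[ℂ] H) :=
    { toFun := fun A => τ A i j
      map_zero' := by rw [map_zero]; rfl
      map_add' := fun A B => by rw [map_add]; rfl }
  refine AddMonoidHomClass.continuous_of_bound g 1 fun A => ?_
  rw [one_mul]
  exact (CStarMatrix.norm_entry_le_norm (M := f A) (i := i) (j := j)).trans
    (NonUnitalStarAlgHom.norm_apply_le f A)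

section Localized

variable {κ κ' : Type} [Fintype κ] [Fintype κ']

theorem IsLocalizedIn.right {τ : N.Mor κ} {o a : DoubleCone} (h : IsLocalizedIn τ o)
    (ha : DoubleCone.Perp a o) (A : N.globalAlg) (hA : (A : H →L[ℂ] H) ∈ N.alg a) (i j : κ) :
    τ A i j = τ 1 i j * A := by
  have h1 := h a ha (star A) ((N.alg a).star_mem' hA) j i
  have h2 := congrArg star h1
  rw [map_star, Matrix.star_apply, star_star, star_mul, ← Matrix.star_apply, ← map_star,
    star_one] at h2
  simpa using h2

theorem IsLocalizedIn.mem {τ : N.Mor κ} {o a : DoubleCone} (h : IsLocalizedIn τ o)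
    (hoa : o.1 ⊆ a.1) (A : N.globalAlg) (hA : (A : H →L[ℂ] H) ∈ N.alg a) (i j : κ) :
    τ A i j ∈ N.alg a := by
  rw [← SetLike.mem_coe, ← N.haag_duality a]
  intro B hB
  obtain ⟨b, hb, hB⟩ := Set.mem_iUnion₂.1 hB
  let B' : N.globalAlg := ⟨B, mem_globalAlg hB⟩
  have hbo := DoubleCone.Perp.mono hb (subset_refl _) hoa
  have comm : B' * A = A * B' := Subtype.ext (N.locality b a hb hB A hA).symm
  have h1 : τ (B' * A) i j = B * τ A i j := by
    rw [map_mul, Matrix.mul_apply]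
    simp_rw [h b hbo B' hB, mul_assoc]
    rw [← Finset.mul_sum, ← Matrix.mul_apply, ← map_mul, one_mul]
  have h2 : τ (A * B') i j = τ A i j * B := by
    rw [map_mul, Matrix.mul_apply]
    simp_rw [h.right hbo B' hB, ← mul_assoc]
    rw [← Finset.sum_mul, ← Matrix.mul_apply, ← map_mul, mul_one]
  rw [← h1, ← h2, comm]

theorem IsLocalizedIn.mem_globalAlg {τ : N.Mor κ} {o : DoubleCone} (h : IsLocalizedIn τ o)
    (A : N.globalAlg) (i j : κ) : τ A i j ∈ N.globalAlg := by
  have hc : IsClosed {A : N.globalAlg | τ A i j ∈ (N.globalAlg : Set (H →L[ℂ] H))} :=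
    N.isClosed_globalAlg.preimage (τ.continuous_entry i j)
  refine (closure_minimal ?_ hc) (N.dense_local A)
  rintro B ⟨b, hB⟩
  obtain ⟨c, hc, hc'⟩ := DoubleCone.exists_union_subset o b
  exact LocalNet.mem_globalAlg (h.mem hc B (N.isotony b c hc' hB) i j)

theorem IsIntertwiner.mem {τ : N.Mor κ} {τ' : N.Mor κ'} {o o' a : DoubleCone}
    (h : IsLocalizedIn τ o) (h' : IsLocalizedIn τ' o') (hoa : o.1 ⊆ a.1) (hoa' : o'.1 ⊆ a.1)
    {T : Matrix κ' κ (H →L[ℂ] H)} (hT : IsIntertwiner τ τ' T) (i : κ') (j : κ) :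
    T i j ∈ N.alg a := by
  rw [← SetLike.mem_coe, ← N.haag_duality a]
  intro B hB
  obtain ⟨b, hb, hB⟩ := Set.mem_iUnion₂.1 hB
  let B' : N.globalAlg := ⟨B, LocalNet.mem_globalAlg hB⟩
  have hbo := DoubleCone.Perp.mono hb (subset_refl _) hoa
  have hbo' := DoubleCone.Perp.mono hb (subset_refl _) hoa'
  have h1 : (τ' B' * T) i j = B * T i j := by
    conv_rhs => rw [← hT.2.1]
    rw [Matrix.mul_apply, Matrix.mul_apply, Finset.mul_sum]
    exact Finset.sum_congr rfl fun k _ => by rw [h' b hbo' B' hB, mul_assoc]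
  have h2 : (T * τ B') i j = T i j * B := by
    conv_rhs => rw [← hT.1]
    rw [Matrix.mul_apply, Matrix.mul_apply, Finset.sum_mul]
    exact Finset.sum_congr rfl fun k _ => by rw [h.right hbo B' hB, mul_assoc]
  rw [← h1, ← h2, hT.2.2]

/-- A localized morphism has values in matrices over the C*-algebra, so it is a bimodule. -/
def IsLocalizedIn.toBimodule {τ : N.Mor κ} {o : DoubleCone} (h : IsLocalizedIn τ o) :
    Bimodule N.globalAlg where
  ι := κ
  hom :=
    { toFun := fun A => Matrix.of fun i j => ⟨τ A i j, h.mem_globalAlg A i j⟩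
      map_smul' := fun c A => ops_injective (by ext1 i j; simp [ops])
      map_zero' := ops_injective (by ext1 i j; simp [ops])
      map_add' := fun A B => ops_injective (by ext1 i j; simp [ops])
      map_mul' := fun A B => ops_injective (by
        rw [ops_mul]; ext1 i j; simp [ops, Matrix.mul_apply])
      map_star' := fun A => ops_injective (by
        rw [Matrix.star_eq_conjTranspose, ops_conjTranspose]
        ext1 i j; simp [ops, Matrix.conjTranspose_apply, map_star, Matrix.star_apply]) }

end Localized

theorem isIntertwiner_ops {ρ σ : Bimodule N.globalAlg} (T : Bimodule.Hom ρ σ) :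
    IsIntertwiner (toMor ρ) (toMor σ) (ops T.1) :=
  ⟨(ops_mul _ _).symm.trans (congrArg ops T.2.1), (ops_mul _ _).symm.trans (congrArg ops T.2.2.1),
    fun A => (ops_mul _ _).symm.trans ((congrArg ops (T.2.2.2 A)).trans (ops_mul _ _))⟩

/-- A localized transportable bimodule of the net: an object of the category of the theory. The
arrows between two objects are their intertwiners as bimodules. -/
structure Obj (N : LocalNet H) extends Bimodule N.globalAlg where
  localized : ∃ o, IsLocalizedIn (toMor toBimodule) o
  transportable : IsTransportable (toMor toBimodule)

theorem IsTransportable.of_unitary {κ₀ κ : Type} [Fintype κ₀] [Fintype κ] {ρ : N.Mor κ₀}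
    (hρ : IsTransportable ρ) {τ : N.Mor κ} {U : Matrix κ κ₀ (H →L[ℂ] H)}
    (hU : IsIntertwiner ρ τ U) (hU1 : Uᴴ * U = ρ 1) (hU2 : U * Uᴴ = τ 1) :
    IsTransportable τ := fun b => by
  obtain ⟨κ', i', τ', W, h1, h2, h3, h4⟩ := hρ b
  have e1 : Uᴴ * τ 1 = Uᴴ := by
    rw [← hU2, ← Matrix.mul_assoc, hU1, ← Matrix.conjTranspose_inj,
      Matrix.conjTranspose_mul, Matrix.conjTranspose_conjTranspose,
      ← Matrix.star_eq_conjTranspose (ρ 1), ← map_star, star_one, hU.1]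
  have e2 : ∀ A, Uᴴ * τ A = ρ A * Uᴴ := fun A => by
    have := congrArg Matrix.conjTranspose (hU.2.2 (star A))
    rw [Matrix.conjTranspose_mul, Matrix.conjTranspose_mul,
      ← Matrix.star_eq_conjTranspose (τ _), ← map_star,
      ← Matrix.star_eq_conjTranspose (ρ _), ← map_star, star_star] at this
    exact this.symm
  refine ⟨κ', i', τ', W * Uᴴ, h1, ⟨by rw [Matrix.mul_assoc, e1],
    by rw [← Matrix.mul_assoc, h2.2.1], fun A => ?_⟩, ?_, ?_⟩
  · rw [Matrix.mul_assoc, e2, ← Matrix.mul_assoc, h2.2.2, Matrix.mul_assoc]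
  · rw [Matrix.conjTranspose_mul, Matrix.conjTranspose_conjTranspose, Matrix.mul_assoc,
      ← Matrix.mul_assoc Wᴴ, h3, ← Matrix.mul_assoc, hU.1, hU2]
  · rw [Matrix.conjTranspose_mul, Matrix.conjTranspose_conjTranspose, Matrix.mul_assoc,
      ← Matrix.mul_assoc Uᴴ, hU1, ← Matrix.mul_assoc, h2.1, h4]

/-- Transport inside the category. -/
theorem Obj.transport (ρ : N.Obj) (o : DoubleCone) :
    ∃ (σ : N.Obj) (U : Bimodule.Hom ρ.toBimodule σ.toBimodule),
      IsLocalizedIn (toMor σ.toBimodule) o ∧ Bimodule.IsUnitary U := by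
  obtain ⟨κ, _, τ, U, hτ, hU, hU1, hU2⟩ := ρ.transportable o
  obtain ⟨o', ho'⟩ := ρ.localized
  obtain ⟨a, ha, ha'⟩ := DoubleCone.exists_union_subset o o'
  let V : Matrix κ ρ.ι N.globalAlg :=
    Matrix.of fun i j => ⟨U i j, mem_globalAlg (hU.mem ho' hτ ha' ha i j)⟩
  let V' : Bimodule.Hom ρ.toBimodule hτ.toBimodule :=
    ⟨V, ops_injective ((ops_mul _ _).trans hU.1), ops_injective ((ops_mul _ _).trans hU.2.1),
      fun A => ops_injective ((ops_mul _ _).trans ((hU.2.2 A).trans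
        (ops_mul (hτ.toBimodule.hom A) V).symm))⟩
  refine ⟨⟨hτ.toBimodule, ⟨o, hτ⟩, ρ.transportable.of_unitary hU hU1 hU2⟩, V', hτ, ?_, ?_⟩
  · refine Subtype.ext (ops_injective ((ops_mul _ _).trans ?_))
    exact (congrArg (· * U) (ops_conjTranspose V)).trans hU1
  · refine Subtype.ext (ops_injective ((ops_mul _ _).trans ?_))
    exact (congrArg (U * ·) (ops_conjTranspose V)).trans hU2

theorem tensor_localized {ρ σ : Bimodule N.globalAlg} {o : DoubleCone}
    (hρ : IsLocalizedIn (toMor ρ) o) (hσ : IsLocalizedIn (toMor σ) o) :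
    IsLocalizedIn (toMor (Bimodule.tensor ρ σ)) o := by
  intro a ha A hA i j
  have h1 : σ.hom A i.2 j.2 = A * σ.hom 1 i.2 j.2 := Subtype.ext (hσ a ha A hA i.2 j.2)
  have h2 : ∀ x y, ρ.hom A x y = A * ρ.hom 1 x y := fun x y => Subtype.ext (hρ a ha A hA x y)
  have h3 : ρ.hom (σ.hom A i.2 j.2) i.1 j.1 = A * ρ.hom (σ.hom 1 i.2 j.2) i.1 j.1 := by
    rw [h1, map_mul, Matrix.mul_apply]
    simp_rw [h2, mul_assoc]
    rw [← Finset.mul_sum, ← Matrix.mul_apply, ← map_mul, one_mul]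
  exact congrArg Subtype.val h3

theorem IsLocalizedIn.mono {κ : Type} [Fintype κ] {τ : N.Mor κ} {o o' : DoubleCone}
    (h : IsLocalizedIn τ o) (hoo' : o.1 ⊆ o'.1) : IsLocalizedIn τ o' :=
  fun a ha => h a (ha.mono (subset_refl _) hoo')

/-- The tensor product of objects. -/
def Obj.tensor (ρ σ : N.Obj) : N.Obj where
  toBimodule := Bimodule.tensor ρ.toBimodule σ.toBimodule
  localized := by
    obtain ⟨o, ho⟩ := ρ.localized
    obtain ⟨o', ho'⟩ := σ.localized
    obtain ⟨a, ha, ha'⟩ := DoubleCone.exists_union_subset o o'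
    exact ⟨a, tensor_localized (ho.mono ha) (ho'.mono ha')⟩
  transportable := fun o => by
    obtain ⟨ρ', U, hρ', hU⟩ := ρ.transport o
    obtain ⟨σ', V, hσ', hV⟩ := σ.transport o
    have hW := Bimodule.IsUnitary.times hU hV
    refine ⟨_, _, toMor (Bimodule.tensor ρ'.toBimodule σ'.toBimodule),
      ops (Bimodule.times U V).1, tensor_localized hρ' hσ', isIntertwiner_ops _, ?_, ?_⟩
    · rw [← ops_conjTranspose, ← ops_mul]
      exact congrArg (fun x => ops x.1) hW.1
    · rw [← ops_conjTranspose, ← ops_mul]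
      exact congrArg (fun x => ops x.1) hW.2

/-- The identity object. -/
def Obj.unit (N : LocalNet H) : N.Obj where
  toBimodule := Bimodule.unit N.globalAlg
  localized := ⟨DoubleCone.diamond 0 1 one_pos, fun _ _ A _ _ _ => (mul_one (A : H →L[ℂ] H)).symm⟩
  transportable := fun o => by
    have hW := Bimodule.isUnitary_one (Bimodule.unit N.globalAlg)
    refine ⟨_, _, toMor (Bimodule.unit N.globalAlg), ops (Bimodule.one (Bimodule.unit _)).1,
      fun _ _ A _ _ _ => (mul_one (A : H →L[ℂ] H)).symm, isIntertwiner_ops _, ?_, ?_⟩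
    · rw [← ops_conjTranspose, ← ops_mul]
      exact congrArg (fun x => ops x.1) hW.1
    · rw [← ops_conjTranspose, ← ops_mul]
      exact congrArg (fun x => ops x.1) hW.2

/-! ## The symmetry -/

theorem hom_mem {ρ : Bimodule N.globalAlg} {o a : DoubleCone} (h : IsLocalizedIn (toMor ρ) o)
    (ha : DoubleCone.Perp a o) (B : N.globalAlg) (hB : (B : H →L[ℂ] H) ∈ N.alg a) (i j : ρ.ι) :
    ρ.hom B i j = B * ρ.hom 1 i j := Subtype.ext (h a ha B hB i j)

theorem times_apply {ρ ρ' σ σ' : Bimodule N.globalAlg} {c d : DoubleCone}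
    (hρ : IsLocalizedIn (toMor ρ) d) (hρ' : IsLocalizedIn (toMor ρ') d)
    (hσ : IsLocalizedIn (toMor σ) c) (hσ' : IsLocalizedIn (toMor σ') c)
    (hcd : DoubleCone.Perp c d) (T : Bimodule.Hom ρ ρ') (S : Bimodule.Hom σ σ')
    (i₁ : ρ'.ι) (i₂ : σ'.ι) (j₁ : ρ.ι) (j₂ : σ.ι) :
    (Bimodule.times T S).1 (i₁, i₂) (j₁, j₂) = S.1 i₂ j₂ * T.1 i₁ j₁ := by
  have hS : (S.1 i₂ j₂ : H →L[ℂ] H) ∈ N.alg c :=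
    IsIntertwiner.mem hσ hσ' (subset_refl _) (subset_refl _) (isIntertwiner_ops S) i₂ j₂
  have hT : ∀ k, (T.1 i₁ k : H →L[ℂ] H) ∈ N.alg d := fun k =>
    IsIntertwiner.mem hρ hρ' (subset_refl _) (subset_refl _) (isIntertwiner_ops T) i₁ k
  have comm : ∀ k, T.1 i₁ k * S.1 i₂ j₂ = S.1 i₂ j₂ * T.1 i₁ k := fun k =>
    Subtype.ext (N.locality c d hcd hS _ (hT k))
  have h1 : ∑ k, T.1 i₁ k * ρ.hom (S.1 i₂ j₂) k j₁ = S.1 i₂ j₂ * T.1 i₁ j₁ := by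
    simp_rw [hom_mem hρ hcd _ hS, ← mul_assoc, comm, mul_assoc]
    rw [← Finset.mul_sum, ← Matrix.mul_apply, T.2.1]
  exact h1

theorem times_swap {ρ ρ' σ σ' : Bimodule N.globalAlg} {c d : DoubleCone}
    (hρ : IsLocalizedIn (toMor ρ) d) (hρ' : IsLocalizedIn (toMor ρ') d)
    (hσ : IsLocalizedIn (toMor σ) c) (hσ' : IsLocalizedIn (toMor σ') c)
    (hcd : DoubleCone.Perp c d) (T : Bimodule.Hom ρ ρ') (S : Bimodule.Hom σ σ') :
    (Bimodule.times S T).1 =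
      (Bimodule.times T S).1.submatrix (Equiv.prodComm σ'.ι ρ'.ι) (Equiv.prodComm σ.ι ρ.ι) := by
  ext1 i j
  refine (times_apply hσ hσ' hρ hρ' hcd.symm S T i.1 i.2 j.1 j.2).trans ?_
  refine Eq.trans ?_ (times_apply hρ hρ' hσ hσ' hcd T S i.2 i.1 j.2 j.1).symm
  refine Subtype.ext (N.locality c d hcd ?_ _ ?_)
  · exact IsIntertwiner.mem hσ hσ' (subset_refl _) (subset_refl _) (isIntertwiner_ops S) _ _
  · exact IsIntertwiner.mem hρ hρ' (subset_refl _) (subset_refl _) (isIntertwiner_ops T) _ _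

theorem tensor_swap_one {ρ σ : Bimodule N.globalAlg} {c d : DoubleCone}
    (hρ : IsLocalizedIn (toMor ρ) d) (hσ : IsLocalizedIn (toMor σ) c)
    (hcd : DoubleCone.Perp c d) :
    (Bimodule.tensor σ ρ).hom 1 = ((Bimodule.tensor ρ σ).hom 1).submatrix
      (Equiv.prodComm σ.ι ρ.ι) (Equiv.prodComm σ.ι ρ.ι) := by
  have h := times_swap hρ hρ hσ hσ hcd (Bimodule.one ρ) (Bimodule.one σ)
  rw [Bimodule.times_one, Bimodule.times_one] at h
  exact h

theorem tensor_swap_far {ρ σ : Bimodule N.globalAlg} {b c d : DoubleCone}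
    (hρ : IsLocalizedIn (toMor ρ) d) (hσ : IsLocalizedIn (toMor σ) c)
    (hcd : DoubleCone.Perp c d) (hbc : DoubleCone.Perp b c) (hbd : DoubleCone.Perp b d)
    (B : N.globalAlg) (hB : (B : H →L[ℂ] H) ∈ N.alg b) :
    (Bimodule.tensor σ ρ).hom B = ((Bimodule.tensor ρ σ).hom B).submatrix
      (Equiv.prodComm σ.ι ρ.ι) (Equiv.prodComm σ.ι ρ.ι) := by
  have key : ∀ {α β : Bimodule N.globalAlg}, (∀ x y, α.hom B x y = B * α.hom 1 x y) →
      (∀ x y, β.hom B x y = B * β.hom 1 x y) → ∀ i j,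
      (Bimodule.tensor α β).hom B i j = B * (Bimodule.tensor α β).hom 1 i j := by
    intro α β h1 h2 i j
    show α.hom (β.hom B i.2 j.2) i.1 j.1 = B * α.hom (β.hom 1 i.2 j.2) i.1 j.1
    rw [h2, map_mul, Matrix.mul_apply]
    simp_rw [h1, mul_assoc]
    rw [← Finset.mul_sum, ← Matrix.mul_apply, ← map_mul, one_mul]
  ext1 i j
  refine (key (hom_mem hσ hbc B hB) (hom_mem hρ hbd B hB) i j).trans ?_
  rw [tensor_swap_one hρ hσ hcd]
  exact (key (hom_mem hρ hbd B hB) (hom_mem hσ hbc B hB) _ _).symm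

theorem tensor_swap_near {ρ σ ρ' σ' : Bimodule N.globalAlg} {b c d c' d' : DoubleCone}
    (hρ : IsLocalizedIn (toMor ρ) d) (hσ : IsLocalizedIn (toMor σ) c)
    (hcd : DoubleCone.Perp c d) (hρ' : IsLocalizedIn (toMor ρ') d')
    (hσ' : IsLocalizedIn (toMor σ') c') (hd : d'.1 ⊆ d.1) (hc : c'.1 ⊆ c.1)
    (hbc : DoubleCone.Perp b c') (hbd : DoubleCone.Perp b d')
    {U : Bimodule.Hom ρ ρ'} {V : Bimodule.Hom σ σ'} (hU : Bimodule.IsUnitary U)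
    (hV : Bimodule.IsUnitary V) (B : N.globalAlg) (hB : (B : H →L[ℂ] H) ∈ N.alg b) :
    (Bimodule.tensor σ ρ).hom B = ((Bimodule.tensor ρ σ).hom B).submatrix
      (Equiv.prodComm σ.ι ρ.ι) (Equiv.prodComm σ.ι ρ.ι) := by
  have hflip := times_swap hρ (hρ'.mono hd) hσ (hσ'.mono hc) hcd U V
  have hfar := tensor_swap_far hρ' hσ' (hcd.mono hc hd) hbc hbd B hB
  have h1 : (Bimodule.times V U).1 * ((Bimodule.tensor ρ σ).hom B).submatrix
      (Equiv.prodComm σ.ι ρ.ι) (Equiv.prodComm σ.ι ρ.ι) =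
      (Bimodule.times V U).1 * (Bimodule.tensor σ ρ).hom B := by
    refine Eq.trans ?_ ((Bimodule.times V U).2.2.2 B).symm
    rw [hfar, hflip, Matrix.submatrix_mul_equiv, Matrix.submatrix_mul_equiv,
      (Bimodule.times U V).2.2.2]
  have h2 := congrArg (fun M => (Bimodule.adj (Bimodule.times V U)).1 * M) h1
  have h3 : (Bimodule.adj (Bimodule.times V U)).1 * (Bimodule.times V U).1 =
      (Bimodule.tensor σ ρ).hom 1 := congrArg Subtype.val (Bimodule.IsUnitary.times hV hU).1
  simp only [← Matrix.mul_assoc] at h2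
  rw [h3, ← map_mul, one_mul, tensor_swap_one hρ hσ hcd, Matrix.submatrix_mul_equiv, ← map_mul,
    one_mul] at h2
  exact h2.symm

/-- `E` is the operator `(V⁺ × U⁺) · θ · (U × V)`, for unitaries `U ∈ (ρ, ρ₁)`, `V ∈ (σ, σ₁)` onto
objects localized in spacelike separated double cones. Multiplication from the left by the
permutation matrix `θ` relabels the rows by `(i₂, i₁) ↦ (i₁, i₂)`. -/
def IsExchange (ρ σ : N.Obj) (E : Bimodule.Hom (ρ.tensor σ).toBimodule (σ.tensor ρ).toBimodule) :
    Prop :=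
  ∃ (o a : DoubleCone) (ρ₁ σ₁ : N.Obj) (U : Bimodule.Hom ρ.toBimodule ρ₁.toBimodule)
    (V : Bimodule.Hom σ.toBimodule σ₁.toBimodule),
    DoubleCone.Perp o a ∧ IsLocalizedIn (toMor ρ₁.toBimodule) o ∧
    IsLocalizedIn (toMor σ₁.toBimodule) a ∧ Bimodule.IsUnitary U ∧ Bimodule.IsUnitary V ∧
    E.1 = (Bimodule.times (Bimodule.adj V) (Bimodule.adj U)).1 *
      (Bimodule.times U V).1.submatrix (Equiv.prodComm σ₁.ι ρ₁.ι) id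

theorem exists_isExchange (ρ σ : N.Obj) : ∃ E, IsExchange ρ σ E := by
  let e : EuclideanSpace ℝ (Fin 3) := EuclideanSpace.single 0 1
  have he : ‖e‖ = 1 := by simp [e]
  have hn : ∀ t s : ℝ, ‖t • e - s • e‖ = |t - s| := fun t s => by
    rw [← sub_smul, norm_smul, he, mul_one, Real.norm_eq_abs]
  let o := DoubleCone.diamond ((-2 : ℝ) • e) 1 one_pos
  let a := DoubleCone.diamond ((2 : ℝ) • e) 1 one_pos
  have hao : DoubleCone.Perp a o := DoubleCone.diamond_perp _ _ (by rw [hn]; norm_num)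
  obtain ⟨ρ₁, U, hρ₁, hU⟩ := ρ.transport o
  obtain ⟨σ₁, V, hσ₁, hV⟩ := σ.transport a
  have local_swap : ∀ (b : DoubleCone) (B : N.globalAlg), (B : H →L[ℂ] H) ∈ N.alg b →
      (Bimodule.tensor σ₁.toBimodule ρ₁.toBimodule).hom B =
      ((Bimodule.tensor ρ₁.toBimodule σ₁.toBimodule).hom B).submatrix
      (Equiv.prodComm σ₁.ι ρ₁.ι) (Equiv.prodComm σ₁.ι ρ₁.ι) := by
    intro b B hB
    obtain ⟨R, hR, hb⟩ := DoubleCone.exists_subset_diamond b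
    have hr : 0 < R + 1 := by linarith
    let d := DoubleCone.diamond ((-(2 + R)) • e) (R + 1) hr
    let c := DoubleCone.diamond ((2 + R) • e) (R + 1) hr
    let d' := DoubleCone.diamond ((-(2 * (R + 1))) • e) 1 one_pos
    let c' := DoubleCone.diamond ((2 * (R + 1)) • e) 1 one_pos
    have hb' := hb R hR le_rfl
    obtain ⟨ρ₂, U₂, hρ₂, hU₂⟩ := ρ₁.transport d'
    obtain ⟨σ₂, V₂, hσ₂, hV₂⟩ := σ₁.transport c'
    have abs1 : |2 * (R + 1) - (2 + R)| = R := by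
      rw [abs_of_nonneg (by linarith)]; ring
    refine tensor_swap_near (b := b) (c := c) (d := d) (c' := c') (d' := d')
      (hρ₁.mono (DoubleCone.diamond_subset _ _ ?_)) (hσ₁.mono (DoubleCone.diamond_subset _ _ ?_))
      (DoubleCone.diamond_perp _ _ ?_) hρ₂ hσ₂ (DoubleCone.diamond_subset _ _ ?_)
      (DoubleCone.diamond_subset _ _ ?_) ?_ ?_ hU₂ hV₂ B hB
    · rw [hn, show (-2 : ℝ) - -(2 + R) = R by ring, abs_of_pos hR]
    · rw [hn, abs_sub_comm, show (2 + R : ℝ) - 2 = R by ring, abs_of_pos hR]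
    · rw [hn, show (2 + R) - -(2 + R) = 2 * (2 + R) by ring, abs_of_pos (by linarith)]
      linarith
    · rw [hn, show -(2 * (R + 1)) - -(2 + R) = -R by ring, abs_neg, abs_of_pos hR]
    · rw [hn, abs1]
    · refine (DoubleCone.diamond_perp hR one_pos ?_).mono hb' (subset_refl _)
      rw [zero_sub, norm_neg, norm_smul, he, Real.norm_eq_abs, abs_of_pos (by linarith)]
      linarith
    · refine (DoubleCone.diamond_perp hR one_pos ?_).mono hb' (subset_refl _)
      rw [zero_sub, norm_neg, norm_smul, he, Real.norm_eq_abs, abs_neg, abs_of_pos (by linarith)]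
      linarith
  have swap : ∀ B : N.globalAlg, (Bimodule.tensor σ₁.toBimodule ρ₁.toBimodule).hom B =
      ((Bimodule.tensor ρ₁.toBimodule σ₁.toBimodule).hom B).submatrix
      (Equiv.prodComm σ₁.ι ρ₁.ι) (Equiv.prodComm σ₁.ι ρ₁.ι) := by
    intro B
    apply ops_injective
    ext1 i j
    have hc := (Mor.continuous_entry (toMor (Bimodule.tensor σ₁.toBimodule ρ₁.toBimodule)) i j)
    have hc' := (Mor.continuous_entry (toMor (Bimodule.tensor ρ₁.toBimodule σ₁.toBimodule))
      (i.2, i.1) (j.2, j.1))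
    refine congrFun (Continuous.ext_on N.dense_local hc hc' ?_) B
    rintro B ⟨b, hB⟩
    exact congrArg Subtype.val (congrFun (congrFun (local_swap b B hB) i) j)
  let Θ : Bimodule.Hom (Bimodule.tensor ρ₁.toBimodule σ₁.toBimodule)
      (Bimodule.tensor σ₁.toBimodule ρ₁.toBimodule) :=
    ⟨((Bimodule.tensor ρ₁.toBimodule σ₁.toBimodule).hom 1).submatrix
        (Equiv.prodComm σ₁.ι ρ₁.ι) (Equiv.refl _),
      by
        refine (Matrix.submatrix_mul_equiv _ ((Bimodule.tensor _ _).hom 1) _ (Equiv.refl _)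
          (Equiv.refl _)).trans ?_
        rw [← map_mul, one_mul],
      by
        rw [swap]
        refine (Matrix.submatrix_mul_equiv _ _ _ _ _).trans ?_
        rw [← map_mul, one_mul],
      fun B => by
        rw [swap B]
        refine Eq.trans ?_ (Matrix.submatrix_mul_equiv _ _ _ _ _).symm
        refine (Matrix.submatrix_mul_equiv _ ((Bimodule.tensor _ _).hom B) _
          (Equiv.refl _) (Equiv.refl _)).trans ?_
        rw [← map_mul, ← map_mul, one_mul, mul_one]⟩
  refine ⟨Bimodule.comp (Bimodule.times (Bimodule.adj V) (Bimodule.adj U))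
    (Bimodule.comp Θ (Bimodule.times U V)), o, a, ρ₁, σ₁, U, V, hao.symm, hρ₁, hσ₁, hU, hV, ?_⟩
  refine congrArg (fun M => (Bimodule.times (Bimodule.adj V) (Bimodule.adj U)).1 * M) ?_
  refine (Matrix.submatrix_mul_equiv _ (Bimodule.times U V).1 _ (Equiv.refl _)
    (Equiv.refl _)).trans ?_
  rw [(Bimodule.times U V).2.2.1]
  rfl

/-- The symmetry `ε(ρ, σ) = (V⁺ × U⁺) · θ · (U × V)`. -/
def symmetry (ρ σ : N.Obj) : Bimodule.Hom (ρ.tensor σ).toBimodule (σ.tensor ρ).toBimodule :=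
  (exists_isExchange ρ σ).choose

/-! ## Simple objects, left inverses and statistics -/

/-- `γ` is simple: `ε(γ, γ) = ± 1`. -/
def IsSimple (γ : N.Obj) : Prop :=
  ∃ χ : ℂ, (χ = 1 ∨ χ = -1) ∧ symmetry γ γ = χ • Bimodule.one (γ.tensor γ).toBimodule

/-- A (positive normalized) left inverse of `ρ`. -/
structure LeftInverse (ρ : N.Obj) where
  map : ∀ σ τ : N.Obj, Bimodule.Hom (ρ.tensor σ).toBimodule (ρ.tensor τ).toBimodule →ₗ[ℂ]
    Bimodule.Hom σ.toBimodule τ.toBimodule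
  /-- `Ψ((1_ρ × T) · X · (1_ρ × S⁺)) = T · Ψ(X) · S⁺`. -/
  map_comp : ∀ (σ σ' τ τ' : N.Obj) (S : Bimodule.Hom σ.toBimodule σ'.toBimodule)
    (T : Bimodule.Hom τ.toBimodule τ'.toBimodule)
    (X : Bimodule.Hom (ρ.tensor σ).toBimodule (ρ.tensor τ).toBimodule),
    map σ' τ' (Bimodule.comp (Bimodule.times (Bimodule.one ρ.toBimodule) T)
      (Bimodule.comp X (Bimodule.times (Bimodule.one ρ.toBimodule) (Bimodule.adj S)))) =
    Bimodule.comp T (Bimodule.comp (map σ τ X) (Bimodule.adj S))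
  /-- `Ψ(X × 1_π) = Ψ(X) × 1_π`. -/
  map_times : ∀ (σ τ π : N.Obj)
    (X : Bimodule.Hom (ρ.tensor σ).toBimodule (ρ.tensor τ).toBimodule),
    map (σ.tensor π) (τ.tensor π) (Bimodule.reassoc (Bimodule.times X (Bimodule.one π.toBimodule))) =
    Bimodule.times (map σ τ X) (Bimodule.one π.toBimodule)
  /-- The maps on the C*-algebras `(ρσ, ρσ)` are positive. -/
  positive : ∀ (σ : N.Obj) (X : Bimodule.Hom (ρ.tensor σ).toBimodule (ρ.tensor σ).toBimodule),
    ∃ Y : Bimodule.Hom σ.toBimodule σ.toBimodule,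
      map σ σ (Bimodule.comp (Bimodule.adj X) X) = Bimodule.comp (Bimodule.adj Y) Y
  normalized : map (Obj.unit N) (Obj.unit N) (Bimodule.one (ρ.tensor (Obj.unit N)).toBimodule) =
    Bimodule.one (Obj.unit N).toBimodule

/-- The arrow `1_{ρ^i} × ε(ρ, ρ) × 1_{ρ^{d-i-2}}` of `(ρ^d, ρ^d)`, for `i + 1 < d`. -/
def adjacent (ρ : N.Obj) : ∀ d : ℕ, ℕ →
    Bimodule.Hom (Bimodule.pow ρ.toBimodule d) (Bimodule.pow ρ.toBimodule d)
  | d + 2, 0 => Bimodule.reassoc (ρ := ρ.toBimodule) (σ := ρ.toBimodule)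
      (τ := Bimodule.pow ρ.toBimodule d) (ρ' := ρ.toBimodule) (σ' := ρ.toBimodule)
      (τ' := Bimodule.pow ρ.toBimodule d) (Bimodule.times (symmetry ρ ρ) (Bimodule.one _))
  | d + 1, i + 1 => Bimodule.times (Bimodule.one ρ.toBimodule) (adjacent ρ d i)
  | _, _ => 0

/-- `R` is the representation `ε^d_ρ` of the permutation group of `d` elements in `(ρ^d, ρ^d)`:
the one that represents the transposition of `i` and `i + 1` by
`1_{ρ^i} × ε(ρ, ρ) × 1_{ρ^{d-i-2}}`. -/
structure IsPermRep (ρ : N.Obj) (d : ℕ) (R : Equiv.Perm (Fin d) →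
    Bimodule.Hom (Bimodule.pow ρ.toBimodule d) (Bimodule.pow ρ.toBimodule d)) : Prop where
  map_one : R 1 = Bimodule.one _
  map_mul : ∀ p q, R (p * q) = Bimodule.comp (R p) (R q)
  map_swap : ∀ (i : ℕ) (h : i + 1 < d),
    R (Equiv.swap ⟨i, Nat.lt_of_succ_lt h⟩ ⟨i + 1, h⟩) = adjacent ρ d i

/-- The antisymmetrizer `A_d = (d!)⁻¹ ∑ sign(p) ε^d_ρ(p)`. -/
def antisymmetrizer {ρ : N.Obj} {d : ℕ} (R : Equiv.Perm (Fin d) →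
    Bimodule.Hom (Bimodule.pow ρ.toBimodule d) (Bimodule.pow ρ.toBimodule d)) :
    Bimodule.Hom (Bimodule.pow ρ.toBimodule d) (Bimodule.pow ρ.toBimodule d) :=
  ((d.factorial : ℂ)⁻¹) • ∑ p, ((Equiv.Perm.sign p : ℤ) : ℂ) • R p

/-- The symmetrizer `S_d = (d!)⁻¹ ∑ ε^d_ρ(p)`. -/
def symmetrizer {ρ : N.Obj} {d : ℕ} (R : Equiv.Perm (Fin d) →
    Bimodule.Hom (Bimodule.pow ρ.toBimodule d) (Bimodule.pow ρ.toBimodule d)) :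
    Bimodule.Hom (Bimodule.pow ρ.toBimodule d) (Bimodule.pow ρ.toBimodule d) :=
  ((d.factorial : ℂ)⁻¹) • ∑ p, R p

/-- The condition imposed on the irreducible constituents of an object with finite statistics:
there are `d ≥ 1`, a faithful simple object `γ` and an isometry `V ∈ (γ, ρ^d)` with
`V V⁺ = A_d` or `V V⁺ = S_d`. -/
def HasDeterminant (ρ : N.Obj) : Prop :=
  ∃ (d : ℕ) (γ : N.Obj) (V : Bimodule.Hom γ.toBimodule (Bimodule.pow ρ.toBimodule d))
    (R : Equiv.Perm (Fin d) →
      Bimodule.Hom (Bimodule.pow ρ.toBimodule d) (Bimodule.pow ρ.toBimodule d)),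
    0 < d ∧ Bimodule.IsFaithful γ.toBimodule ∧ IsSimple γ ∧ Bimodule.IsIsometry V ∧
    IsPermRep ρ d R ∧
    (Bimodule.comp V (Bimodule.adj V) = antisymmetrizer R ∨
      Bimodule.comp V (Bimodule.adj V) = symmetrizer R)

/-- `ρ` has finite statistics: it is a finite direct sum (of at least one summand) of irreducible
objects `τ i` with the preceding property; `W i ∈ (τ i, ρ)` are isometries with
`∑ W i · (W i)⁺ = 1_ρ`. -/
def HasFiniteStatistics (ρ : N.Obj) : Prop :=
  ∃ (k : ℕ) (τ : Fin k → N.Obj) (W : ∀ i, Bimodule.Hom (τ i).toBimodule ρ.toBimodule),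
    0 < k ∧ (∀ i, Bimodule.IsIrreducible (τ i).toBimodule ∧ HasDeterminant (τ i)) ∧
    (∀ i, Bimodule.IsIsometry (W i)) ∧
    ∑ i, Bimodule.comp (W i) (Bimodule.adj (W i)) = Bimodule.one ρ.toBimodule

end LocalNet

end

/-! The objects form a symmetric monoidal category with adjoints, and ρ^d carries a unitary
representation of the permutations of d elements. The braiding laws are checked on objects localized
in spacelike separated double cones, where ε is the bare flip. That ε is independent of its defining
unitaries follows because any two spacelike separated pairs of double cones can be joined by
enlarging and shrinking (`eq_of_perp`).

Let E_d be the symmetrizer (s = 1) or the antisymmetrizer (s = -1) of ρ^d, and let Ψ be a left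
inverse with Ψ(ε(ρ,ρ)) = c. Splitting the permutations into cosets of the stabilizer of the first
factor gives Ψ(E_{d+1}) = (1 + d s c)/(d + 1) · E_d (`app_isotypic`). The d-fold iterate of Ψ is a
left inverse of ρ^d. It takes ε(ρ^d,ρ^d) to c^d and E_d × 1 to the weight w_d = ∏_{k<d} (1 + k s
c)/(k + 1).

a) implies b): an irreducible ρ is unitarily equivalent to one of its summands, so there is a
faithful simple γ and an isometry V with V V⁺ = E_d. The kernel of ρ lies in those of ρ^d and of γ,
hence is zero. Simplicity of γ makes ε(ρ^d,ρ^d) a sign χ on E_d × E_d, and the iterated left inverse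
turns this into c^d E_d = χ w_d E_d. If c were 0, then w_d = 1/d! would force E_d = 0, a
contradiction.

b) implies a): a left inverse must first be produced. Faithfulness allows a vector state to be
extended by Hahn-Banach from ρ(𝔄) to the operator matrices. The GNS representation of the extension
contains the original space of the net isometrically, and compression to it is a completely positive
bimodule map (`exists_conditional_map`). Applied to blocks it is a left inverse, since Haag duality
returns its values to the local algebras. Let c ≠ 0 be its parameter. Positivity gives w_d ≥ 0 for
all d and both signs, so c is real and equals -s/d for some d ≥ 1 and some s
(`exists_parameter_eq`). For these values w_d = |c|^d, so the iterated left inverse annihilates the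
positive element E_d × E_d - χ (E_d × E_d) ε with a suitable sign χ. A left inverse with nonzero
real parameter is faithful (`eq_zero_of_app_eq_zero`), so this element vanishes and the range γ of
E_d is simple. Finally γ is faithful: if E_d ρ^d(A) = 0, stripping off one factor after another
multiplies by the nonzero numbers (1 - k/d)/(k + 1), k < d, and ends with A = 0. -/

noncomputable section

/-! ### Relabellings of matrix units and the coherence arrows -/

namespace Bimodule

variable {A : Type*} [Ring A] [StarRing A] [Algebra ℂ A]

/-- The arrow between two objects that differ by a relabelling of the matrix units. -/
def relabel {ρ σ : Bimodule A} (e : σ.ι ≃ ρ.ι)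
    (h : ∀ a, σ.hom a = (ρ.hom a).submatrix e e) : Hom ρ σ :=
  ⟨(ρ.hom 1).submatrix e id,
    by
      refine (Matrix.submatrix_mul_equiv _ (ρ.hom 1) _ (Equiv.refl _) (Equiv.refl _)).trans ?_
      rw [← map_mul, one_mul]; rfl,
    by rw [h, Matrix.submatrix_mul_equiv, ← map_mul, one_mul],
    fun a => by
      rw [h, Matrix.submatrix_mul_equiv, ← map_mul, mul_one]
      refine (Matrix.submatrix_mul_equiv _ (ρ.hom a) _ (Equiv.refl _) (Equiv.refl _)).trans ?_
      rw [← map_mul, one_mul]; rfl⟩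

theorem relabel_comp {ρ σ τ : Bimodule A} (e : σ.ι ≃ ρ.ι)
    (h : ∀ a, σ.hom a = (ρ.hom a).submatrix e e) (T : Hom τ ρ) :
    (comp (relabel e h) T).1 = T.1.submatrix e id := by
  refine (Matrix.submatrix_mul_equiv (ρ.hom 1) T.1 _ (Equiv.refl _) (Equiv.refl _)).trans ?_
  rw [T.2.2.1]; rfl

theorem comp_relabel {ρ σ τ : Bimodule A} (e : σ.ι ≃ ρ.ι)
    (h : ∀ a, σ.hom a = (ρ.hom a).submatrix e e) (T : Hom σ τ) :
    (comp T (relabel e h)).1 = T.1.submatrix id e.symm := by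
  have h1 : (relabel e h).1 = (σ.hom 1).submatrix id e.symm := by
    rw [h]; ext i j; simp [relabel]
  show T.1 * (relabel e h).1 = _
  rw [h1]
  refine (Matrix.submatrix_mul_equiv T.1 (σ.hom 1) _ (Equiv.refl _) _).trans ?_
  rw [T.2.1]; rfl

theorem adj_relabel {ρ σ : Bimodule A} (e : σ.ι ≃ ρ.ι)
    (h : ∀ a, σ.hom a = (ρ.hom a).submatrix e e)
    (h' : ∀ a, ρ.hom a = (σ.hom a).submatrix e.symm e.symm) :
    adj (relabel e h) = relabel e.symm h' := by
  refine Subtype.ext ?_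
  show ((ρ.hom 1).submatrix e id)ᴴ = (σ.hom 1).submatrix e.symm id
  rw [Matrix.conjTranspose_submatrix, ← Matrix.star_eq_conjTranspose, ← map_star, star_one, h]
  ext i j; simp

theorem relabel_inv {ρ σ : Bimodule A} (e : σ.ι ≃ ρ.ι)
    (h : ∀ a, σ.hom a = (ρ.hom a).submatrix e e)
    (h' : ∀ a, ρ.hom a = (σ.hom a).submatrix e.symm e.symm) :
    comp (relabel e.symm h') (relabel e h) = one ρ := by
  refine Subtype.ext ?_
  rw [relabel_comp]
  ext i j
  simp [relabel, one]

theorem times_apply {ρ ρ' σ σ' : Bimodule A} (T : Hom ρ ρ') (S : Hom σ σ')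
    (i : (tensor ρ' σ').ι) (j : (tensor ρ σ).ι) :
    (times T S).1 i j = (T.1 * ρ.hom (S.1 i.2 j.2)) i.1 j.1 :=
  (Matrix.mul_apply (M := T.1) (N := ρ.hom (S.1 i.2 j.2))).symm

theorem tensor_assoc (ρ σ τ : Bimodule A) (a : A) :
    (tensor ρ (tensor σ τ)).hom a = ((tensor (tensor ρ σ) τ).hom a).submatrix
      (Equiv.prodAssoc _ _ _).symm (Equiv.prodAssoc _ _ _).symm := rfl

theorem tensor_assoc_inv (ρ σ τ : Bimodule A) (a : A) :
    (tensor (tensor ρ σ) τ).hom a = ((tensor ρ (tensor σ τ)).hom a).submatrix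
      (Equiv.prodAssoc _ _ _) (Equiv.prodAssoc _ _ _) := rfl

theorem unit_tensor (ρ : Bimodule A) (a : A) :
    ρ.hom a = ((tensor (unit A) ρ).hom a).submatrix
      (Equiv.punitProd _).symm (Equiv.punitProd _).symm := rfl

theorem unit_tensor_inv (ρ : Bimodule A) (a : A) :
    (tensor (unit A) ρ).hom a = (ρ.hom a).submatrix
      (Equiv.punitProd _) (Equiv.punitProd _) := rfl

theorem tensor_unit (ρ : Bimodule A) (a : A) :
    ρ.hom a = ((tensor ρ (unit A)).hom a).submatrix
      (Equiv.prodPUnit _).symm (Equiv.prodPUnit _).symm := rfl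

theorem tensor_unit_inv (ρ : Bimodule A) (a : A) :
    (tensor ρ (unit A)).hom a = (ρ.hom a).submatrix
      (Equiv.prodPUnit _) (Equiv.prodPUnit _) := rfl

/-- The associativity arrow. -/
def assoc (ρ σ τ : Bimodule A) : Hom (tensor (tensor ρ σ) τ) (tensor ρ (tensor σ τ)) :=
  relabel (Equiv.prodAssoc _ _ _).symm (tensor_assoc ρ σ τ)

/-- The inverse associativity arrow. -/
def assocInv (ρ σ τ : Bimodule A) : Hom (tensor ρ (tensor σ τ)) (tensor (tensor ρ σ) τ) :=
  relabel (Equiv.prodAssoc _ _ _) (tensor_assoc_inv ρ σ τ)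

/-- The left unit arrow. -/
def leftUnit (ρ : Bimodule A) : Hom (tensor (unit A) ρ) ρ :=
  relabel (Equiv.punitProd _).symm (unit_tensor ρ)

/-- The inverse left unit arrow. -/
def leftUnitInv (ρ : Bimodule A) : Hom ρ (tensor (unit A) ρ) :=
  relabel (Equiv.punitProd _) (unit_tensor_inv ρ)

/-- The right unit arrow. -/
def rightUnit (ρ : Bimodule A) : Hom (tensor ρ (unit A)) ρ :=
  relabel (Equiv.prodPUnit _).symm (tensor_unit ρ)

/-- The inverse right unit arrow. -/
def rightUnitInv (ρ : Bimodule A) : Hom ρ (tensor ρ (unit A)) :=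
  relabel (Equiv.prodPUnit _) (tensor_unit_inv ρ)

theorem assoc_assocInv (ρ σ τ : Bimodule A) : comp (assocInv ρ σ τ) (assoc ρ σ τ) = one _ :=
  relabel_inv _ (tensor_assoc ρ σ τ) (tensor_assoc_inv ρ σ τ)

theorem assocInv_assoc (ρ σ τ : Bimodule A) : comp (assoc ρ σ τ) (assocInv ρ σ τ) = one _ :=
  relabel_inv _ (tensor_assoc_inv ρ σ τ) (tensor_assoc ρ σ τ)

theorem leftUnit_leftUnitInv (ρ : Bimodule A) : comp (leftUnitInv ρ) (leftUnit ρ) = one _ :=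
  relabel_inv _ (unit_tensor ρ) (unit_tensor_inv ρ)

theorem leftUnitInv_leftUnit (ρ : Bimodule A) : comp (leftUnit ρ) (leftUnitInv ρ) = one _ :=
  relabel_inv _ (unit_tensor_inv ρ) (unit_tensor ρ)

theorem rightUnit_rightUnitInv (ρ : Bimodule A) : comp (rightUnitInv ρ) (rightUnit ρ) = one _ :=
  relabel_inv _ (tensor_unit ρ) (tensor_unit_inv ρ)

theorem rightUnitInv_rightUnit (ρ : Bimodule A) : comp (rightUnit ρ) (rightUnitInv ρ) = one _ :=
  relabel_inv _ (tensor_unit_inv ρ) (tensor_unit ρ)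

theorem relabel_relabel {ρ σ τ : Bimodule A} (e : σ.ι ≃ ρ.ι)
    (h : ∀ a, σ.hom a = (ρ.hom a).submatrix e e) (e' : τ.ι ≃ σ.ι)
    (h' : ∀ a, τ.hom a = (σ.hom a).submatrix e' e') :
    (comp (relabel e' h') (relabel e h)).1 = (ρ.hom 1).submatrix (e'.trans e) id := by
  rw [relabel_comp]
  rfl

theorem tensor_relabel_left {ρ σ : Bimodule A} (τ : Bimodule A) (e : σ.ι ≃ ρ.ι)
    (h : ∀ a, σ.hom a = (ρ.hom a).submatrix e e) (a : A) :
    (tensor σ τ).hom a = ((tensor ρ τ).hom a).submatrix (e.prodCongr (Equiv.refl τ.ι))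
      (e.prodCongr (Equiv.refl τ.ι)) :=
  Matrix.ext fun i j => congrFun (congrFun (h _) i.1) j.1

theorem tensor_relabel_right {ρ σ : Bimodule A} (τ : Bimodule A) (e : σ.ι ≃ ρ.ι)
    (h : ∀ a, σ.hom a = (ρ.hom a).submatrix e e) (a : A) :
    (tensor τ σ).hom a = ((tensor τ ρ).hom a).submatrix ((Equiv.refl τ.ι).prodCongr e)
      ((Equiv.refl τ.ι).prodCongr e) :=
  Matrix.ext fun i j =>
    congrArg (fun x => τ.hom x i.1 j.1) (congrFun (congrFun (h a) i.2) j.2)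

/-- Relabellings are closed under tensoring with identities and under composition, so every
coherence law reduces to an equality of two equivalences of index types, which holds by `rfl`. -/
theorem times_relabel_one {ρ σ : Bimodule A} (τ : Bimodule A) (e : σ.ι ≃ ρ.ι)
    (h : ∀ a, σ.hom a = (ρ.hom a).submatrix e e) :
    times (relabel e h) (one τ) = relabel _ (tensor_relabel_left τ e h) := by
  refine Subtype.ext (Matrix.ext ?_)
  rintro ⟨i₁, i₂⟩ ⟨j₁, j₂⟩
  rw [times_apply, (relabel e h).2.2.2, h]
  show ((ρ.hom (τ.hom 1 i₂ j₂)).submatrix e e * (ρ.hom 1).submatrix e id) i₁ j₁ = _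
  rw [Matrix.submatrix_mul_equiv, ← map_mul, mul_one]
  rfl

theorem times_one_relabel {ρ σ : Bimodule A} (τ : Bimodule A) (e : σ.ι ≃ ρ.ι)
    (h : ∀ a, σ.hom a = (ρ.hom a).submatrix e e) :
    times (one τ) (relabel e h) = relabel _ (tensor_relabel_right τ e h) := by
  refine Subtype.ext (Matrix.ext ?_)
  rintro ⟨i₁, i₂⟩ ⟨j₁, j₂⟩
  rw [times_apply]
  show (τ.hom 1 * τ.hom _) i₁ j₁ = _
  rw [← map_mul, one_mul]
  rfl

theorem comp_one {ρ σ : Bimodule A} (T : Hom ρ σ) : comp T (one ρ) = T := Subtype.ext T.2.1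

theorem one_comp {ρ σ : Bimodule A} (T : Hom ρ σ) : comp (one σ) T = T := Subtype.ext T.2.2.1

theorem comp_assoc {ρ σ τ π : Bimodule A} (R : Hom τ π) (S : Hom σ τ) (T : Hom ρ σ) :
    comp (comp R S) T = comp R (comp S T) := Subtype.ext (Matrix.mul_assoc _ _ _)

theorem times_times {ρ ρ' σ σ' τ τ' : Bimodule A} (R : Hom ρ ρ') (S : Hom σ σ')
    (T : Hom τ τ') : comp (assoc ρ' σ' τ') (times (times R S) T) =
      comp (times R (times S T)) (assoc ρ σ τ) := by
  refine Subtype.ext ?_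
  rw [assoc, assoc, relabel_comp, comp_relabel]
  ext ⟨i1, i2, i3⟩ ⟨⟨j1, j2⟩, j3⟩
  show (times (times R S) T).1 ((i1, i2), i3) ((j1, j2), j3) =
    (times R (times S T)).1 (i1, (i2, i3)) (j1, (j2, j3))
  rw [times_apply, times_apply, times_apply]
  refine (congrFun (congrFun (block_mul (κ' := ρ.ι) (l' := σ.ι) (times R S).1
    ((tensor ρ σ).hom (T.1 i3 j3)) i2 j2) i1) j1).trans ?_
  refine Eq.trans ?_ (congrArg (fun x => (R.1 * ρ.hom x) i1 j1)
    (Matrix.mul_apply (M := S.1) (N := σ.hom (T.1 i3 j3))).symm)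
  rw [map_sum, Matrix.mul_sum]
  refine congrFun (congrFun (Finset.sum_congr rfl fun k _ => ?_) i1) j1
  refine (congrArg (· * _) (block_times R S i2 k)).trans ?_
  exact (Matrix.mul_assoc _ _ _).trans
    (congrArg (R.1 * ·) (map_mul ρ.hom (S.1 i2 k) (σ.hom (T.1 i3 j3) k j2)).symm)

theorem pentagon (ρ σ τ π : Bimodule A) :
    comp (comp (times (one ρ) (assoc σ τ π)) (assoc ρ (tensor σ τ) π))
      (times (assoc ρ σ τ) (one π)) =
    comp (assoc ρ σ (tensor τ π)) (assoc (tensor ρ σ) τ π) := by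
  rw [assoc, assoc, assoc, assoc, assoc, times_one_relabel, times_relabel_one]
  refine Subtype.ext ?_
  rw [comp_assoc, relabel_comp, relabel_relabel, relabel_relabel]
  rfl

theorem triangle (ρ σ : Bimodule A) :
    comp (times (one ρ) (leftUnit σ)) (assoc ρ (unit A) σ) =
    times (rightUnit ρ) (one σ) := by
  rw [assoc, leftUnit, rightUnit, times_one_relabel, times_relabel_one]
  refine Subtype.ext ?_
  rw [relabel_relabel]
  rfl

theorem leftUnit_natural {ρ σ : Bimodule A} (T : Hom ρ σ) :
    comp (leftUnit σ) (times (one (unit A)) T) = comp T (leftUnit ρ) := by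
  refine Subtype.ext ?_
  rw [leftUnit, leftUnit, relabel_comp, comp_relabel]
  ext i ⟨_, j⟩
  refine (times_apply (one (unit A)) T ((), i) ((), j)).trans ?_
  refine (congrFun (congrFun ((one (unit A)).2.2.2 (T.1 i j)) ()) ()).trans ?_
  refine (congrFun (congrFun (map_mul (unit A).hom (T.1 i j) 1).symm ()) ()).trans ?_
  exact mul_one (T.1 i j)

theorem rightUnit_natural {ρ σ : Bimodule A} (T : Hom ρ σ) :
    comp (rightUnit σ) (times T (one (unit A))) = comp T (rightUnit ρ) := by
  refine Subtype.ext ?_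
  rw [rightUnit, rightUnit, relabel_comp, comp_relabel]
  ext i ⟨j, _⟩
  refine (times_apply T (one (unit A)) (i, ()) (j, ())).trans ?_
  show (T.1 * ρ.hom 1) i j = _
  rw [T.2.1]
  rfl

theorem reassoc_eq {ρ σ τ ρ' σ' τ' : Bimodule A}
    (T : Hom (tensor (tensor ρ σ) τ) (tensor (tensor ρ' σ') τ')) :
    reassoc T = comp (assoc ρ' σ' τ') (comp T (assocInv ρ σ τ)) := by
  refine Subtype.ext ?_
  rw [assoc, assocInv, relabel_comp, comp_relabel]
  rfl

theorem adj_comp {ρ σ τ : Bimodule A} (S : Hom σ τ) (T : Hom ρ σ) :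
    adj (comp S T) = comp (adj T) (adj S) := Subtype.ext (Matrix.conjTranspose_mul _ _)

theorem adj_adj {ρ σ : Bimodule A} (T : Hom ρ σ) : adj (adj T) = T :=
  Subtype.ext (Matrix.conjTranspose_conjTranspose _)

theorem adj_one (ρ : Bimodule A) : adj (one ρ) = one ρ := Subtype.ext (by
  show (ρ.hom 1)ᴴ = ρ.hom 1
  rw [← Matrix.star_eq_conjTranspose, ← map_star, star_one])

theorem adj_assoc (ρ σ τ : Bimodule A) : adj (assoc ρ σ τ) = assocInv ρ σ τ :=
  adj_relabel _ _ fun _ => rfl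

theorem adj_leftUnit (ρ : Bimodule A) : adj (leftUnit ρ) = leftUnitInv ρ :=
  adj_relabel _ _ fun _ => rfl

theorem add_times {ρ ρ' σ σ' : Bimodule A} (T T' : Hom ρ ρ') (S : Hom σ σ') :
    times (T + T') S = times T S + times T' S := by
  refine Subtype.ext (block_ext fun i j => (block_times _ _ i j).trans ?_)
  refine (Matrix.add_mul _ _ _).trans ?_
  rw [← block_times, ← block_times]
  rfl

theorem smul_times {ρ ρ' σ σ' : Bimodule A} (c : ℂ) (T : Hom ρ ρ') (S : Hom σ σ') :
    times (c • T) S = c • times T S := by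
  refine Subtype.ext (block_ext fun i j => (block_times _ _ i j).trans ?_)
  refine (Matrix.smul_mul _ _ _).trans ?_
  rw [← block_times]
  rfl

theorem times_add {ρ ρ' σ σ' : Bimodule A} (T : Hom ρ ρ') (S S' : Hom σ σ') :
    times T (S + S') = times T S + times T S' := by
  refine Subtype.ext (block_ext fun i j => (block_times _ _ i j).trans ?_)
  refine (congrArg (T.1 * ·) (map_add ρ.hom _ _)).trans ((Matrix.mul_add _ _ _).trans ?_)
  rw [← block_times, ← block_times]
  rfl

theorem times_smul {ρ ρ' σ σ' : Bimodule A} (c : ℂ) (T : Hom ρ ρ') (S : Hom σ σ') :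
    times T (c • S) = c • times T S := by
  refine Subtype.ext (block_ext fun i j => (block_times _ _ i j).trans ?_)
  refine (congrArg (T.1 * ·) (map_smul ρ.hom _ _)).trans ((Matrix.mul_smul _ _ _).trans ?_)
  rw [← block_times]
  rfl

end Bimodule

/-! ### The linear monoidal category of objects -/

namespace LocalNet

open CategoryTheory MonoidalCategory

variable {H : Type*} [NormedAddCommGroup H] [InnerProductSpace ℂ H] [CompleteSpace H]
variable {N : LocalNet H}

/-- The order of composition is reversed: `S ≫ T` is the matrix product T · S. In particular the
positive element X⁺X is written `X ≫ dag X` below. -/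
instance : Category N.Obj where
  Hom ρ σ := Bimodule.Hom ρ.toBimodule σ.toBimodule
  id ρ := Bimodule.one ρ.toBimodule
  comp S T := Bimodule.comp T S
  id_comp T := Bimodule.comp_one T
  comp_id T := Bimodule.one_comp T
  assoc _ _ _ := (Bimodule.comp_assoc _ _ _).symm

instance : Preadditive N.Obj where
  homGroup ρ σ := inferInstanceAs (AddCommGroup (Bimodule.Hom ρ.toBimodule σ.toBimodule))
  add_comp _ _ _ S S' T := Subtype.ext (Matrix.mul_add (T : Bimodule.Hom _ _).1
    (S : Bimodule.Hom _ _).1 (S' : Bimodule.Hom _ _).1)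
  comp_add _ _ _ S T T' := Subtype.ext (Matrix.add_mul (T : Bimodule.Hom _ _).1
    (T' : Bimodule.Hom _ _).1 (S : Bimodule.Hom _ _).1)

instance : Linear ℂ N.Obj where
  homModule ρ σ := inferInstanceAs (Module ℂ (Bimodule.Hom ρ.toBimodule σ.toBimodule))
  smul_comp _ _ _ c S T := Subtype.ext (Matrix.mul_smul (T : Bimodule.Hom _ _).1 c
    (S : Bimodule.Hom _ _).1)
  comp_smul _ _ _ S c T := Subtype.ext (Matrix.smul_mul c (T : Bimodule.Hom _ _).1
    (S : Bimodule.Hom _ _).1)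

instance : MonoidalCategoryStruct N.Obj where
  tensorObj ρ σ := ρ.tensor σ
  tensorUnit := Obj.unit N
  tensorHom T S := Bimodule.times T S
  whiskerLeft ρ _ _ T := Bimodule.times (Bimodule.one ρ.toBimodule) T
  whiskerRight T ρ := Bimodule.times T (Bimodule.one ρ.toBimodule)
  associator ρ σ τ :=
    { hom := Bimodule.assoc ρ.toBimodule σ.toBimodule τ.toBimodule
      inv := Bimodule.assocInv ρ.toBimodule σ.toBimodule τ.toBimodule
      hom_inv_id := Bimodule.assoc_assocInv ρ.toBimodule σ.toBimodule τ.toBimodule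
      inv_hom_id := Bimodule.assocInv_assoc ρ.toBimodule σ.toBimodule τ.toBimodule }
  leftUnitor ρ :=
    { hom := Bimodule.leftUnit ρ.toBimodule
      inv := Bimodule.leftUnitInv ρ.toBimodule
      hom_inv_id := Bimodule.leftUnit_leftUnitInv ρ.toBimodule
      inv_hom_id := Bimodule.leftUnitInv_leftUnit ρ.toBimodule }
  rightUnitor ρ :=
    { hom := Bimodule.rightUnit ρ.toBimodule
      inv := Bimodule.rightUnitInv ρ.toBimodule
      hom_inv_id := Bimodule.rightUnit_rightUnitInv ρ.toBimodule
      inv_hom_id := Bimodule.rightUnitInv_rightUnit ρ.toBimodule }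

instance : MonoidalCategory N.Obj := MonoidalCategory.ofTensorHom
  (id_tensorHom_id := fun ρ σ => Bimodule.times_one ρ.toBimodule σ.toBimodule)
  (id_tensorHom := fun _ _ _ _ => rfl)
  (tensorHom_id := fun _ _ => rfl)
  (tensorHom_comp_tensorHom := fun T S T' S' => Bimodule.comp_times T' T S' S)
  (associator_naturality := fun R S T => Bimodule.times_times R S T)
  (leftUnitor_naturality := fun T => Bimodule.leftUnit_natural T)
  (rightUnitor_naturality := fun T => Bimodule.rightUnit_natural T)
  (pentagon := fun ρ σ τ π =>
    Bimodule.pentagon ρ.toBimodule σ.toBimodule τ.toBimodule π.toBimodule)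
  (triangle := fun ρ σ => Bimodule.triangle ρ.toBimodule σ.toBimodule)

instance : MonoidalPreadditive N.Obj where
  whiskerLeft_add _ _ := Bimodule.times_add _ _ _
  add_whiskerRight _ _ := Bimodule.add_times _ _ _
  whiskerLeft_zero := by
    intro ρ σ τ
    have h := Bimodule.times_smul (0 : ℂ) (Bimodule.one ρ.toBimodule) (0 : Bimodule.Hom σ.toBimodule τ.toBimodule)
    rw [zero_smul, zero_smul] at h
    exact h
  zero_whiskerRight := by
    intro ρ σ τ
    have h := Bimodule.smul_times (0 : ℂ) (0 : Bimodule.Hom σ.toBimodule τ.toBimodule) (Bimodule.one ρ.toBimodule)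
    rw [zero_smul, zero_smul] at h
    exact h

instance : MonoidalLinear ℂ N.Obj where
  whiskerLeft_smul _ _ _ c T := Bimodule.times_smul c _ T
  smul_whiskerRight c _ _ T _ := Bimodule.smul_times c T _

end LocalNet
end

/-! ### Connectedness of the spacelike separated pairs of double cones -/

noncomputable section

namespace DoubleCone

/-- The double cone centred at `c` with radius `r` in its rest frame. -/
def ball (c : Minkowski) (r : ℝ) (hr : 0 < r) : DoubleCone :=
  ⟨{z | |z.1 - c.1| + ‖z.2 - c.2‖ < r}, (c.1 - r, c.2), (c.1 + r, c.2), by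
    simp [forwardCone, hr], by
    ext z
    simp only [forwardCone, Set.mem_ofPred_eq, Prod.fst_sub, Prod.snd_sub]
    rw [norm_sub_rev c.2 z.2]
    constructor
    · intro h
      have := abs_le.1 (le_refl |z.1 - c.1|)
      constructor <;> linarith
    · rintro ⟨h1, h2⟩
      rcases abs_cases (z.1 - c.1) with h | h <;> linarith⟩

theorem ball_subset {c d : Minkowski} {r s : ℝ} (hr : 0 < r) (hs : 0 < s)
    (h : |c.1 - d.1| + ‖c.2 - d.2‖ + r ≤ s) : (ball c r hr).1 ⊆ (ball d s hs).1 := fun z hz => by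
  have hz' : |z.1 - c.1| + ‖z.2 - c.2‖ < r := hz
  have h1 := norm_sub_le_norm_sub_add_norm_sub z.2 c.2 d.2
  have h2 := abs_sub_le z.1 c.1 d.1
  show |z.1 - d.1| + ‖z.2 - d.2‖ < s
  linarith

theorem ball_perp {c d : Minkowski} {r s : ℝ} (hr : 0 < r) (hs : 0 < s)
    (h : |c.1 - d.1| + r + s ≤ ‖c.2 - d.2‖) : Perp (ball c r hr) (ball d s hs) := fun z hz w hw => by
  have hz' : |z.1 - c.1| + ‖z.2 - c.2‖ < r := hz
  have hw' : |w.1 - d.1| + ‖w.2 - d.2‖ < s := hw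
  have h1 := norm_sub_le_norm_sub_add_norm_sub c.2 z.2 d.2
  have h2 := norm_sub_le_norm_sub_add_norm_sub z.2 w.2 d.2
  have h3 := abs_sub_le z.1 c.1 w.1
  have h4 := abs_sub_le c.1 d.1 w.1
  rw [norm_sub_rev c.2 z.2] at h1
  rw [abs_sub_comm d.1 w.1] at h4
  show |z.1 - w.1| < ‖z.2 - w.2‖
  linarith

theorem nonempty (a : DoubleCone) : a.1.Nonempty := by
  obtain ⟨s, x, y, hxy, rfl⟩ := a
  refine ⟨(2⁻¹ : ℝ) • (x + y), ?_⟩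
  have e1 : (2⁻¹ : ℝ) • (x + y) - x = (2⁻¹ : ℝ) • (y - x) := by module
  have e2 : y - (2⁻¹ : ℝ) • (x + y) = (2⁻¹ : ℝ) • (y - x) := by module
  have h : ‖y.2 - x.2‖ < y.1 - x.1 := hxy
  have h' : (2⁻¹ : ℝ) • (y - x) ∈ forwardCone := by
    show ‖(2⁻¹ : ℝ) • (y.2 - x.2)‖ < 2⁻¹ * (y.1 - x.1)
    rw [norm_smul, Real.norm_of_nonneg (by norm_num)]
    linarith
  exact ⟨e1 ▸ h', e2 ▸ h'⟩

theorem exists_ball_subset {a : DoubleCone} {x : Minkowski} (hx : x ∈ a.1) :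
    ∃ δ : ℝ, 0 < δ ∧ ∀ r (hr : 0 < r), r ≤ δ → (ball x r hr).1 ⊆ a.1 := by
  obtain ⟨s, p, q, hpq, rfl⟩ := a
  obtain ⟨h1, h2⟩ := hx
  have h1' : ‖x.2 - p.2‖ < x.1 - p.1 := h1
  have h2' : ‖q.2 - x.2‖ < q.1 - x.1 := h2
  refine ⟨min (x.1 - p.1 - ‖x.2 - p.2‖) (q.1 - x.1 - ‖q.2 - x.2‖),
    lt_min (by linarith) (by linarith), fun r hr hrδ z hz => ?_⟩
  have hz' : |z.1 - x.1| + ‖z.2 - x.2‖ < r := hz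
  have h3 := hrδ.trans (min_le_left _ _)
  have h4 := hrδ.trans (min_le_right _ _)
  have h5 := norm_sub_le_norm_sub_add_norm_sub z.2 x.2 p.2
  have h6 := norm_sub_le_norm_sub_add_norm_sub q.2 x.2 z.2
  rw [norm_sub_rev x.2 z.2] at h6
  have h7 := abs_le.1 (le_refl |z.1 - x.1|)
  constructor
  · show ‖z.2 - p.2‖ < z.1 - p.1
    linarith
  · show ‖q.2 - z.2‖ < q.1 - z.1
    linarith

/-- As L grows, ‖v - L w‖ is L - ⟨v, w⟩ up to a term of order 1/L: large balls whose boundary passes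
through a fixed point exhaust a half-space. -/
theorem exists_norm_sub_smul_le {E : Type*} [NormedAddCommGroup E] [InnerProductSpace ℝ E]
    {w v : E} {k : ℝ} (hw : ‖w‖ = 1) (hk : k < inner ℝ v w) (L₀ : ℝ) :
    ∃ L ≥ L₀, ‖v - L • w‖ ≤ L - k := by
  let L := max (max L₀ k) (‖v‖ ^ 2 / (2 * (inner ℝ v w - k)))
  have hpos : 0 < 2 * (inner ℝ v w - k) := by linarith
  have hL : ‖v‖ ^ 2 ≤ L * (2 * (inner ℝ v w - k)) :=
    (div_le_iff₀ hpos).1 (le_max_right _ _)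
  have hLk : k ≤ L := (le_max_right _ _).trans (le_max_left _ _)
  refine ⟨L, (le_max_left _ _).trans (le_max_left _ _), ?_⟩
  refine abs_le_of_sq_le_sq' ?_ (by linarith) |>.2
  rw [norm_sub_sq_real, norm_smul, inner_smul_right, hw, mul_one, Real.norm_eq_abs, sq_abs]
  nlinarith [sq_nonneg k]

/-- The bisector ‖w‖ v + ‖v‖ w makes acute angles with both vectors unless they point in opposite
directions, which is the equality case of Cauchy-Schwarz. -/
theorem exists_inner_pos {E : Type*} [NormedAddCommGroup E] [InnerProductSpace ℝ E] {v w : E}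
    (h : ∀ c : ℝ, w ≠ c • v) (hv : v ≠ 0) :
    ∃ f : E, ‖f‖ = 1 ∧ 0 < inner ℝ f v ∧ 0 < inner ℝ f w := by
  have hw : w ≠ 0 := fun h0 => h 0 (by rw [h0, zero_smul])
  have nv := norm_pos_iff.2 hv
  have nw := norm_pos_iff.2 hw
  let g := ‖w‖ • v + ‖v‖ • w
  have hlt : -(‖v‖ * ‖w‖) < inner ℝ v w := by
    refine lt_of_le_of_ne (neg_le_of_abs_le (abs_real_inner_le_norm v w)) fun heq => ?_
    have h1 : g = 0 := by
      rw [← norm_eq_zero, ← sq_eq_zero_iff, norm_add_sq_real, norm_smul, norm_smul,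
        inner_smul_left, inner_smul_right, ← heq]
      simp
      ring
    refine h (-(‖v‖⁻¹ * ‖w‖)) ?_
    have h2 : ‖v‖ • w = -(‖w‖ • v) := eq_neg_of_add_eq_zero_right h1
    rw [neg_smul, mul_smul, ← smul_neg, ← h2, smul_smul, inv_mul_cancel₀ nv.ne', one_smul]
  have gv : 0 < inner ℝ g v := by
    rw [inner_add_left, inner_smul_left, inner_smul_left, real_inner_self_eq_norm_sq,
      real_inner_comm]
    simp
    nlinarith
  have gw : 0 < inner ℝ g w := by
    rw [inner_add_left, inner_smul_left, inner_smul_left, real_inner_self_eq_norm_sq]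
    simp
    nlinarith
  have ng : 0 < ‖g‖ := norm_pos_iff.2 fun h0 => by rw [h0, inner_zero_left] at gv; exact gv.false
  refine ⟨‖g‖⁻¹ • g, by rw [norm_smul, norm_inv, norm_norm, inv_mul_cancel₀ ng.ne'], ?_, ?_⟩
  · rw [inner_smul_left]; simpa using mul_pos (inv_pos.2 ng) gv
  · rw [inner_smul_left]; simpa using mul_pos (inv_pos.2 ng) gw

/-- Every double cone contains points that avoid a given line in the space directions. -/
theorem exists_mem_not_parallel (o : DoubleCone) (y : Minkowski)
    {v : EuclideanSpace ℝ (Fin 3)} (hv : v ≠ 0) :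
    ∃ x ∈ o.1, ∀ c : ℝ, (x - y).2 ≠ c • v := by
  obtain ⟨x, hx⟩ := o.nonempty
  by_cases h : ∀ c : ℝ, (x - y).2 ≠ c • v
  · exact ⟨x, hx, h⟩
  push Not at h
  obtain ⟨c, hc⟩ := h
  obtain ⟨δ, hδ, hb⟩ := exists_ball_subset hx
  -- A line does not fill three-dimensional space, so x can be displaced off it by a vector of
  -- length δ/2 without leaving the cone.
  obtain ⟨u, hu⟩ : ∃ u : EuclideanSpace ℝ (Fin 3), u ∉ Submodule.span ℝ {v} := by
    by_contra! hall
    have h1 : Submodule.span ℝ {v} = ⊤ := eq_top_iff.2 fun u _ => hall u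
    have h2 := finrank_span_singleton (K := ℝ) hv
    rw [h1, finrank_top, finrank_euclideanSpace_fin] at h2
    omega
  have hu0 : u ≠ 0 := fun h0 => hu (h0 ▸ Submodule.zero_mem _)
  have nu := norm_pos_iff.2 hu0
  let s := δ / (2 * ‖u‖)
  have hs : 0 < s := by positivity
  refine ⟨(x.1, x.2 + s • u), hb δ hδ le_rfl ?_, fun c' hc' => hu ?_⟩
  · show |x.1 - x.1| + ‖x.2 + s • u - x.2‖ < δ
    rw [sub_self, abs_zero, add_sub_cancel_left, norm_smul, Real.norm_of_nonneg hs.le]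
    have : s * ‖u‖ = δ / 2 := by simp only [s]; field_simp
    linarith
  · have h1 : x.2 - y.2 = c • v := hc
    have h2 : x.2 + s • u - y.2 = c' • v := hc'
    have h3 : s • u = (c' - c) • v := by rw [sub_smul, ← h1, ← h2]; abel
    refine Submodule.mem_span_singleton.2 ⟨s⁻¹ * (c' - c), ?_⟩
    rw [mul_smul, ← h3, smul_smul, inv_mul_cancel₀ hs.ne', one_smul]

section Connected

variable {X : Type*} {F : DoubleCone → DoubleCone → X}
  (hF : ∀ o o' a a' : DoubleCone, o'.1 ⊆ o.1 → a'.1 ⊆ a.1 → Perp o a → F o a = F o' a')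
include hF

/-- A pair of spacelike separated double cones can be moved to a pair whose first component
lies far away in any direction `f` that makes an acute angle with the original one. -/
theorem eq_of_move {o a : DoubleCone} (hoa : Perp o a) {x y : Minkowski} (hx : x ∈ o.1)
    (hy : y ∈ a.1) {f : EuclideanSpace ℝ (Fin 3)} (hf : 0 < inner ℝ f (x - y).2) :
    ∃ b : DoubleCone, b.1 ⊆ a.1 ∧ ∃ M₀ : ℝ, ∀ M ≥ M₀,
      F o a = F (ball (0, M • f) 1 one_pos) b := by
  have hxy : |x.1 - y.1| < ‖x.2 - y.2‖ := hoa x hx y hy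
  obtain ⟨δ₁, hδ₁, hb₁⟩ := exists_ball_subset hx
  obtain ⟨δ₂, hδ₂, hb₂⟩ := exists_ball_subset hy
  -- The third bound leaves room for the ball around x inside the large ball constructed below.
  let δ := min (min δ₁ δ₂) ((‖x.2 - y.2‖ - |x.1 - y.1|) / 2)
  have hδ : 0 < δ := lt_min (lt_min hδ₁ hδ₂) (by linarith)
  have hd₁ : δ ≤ δ₁ := (min_le_left _ _).trans (min_le_left _ _)
  have hd₂ : δ ≤ δ₂ := (min_le_left _ _).trans (min_le_right _ _)
  have hd₃ : 2 * δ ≤ ‖x.2 - y.2‖ - |x.1 - y.1| := by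
    have := min_le_right (min δ₁ δ₂) ((‖x.2 - y.2‖ - |x.1 - y.1|) / 2)
    linarith
  set w := x.2 - y.2 with hwdef
  have hwpos : 0 < ‖w‖ := (abs_nonneg _).trans_lt hxy
  let e := ‖w‖⁻¹ • w
  have he : ‖e‖ = 1 := by rw [norm_smul, norm_inv, norm_norm, inv_mul_cancel₀ hwpos.ne']
  have hwe : w = ‖w‖ • e := by rw [smul_smul, mul_inv_cancel₀ hwpos.ne', one_smul]
  have hfe : 0 < inner ℝ f e := by
    rw [inner_smul_right]; exact mul_pos (inv_pos.2 hwpos) hf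
  refine ⟨ball y δ hδ, hb₂ δ hδ hd₂, (|y.1| + 2 + δ + inner ℝ y.2 e) / inner ℝ f e,
    fun M hM => ?_⟩
  have hM' : |y.1| + 2 + δ + inner ℝ y.2 e ≤ M * inner ℝ f e := (div_le_iff₀ hfe).1 hM
  -- The ball of radius L - δ around y + (0, L e) is spacelike to the ball of radius δ around y. For
  -- large L it contains both the ball around x and the distant unit ball, so the first component is
  -- enlarged to it and then shrunk to the distant ball.
  obtain ⟨L, hL, hLn⟩ := exists_norm_sub_smul_le (v := M • f - y.2) (w := e)
    (k := |y.1| + 1 + δ) he (by rw [inner_sub_left, inner_smul_left]; simp; linarith)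
    (‖w‖ + δ + 1)
  have hr : 0 < L - δ := by linarith
  have hp : Perp (ball (y + (0, L • e)) (L - δ) hr) (ball y δ hδ) := by
    refine ball_perp _ _ ?_
    simp only [Prod.fst_add, Prod.snd_add, add_zero, sub_self, abs_zero, add_sub_cancel_left]
    rw [norm_smul, he, Real.norm_of_nonneg (by linarith)]
    linarith
  rw [hF o (ball x δ hδ) a (ball y δ hδ) (hb₁ δ hδ hd₁) (hb₂ δ hδ hd₂) hoa,
    ← hF (ball (y + (0, L • e)) (L - δ) hr) (ball x δ hδ) (ball y δ hδ) (ball y δ hδ) ?_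
      subset_rfl hp,
    hF (ball (y + (0, L • e)) (L - δ) hr) (ball (0, M • f) 1 one_pos) (ball y δ hδ)
      (ball y δ hδ) ?_ subset_rfl hp]
  · refine ball_subset _ _ ?_
    simp only [Prod.fst_add, Prod.snd_add, add_zero, zero_sub, abs_neg]
    rw [← sub_sub]
    linarith
  · refine ball_subset _ _ ?_
    simp only [Prod.fst_add, Prod.snd_add, add_zero]
    rw [← sub_sub, ← hwdef]
    have h1 : w - L • e = (‖w‖ - L) • e := by rw [sub_smul, ← hwe]
    rw [h1, norm_smul, he, mul_one, Real.norm_eq_abs,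
      abs_of_nonpos (show ‖w‖ - L ≤ 0 by linarith)]
    linarith

/-- The pairs of spacelike separated double cones are connected. -/
theorem eq_of_perp {o a o' a' : DoubleCone} (h : Perp o a) (h' : Perp o' a') :
    F o a = F o' a' := by
  obtain ⟨x, hx⟩ := o.nonempty
  obtain ⟨y, hy⟩ := a.nonempty
  obtain ⟨y', hy'⟩ := a'.nonempty
  have hv : (x - y).2 ≠ 0 := fun h0 => by
    have := h x hx y hy
    rw [IsSpacelike, h0, norm_zero] at this
    exact (abs_nonneg _).not_gt this
  -- With x' - y' not parallel to x - y in space there is one direction f acute to both, and both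
  -- pairs can be moved along it.
  obtain ⟨x', hx', hpar⟩ := exists_mem_not_parallel o' y' hv
  obtain ⟨f, hf1, hf2, hf3⟩ := exists_inner_pos hpar hv
  obtain ⟨b, hb, M₁, h1⟩ := eq_of_move hF h hx hy hf2
  obtain ⟨b', hb', M₂, h2⟩ := eq_of_move hF h' hx' hy' hf3
  obtain ⟨c, hc, hc'⟩ := exists_union_subset a a'
  obtain ⟨K, hK, hcK⟩ := exists_subset_diamond c
  -- The distant ball is then also spacelike to one diamond that contains both second components,
  -- and the pair formed with this diamond compares the two.
  let M := max (max M₁ M₂) (1 + K)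
  have hM : 1 + K ≤ M := le_max_right _ _
  have hp : Perp (ball (0, M • f) 1 one_pos) (diamond 0 K hK) := by
    have e : diamond 0 K hK = ball 0 K hK := Subtype.ext (Set.ext fun z => by
      show |z.1| + ‖z.2 - 0‖ < K ↔ |z.1 - 0| + ‖z.2 - 0‖ < K
      rw [sub_zero z.1])
    rw [e]
    refine ball_perp _ _ ?_
    simp only [Prod.fst_zero, Prod.snd_zero, sub_zero, abs_zero, zero_add]
    rw [norm_smul, hf1, mul_one, Real.norm_of_nonneg (by linarith)]
    exact hM
  rw [h1 M ((le_max_left _ _).trans (le_max_left _ _)),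
    h2 M ((le_max_right _ _).trans (le_max_left _ _)),
    ← hF _ _ _ b subset_rfl ((hb.trans hc).trans (hcK K hK le_rfl)) hp,
    ← hF _ _ _ b' subset_rfl ((hb'.trans hc').trans (hcK K hK le_rfl)) hp]

end Connected

end DoubleCone
end

/-! ### Independence of choices, naturality and hexagons of the symmetry -/

noncomputable section

namespace Bimodule

variable {A : Type*} [Ring A] [StarRing A] [Algebra ℂ A]

theorem hexagon_relabel {ρ σ τ : Bimodule A}
    (h₁ : ∀ a, (tensor σ ρ).hom a = ((tensor ρ σ).hom a).submatrix
      (Equiv.prodComm σ.ι ρ.ι) (Equiv.prodComm σ.ι ρ.ι))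
    (h₂ : ∀ a, (tensor τ ρ).hom a = ((tensor ρ τ).hom a).submatrix
      (Equiv.prodComm τ.ι ρ.ι) (Equiv.prodComm τ.ι ρ.ι))
    (h₃ : ∀ a, (tensor (tensor σ τ) ρ).hom a = ((tensor ρ (tensor σ τ)).hom a).submatrix
      (Equiv.prodComm (tensor σ τ).ι ρ.ι) (Equiv.prodComm (tensor σ τ).ι ρ.ι)) :
    comp (comp (assoc σ τ ρ) (relabel _ h₃)) (assoc ρ σ τ) =
    comp (comp (times (one σ) (relabel _ h₂)) (assoc σ ρ τ)) (times (relabel _ h₁) (one τ)) := by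
  rw [assoc, assoc, assoc, times_one_relabel, times_relabel_one]
  refine Subtype.ext ?_
  rw [comp_assoc, comp_assoc]
  simp only [relabel_comp]
  rfl

end Bimodule

namespace LocalNet

open CategoryTheory MonoidalCategory

variable {H : Type*} [NormedAddCommGroup H] [InnerProductSpace ℂ H] [CompleteSpace H]
variable {N : LocalNet H}

/-- The matrix `(V⁺ × U⁺) · θ · (U × V)`. -/
def exchangeMatrix {ρ σ ρ₁ σ₁ : Bimodule N.globalAlg} (U : Bimodule.Hom ρ ρ₁)
    (V : Bimodule.Hom σ σ₁) :
    Matrix (Bimodule.tensor σ ρ).ι (Bimodule.tensor ρ σ).ι N.globalAlg :=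
  (Bimodule.times (Bimodule.adj V) (Bimodule.adj U)).1 *
    (Bimodule.times U V).1.submatrix (Equiv.prodComm σ₁.ι ρ₁.ι) id

/-- The transported arrows U' T U⁺ and V' S V⁺ connect objects localized in spacelike separated
cones. Their entries commute, so the flip exchanges their tensor product. -/
theorem exchangeMatrix_mul_times {ρ σ ρ₁ σ₁ ρ' σ' ρ₁' σ₁' : Bimodule N.globalAlg}
    {o a : DoubleCone} (hoa : DoubleCone.Perp o a)
    {U : Bimodule.Hom ρ ρ₁} {V : Bimodule.Hom σ σ₁}
    {U' : Bimodule.Hom ρ' ρ₁'} {V' : Bimodule.Hom σ' σ₁'}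
    (hρ₁ : IsLocalizedIn (toMor ρ₁) o) (hσ₁ : IsLocalizedIn (toMor σ₁) a)
    (hρ₁' : IsLocalizedIn (toMor ρ₁') o) (hσ₁' : IsLocalizedIn (toMor σ₁') a)
    (hU : Bimodule.IsUnitary U) (hV : Bimodule.IsUnitary V)
    (hU' : Bimodule.IsUnitary U') (hV' : Bimodule.IsUnitary V')
    (T : Bimodule.Hom ρ ρ') (S : Bimodule.Hom σ σ') :
    exchangeMatrix U' V' * (Bimodule.times T S).1 =
      (Bimodule.times S T).1 * exchangeMatrix U V := by
  let T₁ := Bimodule.comp U' (Bimodule.comp T (Bimodule.adj U))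
  let S₁ := Bimodule.comp V' (Bimodule.comp S (Bimodule.adj V))
  have hT : Bimodule.comp T₁ U = Bimodule.comp U' T := by
    simp only [T₁, Bimodule.comp_assoc, hU.1, Bimodule.comp_one]
  have hS : Bimodule.comp S₁ V = Bimodule.comp V' S := by
    simp only [S₁, Bimodule.comp_assoc, hV.1, Bimodule.comp_one]
  have hT' : Bimodule.comp (Bimodule.adj U') T₁ = Bimodule.comp T (Bimodule.adj U) := by
    simp only [T₁, ← Bimodule.comp_assoc, hU'.1, Bimodule.one_comp]
  have hS' : Bimodule.comp (Bimodule.adj V') S₁ = Bimodule.comp S (Bimodule.adj V) := by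
    simp only [S₁, ← Bimodule.comp_assoc, hV'.1, Bimodule.one_comp]
  have h1 : (Bimodule.times U' V').1.submatrix (Equiv.prodComm σ₁'.ι ρ₁'.ι) id *
      (Bimodule.times T S).1 =
      (Bimodule.times S₁ T₁).1 * (Bimodule.times U V).1.submatrix (Equiv.prodComm σ₁.ι ρ₁.ι) id := by
    rw [times_swap hρ₁ hρ₁' hσ₁ hσ₁' hoa.symm T₁ S₁]
    have e1 : (Bimodule.times U' V').1 * (Bimodule.times T S).1 =
        (Bimodule.times T₁ S₁).1 * (Bimodule.times U V).1 := by
      refine (congrArg Subtype.val (Bimodule.comp_times U' T V' S)).trans ?_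
      rw [← hT, ← hS]
      exact (congrArg Subtype.val (Bimodule.comp_times T₁ U S₁ V)).symm
    refine (Matrix.submatrix_mul_equiv (Bimodule.times U' V').1 (Bimodule.times T S).1
      (Equiv.prodComm σ₁'.ι ρ₁'.ι) (Equiv.refl _) id).trans ?_
    rw [e1]
    exact (Matrix.submatrix_mul_equiv (Bimodule.times T₁ S₁).1 (Bimodule.times U V).1
      (Equiv.prodComm σ₁'.ι ρ₁'.ι) (Equiv.prodComm σ₁.ι ρ₁.ι) id).symm
  rw [exchangeMatrix, exchangeMatrix, Matrix.mul_assoc, h1, ← Matrix.mul_assoc, ← Matrix.mul_assoc]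
  congr 1
  refine (congrArg Subtype.val (Bimodule.comp_times (Bimodule.adj V') S₁ (Bimodule.adj U') T₁)).trans ?_
  rw [hT', hS']
  exact (congrArg Subtype.val (Bimodule.comp_times S (Bimodule.adj V) T (Bimodule.adj U))).symm

theorem exchangeMatrix_eq {ρ σ ρ₁ σ₁ ρ₁' σ₁' : Bimodule N.globalAlg}
    {o a : DoubleCone} (hoa : DoubleCone.Perp o a)
    {U : Bimodule.Hom ρ ρ₁} {V : Bimodule.Hom σ σ₁}
    {U' : Bimodule.Hom ρ ρ₁'} {V' : Bimodule.Hom σ σ₁'}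
    (hρ₁ : IsLocalizedIn (toMor ρ₁) o) (hσ₁ : IsLocalizedIn (toMor σ₁) a)
    (hρ₁' : IsLocalizedIn (toMor ρ₁') o) (hσ₁' : IsLocalizedIn (toMor σ₁') a)
    (hU : Bimodule.IsUnitary U) (hV : Bimodule.IsUnitary V)
    (hU' : Bimodule.IsUnitary U') (hV' : Bimodule.IsUnitary V') :
    exchangeMatrix U V = exchangeMatrix U' V' := by
  have h := exchangeMatrix_mul_times hoa hρ₁ hσ₁ hρ₁' hσ₁' hU hV hU' hV'
    (Bimodule.one ρ) (Bimodule.one σ)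
  rw [Bimodule.times_one, Bimodule.times_one] at h
  have h1 : (Bimodule.one (Bimodule.tensor σ ρ)).1 * exchangeMatrix U V = exchangeMatrix U V := by
    rw [exchangeMatrix, ← Matrix.mul_assoc]
    exact congrArg (· * _) (Bimodule.times (Bimodule.adj V) (Bimodule.adj U)).2.2.1
  have h2 : exchangeMatrix U' V' * (Bimodule.one (Bimodule.tensor ρ σ)).1 =
      exchangeMatrix U' V' := by
    rw [exchangeMatrix, Matrix.mul_assoc]
    refine congrArg (_ * ·) ?_
    refine (Matrix.submatrix_mul_equiv (Bimodule.times U' V').1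
      (Bimodule.one (Bimodule.tensor ρ σ)).1 _ (Equiv.refl _) id).trans ?_
    exact congrArg (fun M => Matrix.submatrix M _ _) (Bimodule.times U' V').2.1
  rw [← h1, ← h, h2]

/-- The symmetry as an arrow between tensor products of bimodules. -/
def swapArrow (ρ σ : N.Obj) :
    Bimodule.Hom (Bimodule.tensor ρ.toBimodule σ.toBimodule)
      (Bimodule.tensor σ.toBimodule ρ.toBimodule) := symmetry ρ σ

/-- The symmetry does not depend on the choice of the unitaries in its definition. -/
theorem symmetry_eq (ρ σ : N.Obj) {ρ₁ σ₁ : N.Obj} {o a : DoubleCone}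
    (hoa : DoubleCone.Perp o a) {U : Bimodule.Hom ρ.toBimodule ρ₁.toBimodule}
    {V : Bimodule.Hom σ.toBimodule σ₁.toBimodule}
    (hρ₁ : IsLocalizedIn (toMor ρ₁.toBimodule) o) (hσ₁ : IsLocalizedIn (toMor σ₁.toBimodule) a)
    (hU : Bimodule.IsUnitary U) (hV : Bimodule.IsUnitary V) :
    (swapArrow ρ σ).1 = exchangeMatrix U V := by
  -- Transports are fixed for all double cones at once, so that the exchange matrix becomes a
  -- function of the pair of cones alone.
  choose ρt Ut hρt hUt using ρ.transport
  choose σt Vt hσt hVt using σ.transport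
  obtain ⟨o', a', ρ₁', σ₁', U', V', hoa', hρ₁', hσ₁', hU', hV', hE⟩ :=
    (exists_isExchange ρ σ).choose_spec
  refine hE.trans ?_
  refine (exchangeMatrix_eq hoa' hρ₁' hσ₁' (hρt o') (hσt a') hU' hV' (hUt o') (hVt a')).trans ?_
  refine Eq.trans ?_
    (exchangeMatrix_eq hoa hρ₁ hσ₁ (hρt o) (hσt a) hU hV (hUt o) (hVt a)).symm
  -- Passing to smaller cones changes nothing, because a morphism localized in the smaller cone is
  -- also localized in the larger one and `exchangeMatrix_eq` applies there.
  refine DoubleCone.eq_of_perp (F := fun o a => exchangeMatrix (Ut o) (Vt a)) ?_ hoa' hoa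
  intro o o' a a' ho ha hoa
  exact exchangeMatrix_eq hoa (hρt o) (hσt a) ((hρt o').mono ho) ((hσt a').mono ha)
    (hUt o) (hVt a) (hUt o') (hVt a')

theorem exists_perp : ∃ o a : DoubleCone, DoubleCone.Perp o a :=
  ⟨_, _, DoubleCone.diamond_perp (x := EuclideanSpace.single 0 2) (y := 0) one_pos one_pos (by
    simp; norm_num)⟩

theorem symmetry_natural {ρ ρ' σ σ' : N.Obj} (T : Bimodule.Hom ρ.toBimodule ρ'.toBimodule)
    (S : Bimodule.Hom σ.toBimodule σ'.toBimodule) :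
    Bimodule.comp (swapArrow ρ' σ') (Bimodule.times T S) =
      Bimodule.comp (Bimodule.times S T) (swapArrow ρ σ) := by
  obtain ⟨o, a, hoa⟩ := exists_perp
  obtain ⟨ρ₁, U, hρ₁, hU⟩ := ρ.transport o
  obtain ⟨σ₁, V, hσ₁, hV⟩ := σ.transport a
  obtain ⟨ρ₁', U', hρ₁', hU'⟩ := ρ'.transport o
  obtain ⟨σ₁', V', hσ₁', hV'⟩ := σ'.transport a
  refine Subtype.ext ?_
  show (swapArrow ρ' σ').1 * (Bimodule.times T S).1 = (Bimodule.times S T).1 * (swapArrow ρ σ).1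
  rw [symmetry_eq ρ σ hoa hρ₁ hσ₁ hU hV, symmetry_eq ρ' σ' hoa hρ₁' hσ₁' hU' hV']
  exact exchangeMatrix_mul_times hoa hρ₁ hσ₁ hρ₁' hσ₁' hU hV hU' hV' T S

section LocalizedPair

variable {ρ σ : N.Obj} {o a : DoubleCone} (hoa : DoubleCone.Perp o a)
    (hρ : IsLocalizedIn (toMor ρ.toBimodule) o) (hσ : IsLocalizedIn (toMor σ.toBimodule) a)
include hoa hρ hσ

theorem symmetry_localized_val : (swapArrow ρ σ).1 =
    ((Bimodule.tensor ρ.toBimodule σ.toBimodule).hom 1).submatrix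
      (Equiv.prodComm σ.ι ρ.ι) id := by
  rw [symmetry_eq ρ σ hoa hρ hσ (Bimodule.isUnitary_one _) (Bimodule.isUnitary_one _),
    exchangeMatrix, Bimodule.adj_one, Bimodule.adj_one, Bimodule.times_one, Bimodule.times_one]
  refine (congrArg (· * _) (tensor_swap_one hρ hσ hoa.symm)).trans ?_
  refine (Matrix.submatrix_mul_equiv ((Bimodule.tensor ρ.toBimodule σ.toBimodule).hom 1)
    ((Bimodule.tensor ρ.toBimodule σ.toBimodule).hom 1) _ _ id).trans ?_
  rw [← map_mul, one_mul]

/-- Here ε is the flip up to the unit projection, so its intertwining relation says that ρσ and σρ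
differ by a relabelling. -/
theorem tensor_swap (A : N.globalAlg) :
    (Bimodule.tensor σ.toBimodule ρ.toBimodule).hom A =
    ((Bimodule.tensor ρ.toBimodule σ.toBimodule).hom A).submatrix
      (Equiv.prodComm σ.ι ρ.ι) (Equiv.prodComm σ.ι ρ.ι) := by
  have h : (swapArrow ρ σ).1 * (Bimodule.tensor ρ.toBimodule σ.toBimodule).hom A =
      (Bimodule.tensor σ.toBimodule ρ.toBimodule).hom A * (swapArrow ρ σ).1 :=
    (swapArrow ρ σ).2.2.2 A
  have e : ((Bimodule.tensor ρ.toBimodule σ.toBimodule).hom 1).submatrix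
      (Equiv.prodComm σ.ι ρ.ι) id = ((Bimodule.tensor σ.toBimodule ρ.toBimodule).hom 1).submatrix
      id (Equiv.prodComm σ.ι ρ.ι).symm := by
    rw [tensor_swap_one hρ hσ hoa.symm]; rfl
  rw [symmetry_localized_val hoa hρ hσ] at h
  nth_rewrite 2 [e] at h
  have h1 := Matrix.submatrix_mul_equiv
    ((Bimodule.tensor ρ.toBimodule σ.toBimodule).hom 1)
    ((Bimodule.tensor ρ.toBimodule σ.toBimodule).hom A)
    (Equiv.prodComm σ.ι ρ.ι) (Equiv.refl _) id
  have h2 := Matrix.submatrix_mul_equiv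
    ((Bimodule.tensor σ.toBimodule ρ.toBimodule).hom A)
    ((Bimodule.tensor σ.toBimodule ρ.toBimodule).hom 1) id (Equiv.refl _)
    (Equiv.prodComm σ.ι ρ.ι).symm
  rw [← map_mul, one_mul] at h1
  rw [← map_mul, mul_one] at h2
  have h3 := (h1.symm.trans h).trans h2
  have h4 := congrArg (fun M => Matrix.submatrix M id (Equiv.prodComm σ.ι ρ.ι)) h3
  exact h4.symm

theorem symmetry_localized : swapArrow ρ σ =
    Bimodule.relabel (Equiv.prodComm σ.ι ρ.ι) (tensor_swap hoa hρ hσ) :=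
  Subtype.ext (symmetry_localized_val hoa hρ hσ)

end LocalizedPair

/-- The adjoint of an arrow of the category. -/
def dag {ρ σ : N.Obj} (T : ρ ⟶ σ) : σ ⟶ ρ := Bimodule.adj T

theorem dag_comp {ρ σ τ : N.Obj} (S : ρ ⟶ σ) (T : σ ⟶ τ) : dag (S ≫ T) = dag T ≫ dag S :=
  Bimodule.adj_comp _ _

theorem dag_dag {ρ σ : N.Obj} (T : ρ ⟶ σ) : dag (dag T) = T := Bimodule.adj_adj _

theorem dag_id (ρ : N.Obj) : dag (𝟙 ρ) = 𝟙 ρ := Bimodule.adj_one _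

theorem dag_tensorHom {ρ ρ' σ σ' : N.Obj} (S : ρ ⟶ ρ') (T : σ ⟶ σ') :
    dag (S ⊗ₘ T) = dag S ⊗ₘ dag T := Bimodule.adj_times _ _

theorem dag_whiskerLeft (ρ : N.Obj) {σ σ' : N.Obj} (T : σ ⟶ σ') :
    dag (ρ ◁ T) = ρ ◁ dag T := by
  rw [← id_tensorHom, dag_tensorHom, dag_id, id_tensorHom]

theorem dag_whiskerRight {σ σ' : N.Obj} (T : σ ⟶ σ') (ρ : N.Obj) :
    dag (T ▷ ρ) = dag T ▷ ρ := by
  rw [← tensorHom_id, dag_tensorHom, dag_id, tensorHom_id]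

theorem dag_associator_hom (ρ σ τ : N.Obj) : dag (α_ ρ σ τ).hom = (α_ ρ σ τ).inv :=
  Bimodule.adj_assoc _ _ _

theorem dag_associator_inv (ρ σ τ : N.Obj) : dag (α_ ρ σ τ).inv = (α_ ρ σ τ).hom := by
  rw [← dag_associator_hom, dag_dag]

theorem dag_leftUnitor_hom (ρ : N.Obj) : dag (λ_ ρ).hom = (λ_ ρ).inv :=
  Bimodule.adj_leftUnit _

theorem dag_add {ρ σ : N.Obj} (S T : ρ ⟶ σ) : dag (S + T) = dag S + dag T :=
  Subtype.ext (Matrix.conjTranspose_add (S : Bimodule.Hom _ _).1 (T : Bimodule.Hom _ _).1)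

theorem dag_smul {ρ σ : N.Obj} (c : ℂ) (T : ρ ⟶ σ) :
    dag (c • T) = (starRingEnd ℂ c) • dag T :=
  Subtype.ext (Matrix.conjTranspose_smul c (T : Bimodule.Hom _ _).1)

/-- The unitary isomorphism of an object with an object localized in a given double cone. -/
theorem exists_iso_localized (ρ : N.Obj) (o : DoubleCone) :
    ∃ (ρ₁ : N.Obj) (u : ρ ≅ ρ₁), IsLocalizedIn (toMor ρ₁.toBimodule) o ∧ dag u.hom = u.inv := by
  obtain ⟨ρ₁, U, h1, h2⟩ := ρ.transport o
  exact ⟨ρ₁, ⟨U, Bimodule.adj U, h2.1, h2.2⟩, h1, rfl⟩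

/-- The symmetry as an arrow of the category. -/
def swapHom (ρ σ : N.Obj) : ρ ⊗ σ ⟶ σ ⊗ ρ := swapArrow ρ σ

theorem swapHom_natural {ρ ρ' σ σ' : N.Obj} (T : ρ ⟶ ρ') (S : σ ⟶ σ') :
    (T ⊗ₘ S) ≫ swapHom ρ' σ' = swapHom ρ σ ≫ (S ⊗ₘ T) := symmetry_natural T S

theorem swapHom_localized {ρ σ : N.Obj} {o a : DoubleCone} (hoa : DoubleCone.Perp o a)
    (hρ : IsLocalizedIn (toMor ρ.toBimodule) o) (hσ : IsLocalizedIn (toMor σ.toBimodule) a) :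
    swapHom ρ σ = (Bimodule.relabel (Equiv.prodComm σ.ι ρ.ι) (tensor_swap hoa hρ hσ) :
      Bimodule.Hom (Bimodule.tensor ρ.toBimodule σ.toBimodule)
        (Bimodule.tensor σ.toBimodule ρ.toBimodule)) := symmetry_localized hoa hρ hσ

theorem swapHom_eq_conj {ρ σ ρ₁ σ₁ : N.Obj} (u : ρ ≅ ρ₁) (v : σ ≅ σ₁) :
    swapHom ρ σ = (u.hom ⊗ₘ v.hom) ≫ swapHom ρ₁ σ₁ ≫ (v.inv ⊗ₘ u.inv) := by
  rw [← Category.assoc, swapHom_natural, Category.assoc, tensorHom_comp_tensorHom]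
  simp

/-- By naturality both factors can be conjugated by unitaries onto spacelike localized objects,
where the arrows are mutually inverse relabellings. The adjoint and the hexagon are treated in the
same way. -/
theorem swapHom_swapHom (ρ σ : N.Obj) : swapHom ρ σ ≫ swapHom σ ρ = 𝟙 (ρ ⊗ σ) := by
  obtain ⟨o, a, hoa⟩ := exists_perp
  obtain ⟨ρ₁, u, hρ₁, hu⟩ := exists_iso_localized ρ o
  obtain ⟨σ₁, v, hσ₁, hv⟩ := exists_iso_localized σ a
  have h : swapHom ρ₁ σ₁ ≫ swapHom σ₁ ρ₁ = 𝟙 (ρ₁ ⊗ σ₁) := by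
    rw [swapHom_localized hoa hρ₁ hσ₁, swapHom_localized hoa.symm hσ₁ hρ₁]
    exact Bimodule.relabel_inv _ (tensor_swap hoa hρ₁ hσ₁) (tensor_swap hoa.symm hσ₁ hρ₁)
  rw [swapHom_eq_conj u v, swapHom_eq_conj v u]
  simp only [Category.assoc, tensorHom_comp_tensorHom_assoc, Iso.inv_hom_id,
    tensorHom_id, id_whiskerRight, Category.id_comp]
  rw [reassoc_of% h, tensorHom_comp_tensorHom, Iso.hom_inv_id, Iso.hom_inv_id]
  exact id_tensorHom_id _ _

theorem dag_swapHom (ρ σ : N.Obj) : dag (swapHom ρ σ) = swapHom σ ρ := by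
  obtain ⟨o, a, hoa⟩ := exists_perp
  obtain ⟨ρ₁, u, hρ₁, hu⟩ := exists_iso_localized ρ o
  obtain ⟨σ₁, v, hσ₁, hv⟩ := exists_iso_localized σ a
  have h : dag (swapHom ρ₁ σ₁) = swapHom σ₁ ρ₁ := by
    rw [swapHom_localized hoa hρ₁ hσ₁, swapHom_localized hoa.symm hσ₁ hρ₁]
    exact Bimodule.adj_relabel _ (tensor_swap hoa hρ₁ hσ₁) (tensor_swap hoa.symm hσ₁ hρ₁)
  rw [swapHom_eq_conj u v, swapHom_eq_conj v u]
  rw [dag_comp, dag_comp, dag_tensorHom, dag_tensorHom, h, hu, hv, ← hu, ← hv, dag_dag, dag_dag,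
    Category.assoc]

theorem swapHom_hexagon (ρ σ τ : N.Obj) :
    (α_ ρ σ τ).hom ≫ swapHom ρ (σ ⊗ τ) ≫ (α_ σ τ ρ).hom =
      swapHom ρ σ ▷ τ ≫ (α_ σ ρ τ).hom ≫ σ ◁ swapHom ρ τ := by
  obtain ⟨o, a, hoa⟩ := exists_perp
  obtain ⟨ρ₁, u, hρ₁, hu⟩ := exists_iso_localized ρ o
  obtain ⟨σ₁, v, hσ₁, hv⟩ := exists_iso_localized σ a
  obtain ⟨τ₁, w, hτ₁, hw⟩ := exists_iso_localized τ a
  have h : (α_ ρ₁ σ₁ τ₁).hom ≫ swapHom ρ₁ (σ₁ ⊗ τ₁) ≫ (α_ σ₁ τ₁ ρ₁).hom =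
      swapHom ρ₁ σ₁ ▷ τ₁ ≫ (α_ σ₁ ρ₁ τ₁).hom ≫ σ₁ ◁ swapHom ρ₁ τ₁ := by
    -- Both σ₁ and τ₁ sit in the same cone a, so their product is localized there too and all three
    -- symmetries are flips.
    have hστ : IsLocalizedIn (toMor (σ₁ ⊗ τ₁ : N.Obj).toBimodule) a := tensor_localized hσ₁ hτ₁
    rw [swapHom_localized hoa hρ₁ hσ₁, swapHom_localized hoa hρ₁ hτ₁,
      swapHom_localized hoa hρ₁ hστ]
    exact Bimodule.hexagon_relabel _ _ _
  have e2 : (u.hom ⊗ₘ (v.hom ⊗ₘ w.hom)) ≫ swapHom ρ₁ (σ₁ ⊗ τ₁) =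
      swapHom ρ (σ ⊗ τ) ≫ ((v.hom ⊗ₘ w.hom) ⊗ₘ u.hom) := swapHom_natural _ _
  have e3 := associator_naturality u.hom v.hom w.hom
  have e4 := associator_naturality v.hom w.hom u.hom
  have e5 := associator_naturality v.hom u.hom w.hom
  rw [← cancel_mono (v.hom ⊗ₘ (w.hom ⊗ₘ u.hom))]
  simp only [Category.assoc]
  rw [← e4, ← reassoc_of% e2, ← reassoc_of% e3, h]
  have e6 : (v.hom ⊗ₘ (u.hom ⊗ₘ w.hom)) ≫ σ₁ ◁ swapHom ρ₁ τ₁ =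
      σ ◁ swapHom ρ τ ≫ (v.hom ⊗ₘ (w.hom ⊗ₘ u.hom)) := by
    rw [← id_tensorHom, ← id_tensorHom, tensorHom_comp_tensorHom, tensorHom_comp_tensorHom,
      swapHom_natural, Category.comp_id, Category.id_comp]
  have e7 : ((u.hom ⊗ₘ v.hom) ⊗ₘ w.hom) ≫ swapHom ρ₁ σ₁ ▷ τ₁ =
      swapHom ρ σ ▷ τ ≫ ((v.hom ⊗ₘ u.hom) ⊗ₘ w.hom) := by
    rw [← tensorHom_id, ← tensorHom_id, tensorHom_comp_tensorHom, tensorHom_comp_tensorHom,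
      swapHom_natural, Category.comp_id, Category.id_comp]
  rw [reassoc_of% e7, reassoc_of% e5, e6]

/-- The braiding given by the symmetry. -/
def swapIso (ρ σ : N.Obj) : ρ ⊗ σ ≅ σ ⊗ ρ where
  hom := swapHom ρ σ
  inv := swapHom σ ρ
  hom_inv_id := swapHom_swapHom ρ σ
  inv_hom_id := swapHom_swapHom σ ρ

/-- Adjoint of the first hexagon, with the three objects cyclically permuted. -/
theorem swapHom_hexagon_reverse (ρ σ τ : N.Obj) :
    (α_ ρ σ τ).inv ≫ swapHom (ρ ⊗ σ) τ ≫ (α_ τ ρ σ).inv =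
      ρ ◁ swapHom σ τ ≫ (α_ ρ τ σ).inv ≫ swapHom ρ τ ▷ σ := by
  have h := congrArg dag (swapHom_hexagon τ ρ σ)
  simpa only [dag_comp, dag_associator_hom, dag_swapHom, dag_whiskerLeft, dag_whiskerRight,
    Category.assoc] using h

instance : SymmetricCategory N.Obj where
  braiding := swapIso
  braiding_naturality_right ρ _ _ T := by
    have h := swapHom_natural (𝟙 ρ) T
    rwa [id_tensorHom, tensorHom_id] at h
  braiding_naturality_left T ρ := by
    have h := swapHom_natural T (𝟙 ρ)
    rwa [id_tensorHom, tensorHom_id] at h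
  hexagon_forward := swapHom_hexagon
  hexagon_reverse := swapHom_hexagon_reverse
  symmetry := swapHom_swapHom

theorem dag_braiding (ρ σ : N.Obj) : dag (β_ ρ σ).hom = (β_ σ ρ).hom := dag_swapHom ρ σ

end LocalNet
end

/-! ### Coxeter presentation of the permutation group -/

namespace Equiv.Perm

/-- The permutation of `n + 1` elements that fixes `0` and permutes the others by `e`. -/
def shift {n : ℕ} (e : Equiv.Perm (Fin n)) : Equiv.Perm (Fin (n + 1)) :=
  decomposeFin.symm (0, e)

@[simp]
theorem shift_zero {n : ℕ} (e : Equiv.Perm (Fin n)) : shift e 0 = 0 := by simp [shift]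

@[simp]
theorem shift_succ {n : ℕ} (e : Equiv.Perm (Fin n)) (x : Fin n) :
    shift e x.succ = (e x).succ := by simp [shift]

@[simp]
theorem shift_one {n : ℕ} : shift (1 : Equiv.Perm (Fin n)) = 1 := by
  ext x; refine Fin.cases ?_ (fun x => ?_) x <;> simp

theorem shift_mul {n : ℕ} (e f : Equiv.Perm (Fin n)) : shift (e * f) = shift e * shift f := by
  ext x; refine Fin.cases ?_ (fun x => ?_) x <;> simp

theorem shift_swap {n : ℕ} (i j : Fin n) : shift (swap i j) = swap i.succ j.succ := by
  ext x
  refine Fin.cases ?_ (fun x => ?_) x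
  · rw [shift_zero, swap_apply_of_ne_of_ne (Fin.succ_ne_zero _).symm (Fin.succ_ne_zero _).symm]
  · rw [shift_succ, (Fin.succ_injective n).swap_apply]

theorem decomposeFin_symm_eq {n : ℕ} (k : Fin (n + 1)) (e : Equiv.Perm (Fin n)) :
    decomposeFin.symm (k, e) = swap 0 k * shift e := by
  ext x; refine Fin.cases ?_ (fun x => ?_) x <;> simp

theorem exists_eq_shift {n : ℕ} {g : Equiv.Perm (Fin (n + 1))} (hg : g 0 = 0) :
    ∃ h, g = shift h := by
  obtain ⟨⟨k, h⟩, rfl⟩ := decomposeFin.symm.surjective g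
  rw [decomposeFin_symm_apply_zero] at hg
  exact ⟨h, by rw [hg]; rfl⟩

theorem swap_zero_succ {n : ℕ} (j : Fin (n + 1)) :
    swap (0 : Fin (n + 2)) j.succ = shift (swap 0 j) * swap 0 1 * shift (swap 0 j) := by
  rw [mul_swap_eq_swap_mul, shift_zero, ← Fin.succ_zero_eq_one, shift_succ, swap_apply_left,
    mul_assoc, ← shift_mul, swap_mul_self, shift_one, mul_one]

section Presentation

variable {M : Type*} [Monoid M]

/-- The Coxeter relations of type `A_n` for the elements `s 0, …, s (n - 1)` of a monoid. -/
structure CoxeterRelations (s : ℕ → M) (n : ℕ) : Prop where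
  sq : ∀ i < n, s i * s i = 1
  braid : ∀ i, i + 1 < n → s i * s (i + 1) * s i = s (i + 1) * s i * s (i + 1)
  comm : ∀ i j, i + 1 < j → j < n → Commute (s i) (s j)

theorem CoxeterRelations.succ {s : ℕ → M} {n : ℕ} (h : CoxeterRelations s (n + 1)) :
    CoxeterRelations (fun i => s (i + 1)) n where
  sq i hi := h.sq _ (by omega)
  braid i hi := h.braid _ (by omega)
  comm i j hi hj := h.comm _ _ (by omega) (by omega)

/-- The representation of the permutation group with given images of the transpositions of
neighbours. -/
def rep : ∀ n : ℕ, (ℕ → M) → Equiv.Perm (Fin (n + 1)) → M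
  | 0, _, _ => 1
  | n + 1, s, p =>
    Fin.cases (rep n (fun i => s (i + 1)) (decomposeFin p).2)
      (fun j => rep n (fun i => s (i + 1)) (swap 0 j) * s 0 *
        rep n (fun i => s (i + 1)) (swap 0 j) *
        rep n (fun i => s (i + 1)) (decomposeFin p).2) (decomposeFin p).1

theorem rep_shift (n : ℕ) (s : ℕ → M) (e : Equiv.Perm (Fin (n + 1))) :
    rep (n + 1) s (shift e) = rep n (fun i => s (i + 1)) e := by
  simp [rep, shift]

theorem rep_swap_mul_shift (n : ℕ) (s : ℕ → M) (j : Fin (n + 1)) (e : Equiv.Perm (Fin (n + 1))) :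
    rep (n + 1) s (swap 0 j.succ * shift e) = rep n (fun i => s (i + 1)) (swap 0 j) * s 0 *
        rep n (fun i => s (i + 1)) (swap 0 j) * rep n (fun i => s (i + 1)) e := by
  rw [← decomposeFin_symm_eq]
  simp [rep]

theorem commute_rep {x : M} : ∀ (n : ℕ) (s : ℕ → M), (∀ i < n, Commute x (s i)) →
    ∀ p, Commute x (rep n s p)
  | 0, _, _, _ => Commute.one_right x
  | n + 1, s, h, p => by
    have ih := commute_rep n (fun i => s (i + 1)) fun i hi => h _ (by omega)
    obtain ⟨⟨k, e⟩, rfl⟩ := decomposeFin.symm.surjective p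
    rw [decomposeFin_symm_eq]
    refine Fin.cases ?_ (fun j => ?_) k
    · rw [swap_self, ← one_def, one_mul, rep_shift]
      exact ih e
    · rw [rep_swap_mul_shift]
      exact (((ih _).mul_right (h 0 (by omega))).mul_right (ih _)).mul_right (ih e)

theorem rep_one : ∀ (n : ℕ) (s : ℕ → M), rep n s 1 = 1
  | 0, _ => rfl
  | n + 1, s => by rw [← shift_one, rep_shift, rep_one]

/-- Every permutation is uniquely `swap 0 k * shift e`, and `rep` is defined on this normal form.
The shifts and `swap 0 1` generate the group, so it suffices that left multiplication by either is
respected (`hshift` and `hs0`). -/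
theorem rep_mul : ∀ {n : ℕ} {s : ℕ → M}, CoxeterRelations s n → ∀ p q,
    rep n s (p * q) = rep n s p * rep n s q
  | 0, _, _, _, _ => (mul_one 1).symm
  | n + 1, s, h, p, q => by
    have ih := rep_mul h.succ
    set R := rep n fun i => s (i + 1)
    have hR1 : R 1 = 1 := rep_one _ _
    -- Such a g, shifted once more, fixes the first two elements, so its image involves only s 2, s
    -- 3, and so on, which commute with s 0.
    have hcomm : ∀ g : Equiv.Perm (Fin (n + 1)), g 0 = 0 → s 0 * R g = R g * s 0 := by
      intro g hg
      obtain ⟨e, rfl⟩ := exists_eq_shift hg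
      cases n with
      | zero => exact (mul_one _).trans (one_mul _).symm
      | succ m =>
        simp only [R]
        rw [rep_shift]
        exact commute_rep m _ (fun i hi => h.comm _ _ (by omega) (by omega)) e
    have hsw : ∀ j, R (swap 0 j) * R (swap 0 j) = 1 := fun j => by
      rw [← ih, swap_mul_self, hR1]
    have hshift : ∀ e p, rep (n + 1) s (shift e * p) = R e * rep (n + 1) s p := by
      intro e p
      obtain ⟨⟨k, f⟩, rfl⟩ := decomposeFin.symm.surjective p
      rw [decomposeFin_symm_eq]
      refine Fin.cases ?_ (fun j => ?_) k
      · rw [swap_self, ← one_def, one_mul, ← shift_mul, rep_shift, rep_shift]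
        exact ih e f
      · rw [← mul_assoc, mul_swap_eq_swap_mul, shift_zero, shift_succ, mul_assoc, ← shift_mul,
          rep_swap_mul_shift, rep_swap_mul_shift, ← mul_assoc, ← mul_assoc, ← mul_assoc]
        change R (swap 0 (e j)) * s 0 * R (swap 0 (e j)) * R (e * f) =
          R e * R (swap 0 j) * s 0 * R (swap 0 j) * R f
        rw [ih, ← mul_assoc]
        congr 1
        -- This product fixes 0. Commuting its image past s 0 is what turns conjugation by `swap 0
        -- j` into conjugation by `swap 0 (e j)`.
        have h1 := hcomm (swap 0 (e j) * e * swap 0 j) (by simp)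
        rw [ih, ih] at h1
        calc _ = R (swap 0 (e j)) * (s 0 * (R (swap 0 (e j)) * R e * R (swap 0 j))) *
              R (swap 0 j) := by simp only [mul_assoc, hsw, mul_one]
          _ = R (swap 0 (e j)) * R (swap 0 (e j)) * (R e * R (swap 0 j) * s 0 * R (swap 0 j)) := by
            rw [h1]; simp only [mul_assoc]
          _ = _ := by rw [hsw, one_mul]
    have hs0 : ∀ p, rep (n + 1) s (swap 0 1 * p) = s 0 * rep (n + 1) s p := by
      intro p
      have hs : s 0 * s 0 = 1 := h.sq 0 (by omega)
      obtain ⟨⟨k, f⟩, rfl⟩ := decomposeFin.symm.surjective p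
      rw [decomposeFin_symm_eq]
      refine Fin.cases ?_ (fun j => ?_) k
      · rw [swap_self, ← one_def, one_mul, ← Fin.succ_zero_eq_one, rep_swap_mul_shift, rep_shift]
        change R (swap 0 0) * s 0 * R (swap 0 0) * R f = s 0 * R f
        rw [swap_self, ← one_def, hR1, one_mul, mul_one]
      · by_cases hj : j = 0
        · subst hj
          rw [Fin.succ_zero_eq_one, ← mul_assoc, swap_mul_self, one_mul, rep_shift,
            ← Fin.succ_zero_eq_one, rep_swap_mul_shift]
          change R f = s 0 * (R (swap 0 0) * s 0 * R (swap 0 0) * R f)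
          rw [swap_self, ← one_def, hR1, one_mul, mul_one, ← mul_assoc, hs, one_mul]
        · have e1 : swap (0 : Fin (n + 2)) 1 * (swap 0 j.succ * shift f) =
              swap 0 j.succ * shift (swap 0 j * f) := by
            have hj' : (1 : Fin (n + 2)) ≠ j.succ := fun hc =>
              hj (Fin.succ_injective _ (hc.symm.trans Fin.succ_zero_eq_one.symm))
            rw [shift_mul, shift_swap, Fin.succ_zero_eq_one, ← mul_assoc, ← mul_assoc,
              mul_swap_eq_swap_mul (swap 0 j.succ) 1 j.succ, swap_apply_right,
              swap_apply_of_ne_of_ne Fin.zero_ne_one.symm hj', swap_comm 1 0]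
          rw [e1, rep_swap_mul_shift, rep_swap_mul_shift]
          change R (swap 0 j) * s 0 * R (swap 0 j) * R (swap 0 j * f) =
            s 0 * (R (swap 0 j) * s 0 * R (swap 0 j) * R f)
          rw [ih]
          -- The braid relation for s 0 and an arbitrary transposition of the second element with a
          -- later one: the latter is s 1 conjugated by an involution x that commutes with s 0,
          -- which reduces it to the relation for s 0 and s 1.
          have hbr : s 0 * R (swap 0 j) * s 0 = R (swap 0 j) * s 0 * R (swap 0 j) := by
            cases n with
            | zero => exact absurd (Fin.fin_one_eq_zero j) hj
            | succ m =>
              obtain ⟨i, rfl⟩ := Fin.exists_succ_eq_of_ne_zero hj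
              have hR : R (swap 0 i.succ) = R (shift (swap 0 i)) * s 1 * R (shift (swap 0 i)) := by
                have := rep_swap_mul_shift m (fun i => s (i + 1)) i 1
                rw [shift_one, mul_one, rep_one, mul_one] at this
                simp only [R, rep_shift]
                exact this
              have hc := hcomm (shift (swap 0 i)) (shift_zero _)
              have hsq : R (shift (swap 0 i)) * R (shift (swap 0 i)) = 1 := by
                rw [← ih, ← shift_mul, swap_mul_self, shift_one, hR1]
              have hb : s 0 * s 1 * s 0 = s 1 * s 0 * s 1 := h.braid 0 (by omega)
              rw [hR]
              generalize R (shift (swap 0 i)) = x at hc hsq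
              calc _ = s 0 * x * s 1 * (x * s 0) := by simp only [mul_assoc]
                _ = x * s 0 * s 1 * (s 0 * x) := congrArg₂ (fun a b => a * s 1 * b) hc hc.symm
                _ = x * (s 0 * s 1 * s 0) * x := by simp only [mul_assoc]
                _ = x * s 1 * (x * x) * s 0 * s 1 * x := by
                    rw [hb, hsq]; simp only [mul_assoc, mul_one]
                _ = x * s 1 * x * (s 0 * x) * s 1 * x := by rw [hc]; simp only [mul_assoc]
                _ = _ := by simp only [mul_assoc]
          calc _ = R (swap 0 j) * s 0 * (R (swap 0 j) * R (swap 0 j)) * R f := by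
                simp only [mul_assoc]
            _ = s 0 * s 0 * R (swap 0 j) * s 0 * R f := by rw [hsw, hs, mul_one, one_mul]
            _ = s 0 * (s 0 * R (swap 0 j) * s 0) * R f := by simp only [mul_assoc]
            _ = _ := by rw [hbr]; simp only [mul_assoc]
    obtain ⟨⟨k, e⟩, rfl⟩ := decomposeFin.symm.surjective p
    rw [decomposeFin_symm_eq]
    refine Fin.cases ?_ (fun j => ?_) k
    · rw [swap_self, ← one_def, one_mul, hshift, rep_shift]
    · rw [rep_swap_mul_shift, swap_zero_succ]
      simp only [mul_assoc, hshift, hs0]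
      rfl

theorem rep_swap : ∀ (n : ℕ) (s : ℕ → M) (i : ℕ) (hi : i < n),
    rep n s (swap ⟨i, by omega⟩ ⟨i + 1, by omega⟩) = s i
  | n + 1, s, 0, _ => by
    have := rep_swap_mul_shift n s 0 1
    rw [shift_one, mul_one, swap_self, ← one_def, rep_one, one_mul, mul_one, mul_one] at this
    exact this
  | n + 1, s, i + 1, hi => by
    have := rep_shift n s (swap ⟨i, by omega⟩ ⟨i + 1, by omega⟩)
    rw [shift_swap, rep_swap n _ i (by omega)] at this
    exact this

end Presentation

end Equiv.Perm

/-! ### Extension of states and dilation by the GNS construction -/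

section

open scoped ComplexOrder InnerProductSpace

theorem CStarAlgebra.norm_one_le (B : Type*) [CStarAlgebra B] : ‖(1 : B)‖ ≤ 1 := by
  rcases subsingleton_or_nontrivial B with h | h
  · rw [Subsingleton.elim (1 : B) 0, norm_zero]
    exact zero_le_one
  · exact CStarRing.norm_one.le

section PositiveFunctional

variable {B : Type*} [CStarAlgebra B]

/-- Adding i t to x raises the square of the norm by at most t², while |g|² grows by 2 b t + t² with
b the imaginary part. A nonzero b is contradicted by a t of large modulus and the right sign. -/
theorem im_eq_zero_of_norm_le {g : B →ₗ[ℂ] ℂ} (hg : ∀ x, ‖g x‖ ≤ ‖x‖) (h1 : g 1 = 1)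
    {x : B} (hx : IsSelfAdjoint x) : (g x).im = 0 := by
  by_contra hb
  set b := (g x).im
  have key : ∀ t : ℝ, b ^ 2 + 2 * b * t ≤ ‖x‖ ^ 2 := by
    intro t
    let y := x + (Complex.I * t) • (1 : B)
    have h2 : ‖y‖ ^ 2 ≤ ‖x‖ ^ 2 + t ^ 2 := by
      rw [sq, ← CStarRing.norm_star_mul_self]
      have e : star y * y = x * x + ((t ^ 2 : ℝ) : ℂ) • (1 : B) := by
        simp only [y, star_add, star_smul, star_one, hx.star_eq, RCLike.star_def, map_mul,
          Complex.conj_I, Complex.conj_ofReal, add_mul, mul_add, smul_mul_assoc, mul_smul_comm,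
          one_mul, mul_one]
        have : Complex.I * t * (-Complex.I * t) = ((t ^ 2 : ℝ) : ℂ) := by
          push_cast; linear_combination (-(t : ℂ) ^ 2) * Complex.I_mul_I
        rw [← this, smul_add, smul_smul, neg_mul, neg_smul]
        abel
      rw [e]
      refine (norm_add_le _ _).trans (add_le_add ?_ ?_)
      · rw [sq]; exact norm_mul_le _ _
      · rw [norm_smul, Complex.norm_real, Real.norm_of_nonneg (sq_nonneg t)]
        exact mul_le_of_le_one_right (sq_nonneg t) (CStarAlgebra.norm_one_le _)
    have h3 := pow_le_pow_left₀ (norm_nonneg _) (hg y) 2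
    rw [← Complex.normSq_eq_norm_sq, map_add, map_smul, h1, Complex.normSq_apply] at h3
    simp at h3
    nlinarith [sq_nonneg (g x).re]
  have := key ((‖x‖ ^ 2 + 1) / (2 * b))
  rw [mul_div_cancel₀ _ (by simpa using hb)] at this
  nlinarith [sq_nonneg b]

/-- For positive x the element ‖x‖ - x has norm at most ‖x‖, so the real number g(x) differs from
‖x‖ by at most ‖x‖. -/
theorem nonneg_of_norm_le [PartialOrder B] [StarOrderedRing B] {g : B →ₗ[ℂ] ℂ} (hg : ∀ x, ‖g x‖ ≤ ‖x‖) (h1 : g 1 = 1)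
    {x : B} (hx : 0 ≤ x) : 0 ≤ g x := by
  refine Complex.nonneg_iff.2 ⟨?_, (im_eq_zero_of_norm_le hg h1 hx.isSelfAdjoint).symm⟩
  have h2 : ‖algebraMap ℝ B ‖x‖ - x‖ ≤ ‖x‖ :=
    (CStarAlgebra.norm_le_iff_le_algebraMap _ (norm_nonneg x)
      (sub_nonneg.2 hx.isSelfAdjoint.le_algebraMap_norm_self)).2 (sub_le_self _ hx)
  have h3 := (Complex.abs_re_le_norm _).trans ((hg _).trans h2)
  have e : algebraMap ℝ B ‖x‖ = (‖x‖ : ℂ) • (1 : B) := by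
    rw [Algebra.algebraMap_eq_smul_one]; rfl
  rw [map_sub, e, map_smul, h1] at h3
  simp at h3
  linarith [(abs_le.1 h3).2]

end PositiveFunctional

/-- A vector state of an algebra of operators extends along every injective morphism of
C*-algebras. The extension gives a dilation of the algebra of operators. -/
theorem exists_dilation {𝔄 B H : Type*} [Ring 𝔄] [StarRing 𝔄] [Algebra ℂ 𝔄]
    [CStarAlgebra B] [PartialOrder B]
    [StarOrderedRing B] [NormedAddCommGroup H] [InnerProductSpace ℂ H] [CompleteSpace H]
    (φ : 𝔄 →⋆ₙₐ[ℂ] B) (hφ : Function.Injective φ) (r : 𝔄 →⋆ₐ[ℂ] (H →L[ℂ] H))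
    (hr : ∀ a, ‖r a‖ ≤ ‖φ a‖) (ξ : H)
    (hξ : ‖ξ‖ = 1) (hd : DenseRange fun a => r a ξ) :
    ∃ (f : B →ₚ[ℂ] ℂ) (V : H →L[ℂ] f.GNS),
      (∀ a x, f.gnsStarAlgHom (φ a) (V x) = V (r a x)) ∧ ∀ x, ‖V x‖ = ‖x‖ := by
  let e := LinearEquiv.ofInjective (φ : 𝔄 →ₗ[ℂ] B) hφ
  let p := LinearMap.range (φ : 𝔄 →ₗ[ℂ] B)
  let ω : 𝔄 →ₗ[ℂ] ℂ :=
    { toFun := fun a => ⟪ξ, r a ξ⟫_ℂ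
      map_add' := fun a b => by simp
      map_smul' := fun c a => by simp }
  have hω : ∀ a, ‖ω a‖ ≤ ‖φ a‖ := fun a => by
    refine (norm_inner_le_norm _ _).trans ?_
    rw [hξ, one_mul]
    refine ((r a).le_opNorm ξ).trans ?_
    rw [hξ, mul_one]
    exact hr a
  -- Injectivity of φ carries the vector state to the range of φ, where `hr` makes it a contraction.
  let f₀ : StrongDual ℂ p := (ω ∘ₗ e.symm.toLinearMap).mkContinuous 1 fun x => by
    obtain ⟨a, rfl⟩ := e.surjective x
    rw [LinearMap.comp_apply, LinearEquiv.coe_coe, e.symm_apply_apply, one_mul]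
    exact hω a
  have hf₀ : ∀ a, f₀ (e a) = ω a := fun a => by
    show ω (e.symm (e a)) = _
    rw [e.symm_apply_apply]
  obtain ⟨g₀, hg₀, hg₀n⟩ := exists_extension_norm_eq p f₀
  have hg₀' : ∀ a, g₀ (φ a) = ω a := fun a => (hg₀ (e a)).trans (hf₀ a)
  have hg₀1 : ‖g₀‖ ≤ 1 := hg₀n.trans_le (LinearMap.mkContinuous_norm_le _ zero_le_one _)
  -- Since φ need not be unital, the Hahn-Banach extension is compressed by the projection φ(1).
  -- This leaves its values on the range unchanged and gives the unit of B the value 1, so that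
  -- contractivity yields positivity.
  let g : B →ₗ[ℂ] ℂ :=
    { toFun := fun x => g₀ (φ 1 * x * φ 1)
      map_add' := fun x y => by rw [mul_add, add_mul, map_add]
      map_smul' := fun c x => by simp }
  have hgφ : ∀ a, g (φ a) = ω a := fun a => by
    show g₀ (φ 1 * φ a * φ 1) = _
    rw [← map_mul, ← map_mul, one_mul, mul_one, hg₀']
  have hg1 : g 1 = 1 := by
    show g₀ (φ 1 * 1 * φ 1) = 1
    rw [mul_one, ← map_mul, one_mul, hg₀']
    show ⟪ξ, r 1 ξ⟫_ℂ = 1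
    rw [map_one, one_apply_eq_self, inner_self_eq_norm_sq_to_K, hξ]
    simp
  have hφ1 : ‖φ 1‖ ≤ 1 := by
    have h1 : ‖φ 1‖ = ‖φ 1‖ * ‖φ 1‖ := by
      rw [← CStarRing.norm_star_mul_self, ← map_star, ← map_mul, star_one, one_mul]
    by_contra hc
    nlinarith [norm_nonneg (φ 1)]
  have hgn : ∀ x, ‖g x‖ ≤ ‖x‖ := fun x => by
    refine (g₀.le_opNorm _).trans ?_
    calc _ ≤ 1 * (‖φ 1‖ * ‖x‖ * ‖φ 1‖) := by
          gcongr
          exact (norm_mul_le _ _).trans (by gcongr; exact norm_mul_le _ _)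
      _ ≤ 1 * (1 * ‖x‖ * 1) := by gcongr
      _ = ‖x‖ := by ring
  let f : B →ₚ[ℂ] ℂ := PositiveLinearMap.mk₀ g fun x hx => nonneg_of_norm_le hgn hg1 hx
  have hf : ∀ a, f (φ a) = ω a := hgφ
  let S : 𝔄 →ₗ[ℂ] f.GNS :=
    { toFun := fun a => ((f.toPreGNS (φ a) : f.PreGNS) : f.GNS)
      map_add' := fun a b => by rw [map_add, map_add, UniformSpace.Completion.coe_add]
      map_smul' := fun c a => by rw [map_smul, map_smul, UniformSpace.Completion.coe_smul]; rfl }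
  let T : 𝔄 →ₗ[ℂ] H :=
    { toFun := fun a => r a ξ
      map_add' := fun a b => by simp
      map_smul' := fun c a => by simp }
  -- Both squared norms are the value of the state at a*a, so r(a)ξ ↦ [φ(a)] is isometric on a dense
  -- subspace.
  have hST : ∀ a, ‖S a‖ = ‖T a‖ := fun a => by
    have h1 : ((‖S a‖ ^ 2 : ℝ) : ℂ) = ((‖T a‖ ^ 2 : ℝ) : ℂ) := by
      push_cast
      have h2 : ‖S a‖ = ‖f.toPreGNS (φ a)‖ := UniformSpace.Completion.norm_coe _
      rw [h2, PositiveLinearMap.preGNS_norm_sq, PositiveLinearMap.ofPreGNS_toPreGNS, ← map_star,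
        ← map_mul, hf]
      show ⟪ξ, r (star a * a) ξ⟫_ℂ = (‖r a ξ‖ : ℂ) ^ 2
      rw [map_mul, map_star, ContinuousLinearMap.star_eq_adjoint, mul_apply_eq_comp,
        ContinuousLinearMap.adjoint_inner_right, inner_self_eq_norm_sq_to_K]
      rfl
    have h3 : ‖S a‖ ^ 2 = ‖T a‖ ^ 2 := by exact_mod_cast h1
    exact (pow_left_inj₀ (norm_nonneg _) (norm_nonneg _) two_ne_zero).1 h3
  have hC : ∃ C : ℝ, ∀ a, ‖S a‖ ≤ C * ‖T a‖ := ⟨1, fun a => by rw [one_mul, hST]⟩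
  let V : H →L[ℂ] f.GNS := S.extendOfNorm T
  have hV : ∀ a, V (r a ξ) = S a := fun a => LinearMap.extendOfNorm_eq hd hC a
  refine ⟨f, V, fun a x => ?_, fun x => ?_⟩
  · refine hd.induction_on (p := fun x => f.gnsStarAlgHom (φ a) (V x) = V (r a x)) x
      (isClosed_eq (by fun_prop) (by fun_prop)) fun b => ?_
    rw [hV, ← mul_apply_eq_comp, ← map_mul, hV]
    show f.gnsNonUnitalStarAlgHom (φ a) ((f.toPreGNS (φ b) : f.PreGNS) : f.GNS) =
      ((f.toPreGNS (φ (a * b)) : f.PreGNS) : f.GNS)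
    rw [PositiveLinearMap.gnsNonUnitalStarAlgHom_apply_coe, map_mul]
    rfl
  · refine hd.induction_on (p := fun x => ‖V x‖ = ‖x‖) x
      (isClosed_eq (by fun_prop) (by fun_prop)) fun b => ?_
    rw [hV, hST]
    rfl

end

/-! ### Operator matrices and intertwining square roots -/

noncomputable section

/-- The self-adjoint element r - r e has square zero. This keeps the square root of an element
supported by a projection supported by it as well. -/
theorem mul_eq_self_of_sq_mul_eq_self {B : Type*} [CStarAlgebra B] {r e : B} (hr : star r = r)
    (he : star e = e) (hc : r * e = e * r) (h : r * r * e = r * r) :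
    r * e = r := by
  have h1 : r * e * r = r * r := by rw [mul_assoc, ← hc, ← mul_assoc, h]
  have h2 : r * e * (r * e) = r * r := by rw [← mul_assoc, h1, h]
  have h3 : star (r - r * e) = r - r * e := by rw [star_sub, star_mul, hr, he, hc]
  have h4 : r - r * e = 0 := by
    rw [← CStarRing.star_mul_self_eq_zero_iff, h3, sub_mul, mul_sub, mul_sub, h1, h2,
      ← mul_assoc, h]
    abel
  exact (sub_eq_zero.1 h4).symm

namespace OperatorMatrix

variable {H : Type*} [NormedAddCommGroup H] [InnerProductSpace ℂ H] [CompleteSpace H]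
variable (κ : Type) [Fintype κ]

/-- The coordinate projections of the direct sum of copies of `H` labelled by `κ`. -/
abbrev coord (i : κ) : PiLp 2 (fun _ : κ => H) →L[ℂ] H := PiLp.proj 2 (fun _ : κ => H) i

variable {κ}

theorem sum_adjoint_coord_comp : ∑ i, (coord (H := H) κ i).adjoint ∘L coord κ i = 1 := by
  refine ContinuousLinearMap.ext fun x => ext_inner_left ℂ fun y => ?_
  simp only [sum_apply, inner_sum, ContinuousLinearMap.comp_apply,
    ContinuousLinearMap.adjoint_inner_right, one_apply_eq_self, PiLp.inner_apply]
  rfl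

theorem adjoint_coord_apply [DecidableEq κ] (j : κ) (b : H) :
    (coord (H := H) κ j).adjoint b = WithLp.toLp 2 (Pi.single j b) := by
  refine ext_inner_left ℂ fun y => ?_
  rw [ContinuousLinearMap.adjoint_inner_right, PiLp.inner_apply]
  rw [Finset.sum_eq_single j]
  · simp
  · intro i _ hij
    simp [Pi.single_eq_of_ne hij]
  · simp

/-- The operator on the direct sum given by a matrix of operators. -/
def toOperator (M : Matrix κ κ (H →L[ℂ] H)) :
    PiLp 2 (fun _ : κ => H) →L[ℂ] PiLp 2 (fun _ : κ => H) :=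
  ∑ i, ∑ j, (coord κ i).adjoint ∘L M i j ∘L coord κ j

/-- The matrix of an operator on the direct sum. -/
def ofOperator (R : PiLp 2 (fun _ : κ => H) →L[ℂ] PiLp 2 (fun _ : κ => H)) :
    Matrix κ κ (H →L[ℂ] H) :=
  Matrix.of fun i j => coord κ i ∘L R ∘L (coord κ j).adjoint

theorem ofOperator_mul (R S : PiLp 2 (fun _ : κ => H) →L[ℂ] PiLp 2 (fun _ : κ => H)) :
    ofOperator (R * S) = ofOperator R * ofOperator S := by
  ext1 i j
  rw [Matrix.mul_apply]
  have h : R * S = ∑ k, R ∘L ((coord κ k).adjoint ∘L coord κ k) ∘L S := by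
    refine ContinuousLinearMap.ext fun x => ?_
    have h1 := congrArg (fun T => R (T (S x))) (sum_adjoint_coord_comp (H := H) (κ := κ))
    simp only [sum_apply, map_sum] at h1
    simpa using h1.symm
  refine ContinuousLinearMap.ext fun x => ?_
  simp [ofOperator, h]

theorem conjTranspose_ofOperator
    (R : PiLp 2 (fun _ : κ => H) →L[ℂ] PiLp 2 (fun _ : κ => H)) :
    (ofOperator R)ᴴ = ofOperator R.adjoint := by
  ext1 i j
  simp [ofOperator, Matrix.conjTranspose_apply, ContinuousLinearMap.star_eq_adjoint,
    ContinuousLinearMap.adjoint_comp, ContinuousLinearMap.comp_assoc]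

theorem ofOperator_toOperator (M : Matrix κ κ (H →L[ℂ] H)) : ofOperator (toOperator M) = M := by
  classical
  ext i j x
  simp only [ofOperator, toOperator, Matrix.of_apply, ContinuousLinearMap.comp_apply,
    sum_apply, map_sum, adjoint_coord_apply]
  rw [Finset.sum_eq_single i, Finset.sum_eq_single j]
  · simp
  · intro b _ hb
    simp [hb]
  · simp
  · intro b _ hb
    simp [hb.symm]
  · simp

theorem toOperator_ofOperator (R : PiLp 2 (fun _ : κ => H) →L[ℂ] PiLp 2 (fun _ : κ => H)) :
    toOperator (ofOperator R) = R := by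
  refine ContinuousLinearMap.ext fun x => ?_
  have h1 := fun y => congrArg (fun T => T y) (sum_adjoint_coord_comp (H := H) (κ := κ))
  simp only [sum_apply, ContinuousLinearMap.comp_apply,
    one_apply_eq_self] at h1
  simp only [toOperator, ofOperator, Matrix.of_apply, sum_apply,
    ContinuousLinearMap.comp_apply]
  simp only [← map_sum, h1]

theorem toOperator_mul (M M' : Matrix κ κ (H →L[ℂ] H)) :
    toOperator (M * M') = toOperator M * toOperator M' := by
  rw [← toOperator_ofOperator (toOperator M * toOperator M'), ofOperator_mul,
    ofOperator_toOperator, ofOperator_toOperator]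

theorem star_toOperator (M : Matrix κ κ (H →L[ℂ] H)) :
    star (toOperator M) = toOperator Mᴴ := by
  rw [← toOperator_ofOperator (star (toOperator M)), ContinuousLinearMap.star_eq_adjoint,
    ← conjTranspose_ofOperator, ofOperator_toOperator]

/-- A positive matrix of operators has a square root that commutes with every morphism with
which the matrix commutes. -/
theorem exists_sqrt {A : Type*} [Ring A] [StarRing A] [Algebra ℂ A]
    (σ : A →⋆ₙₐ[ℂ] Matrix κ κ (H →L[ℂ] H)) {K : Type*} [NormedAddCommGroup K]
    [InnerProductSpace ℂ K] [CompleteSpace K] {l : Type*} [Fintype l] (W : l → κ → (H →L[ℂ] K))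
    (Z : Matrix κ κ (H →L[ℂ] H)) (hZ : ∀ i j, Z i j = ∑ k, (W k i).adjoint ∘L W k j)
    (hcomm : ∀ a, Z * σ a = σ a * Z) (hone : Z * σ 1 = Z) :
    ∃ Y : Matrix κ κ (H →L[ℂ] H), Yᴴ * Y = Z ∧ Y * σ 1 = Y ∧ ∀ a, Y * σ a = σ a * Y := by
  -- The dilation exhibits the operator of Z as a sum of terms Θ*Θ, with Θ mapping the direct sum to
  -- K; hence it is positive.
  have hTZ : toOperator Z = ∑ k, (∑ i, W k i ∘L coord κ i).adjoint ∘L ∑ j, W k j ∘L coord κ j := by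
    refine ContinuousLinearMap.ext fun x => ?_
    simp only [toOperator, hZ, map_sum, ContinuousLinearMap.adjoint_comp,
      sum_apply, ContinuousLinearMap.comp_apply]
    rw [Finset.sum_congr rfl fun i _ => Finset.sum_comm, Finset.sum_comm]
    exact Finset.sum_congr rfl fun _ _ => Finset.sum_comm
  have hpos : 0 ≤ toOperator Z := by
    rw [hTZ]
    refine Finset.sum_nonneg fun k _ => ?_
    rw [ContinuousLinearMap.nonneg_iff_isPositive]
    exact ContinuousLinearMap.isPositive_adjoint_comp_self _
  let R := CFC.sqrt (toOperator Z)
  have hRR : R * R = toOperator Z := CFC.sqrt_mul_sqrt_self _ hpos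
  have hRs : star R = R := (CFC.sqrt_nonneg (toOperator Z)).isSelfAdjoint
  have hRc : ∀ a, Commute R (toOperator (σ a)) := fun a => by
    -- The square root is a function of Z, so it commutes with whatever commutes with Z.
    refine Commute.cfcₙ_nnreal ?_ _
    show toOperator Z * toOperator (σ a) = toOperator (σ a) * toOperator Z
    rw [← toOperator_mul, hcomm, toOperator_mul]
  have hR1 : R * toOperator (σ 1) = R := by
    set e := toOperator (σ 1)
    have hes : star e = e := by
      rw [star_toOperator, ← Matrix.star_eq_conjTranspose, ← map_star, star_one]
    have hc : R * e = e * R := hRc 1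
    have hz : toOperator Z * e = toOperator Z := by rw [← toOperator_mul, hone]
    refine mul_eq_self_of_sq_mul_eq_self hRs hes hc ?_
    rw [hRR, hz]
  refine ⟨ofOperator R, ?_, ?_, fun a => ?_⟩
  · rw [conjTranspose_ofOperator, ← ContinuousLinearMap.star_eq_adjoint, hRs, ← ofOperator_mul,
      hRR, ofOperator_toOperator]
  · rw [← ofOperator_toOperator (σ 1), ← ofOperator_mul, hR1]
  · rw [← ofOperator_toOperator (σ a), ← ofOperator_mul, ← ofOperator_mul, (hRc a).eq]

end OperatorMatrix
end

/-! ### Slices: positive left inverses of faithful morphisms -/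

noncomputable section

open scoped InnerProductSpace

universe u

/-- The compression of a representation to an intertwined isometric image. -/
theorem exists_compression {𝔄 B H : Type*} {K : Type u} [Ring 𝔄] [StarRing 𝔄] [Algebra ℂ 𝔄]
    [Ring B] [StarRing B] [Algebra ℂ B] [NormedAddCommGroup H] [InnerProductSpace ℂ H]
    [CompleteSpace H] [NormedAddCommGroup K] [InnerProductSpace ℂ K] [CompleteSpace K]
    (φ : 𝔄 →⋆ₙₐ[ℂ] B) (r : 𝔄 →⋆ₐ[ℂ] (H →L[ℂ] H)) (P : B →⋆ₐ[ℂ] (K →L[ℂ] K)) (V : H →L[ℂ] K)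
    (hV : ∀ a x, P (φ a) (V x) = V (r a x)) (hVn : ∀ x, ‖V x‖ = ‖x‖) :
    ∃ Λ : B →ₗ[ℂ] (H →L[ℂ] H), (∀ x a, Λ (x * φ a) = Λ x * r a) ∧
      (∀ x a, Λ (φ a * x) = r a * Λ x) ∧ Λ (φ 1) = 1 ∧
      ∃ (K : Type u) (_ : NormedAddCommGroup K) (_ : InnerProductSpace ℂ K)
        (_ : CompleteSpace K) (W : B → (H →L[ℂ] K)),
        ∀ x y, Λ (star x * y) = (W x).adjoint ∘L W y := by
  have hV' : ∀ a, P (φ a) ∘L V = V ∘L r a := fun a => ContinuousLinearMap.ext (hV a)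
  -- The adjoint of the relation for a*. It supplies the left half of the bimodule property.
  have hV'' : ∀ a, V.adjoint ∘L P (φ a) = r a ∘L V.adjoint := fun a => by
    have h := congrArg ContinuousLinearMap.adjoint (hV' (star a))
    rw [ContinuousLinearMap.adjoint_comp, ContinuousLinearMap.adjoint_comp,
      ← ContinuousLinearMap.star_eq_adjoint (P _),
      ← ContinuousLinearMap.star_eq_adjoint (r _), map_star, map_star, map_star, star_star,
      star_star] at h
    exact h
  have hVV : V.adjoint ∘L V = 1 := V.norm_map_iff_adjoint_comp_self.1 hVn
  refine ⟨
    { toFun := fun x => V.adjoint ∘L P x ∘L V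
      map_add' := fun x y => by
        rw [map_add, ContinuousLinearMap.add_comp, ContinuousLinearMap.comp_add]
      map_smul' := fun c x => by
        rw [map_smul, ContinuousLinearMap.smul_comp, ContinuousLinearMap.comp_smul]
        rfl },
    fun x a => ?_, fun x a => ?_, ?_, K, inferInstance, inferInstance, inferInstance,
      fun x => P x ∘L V, fun x y => ?_⟩
  · refine ContinuousLinearMap.ext fun y => ?_
    show V.adjoint (P (x * φ a) (V y)) = V.adjoint (P x (V (r a y)))
    rw [map_mul, mul_apply_eq_comp, hV]
  · refine ContinuousLinearMap.ext fun y => ?_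
    show V.adjoint (P (φ a * x) (V y)) = r a (V.adjoint (P x (V y)))
    rw [map_mul, mul_apply_eq_comp]
    exact congrArg (fun T => T (P x (V y))) (hV'' a)
  · show V.adjoint ∘L P (φ 1) ∘L V = 1
    rw [hV', map_one]
    exact hVV
  · show V.adjoint ∘L P (star x * y) ∘L V = _
    rw [map_mul, map_star, ContinuousLinearMap.adjoint_comp,
      ContinuousLinearMap.star_eq_adjoint]
    rfl

open scoped ComplexOrder in
/-- An injective morphism of C*-algebras has a positive left inverse with values in the operators
on the space of an irreducible representation. -/
theorem exists_conditional_map {𝔄 H : Type*} {B : Type u} [Ring 𝔄] [StarRing 𝔄] [Algebra ℂ 𝔄]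
    [CStarAlgebra B] [PartialOrder B]
    [StarOrderedRing B] [NormedAddCommGroup H] [InnerProductSpace ℂ H] [CompleteSpace H]
    (φ : 𝔄 →⋆ₙₐ[ℂ] B) (hφ : Function.Injective φ) (r : 𝔄 →⋆ₐ[ℂ] (H →L[ℂ] H))
    (hr : ∀ a, ‖r a‖ ≤ ‖φ a‖) (ξ : H)
    (hξ : ‖ξ‖ = 1) (hd : DenseRange fun a => r a ξ) :
    ∃ Λ : B →ₗ[ℂ] (H →L[ℂ] H), (∀ x a, Λ (x * φ a) = Λ x * r a) ∧
      (∀ x a, Λ (φ a * x) = r a * Λ x) ∧ Λ (φ 1) = 1 ∧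
      ∃ (K : Type u) (_ : NormedAddCommGroup K) (_ : InnerProductSpace ℂ K)
        (_ : CompleteSpace K) (W : B → (H →L[ℂ] K)),
        ∀ x y, Λ (star x * y) = (W x).adjoint ∘L W y := by
  obtain ⟨f, V, hV, hVn⟩ := exists_dilation φ hφ r hr ξ hξ hd
  exact exists_compression φ r f.gnsStarAlgHom V hV hVn

namespace LocalNet

variable {H : Type u} [NormedAddCommGroup H] [InnerProductSpace ℂ H] [CompleteSpace H]
variable {N : LocalNet H}

theorem one_mem_centralizer_orbit {P : H →L[ℂ] H}
    (hP : ∀ A ∈ N.globalAlg, A * P = P * A) : ∃ c : ℂ, P = c • 1 := by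
  have h : P ∈ Set.centralizer (⋃ a, (N.alg a : Set (H →L[ℂ] H))) := fun A hA => by
    obtain ⟨a, ha⟩ := Set.mem_iUnion.1 hA
    exact hP A (mem_globalAlg ha)
  rw [N.irreducible] at h
  obtain ⟨c, hc⟩ := h
  exact ⟨c, hc.symm⟩

/-- Every nonzero vector is cyclic for the C*-algebra of the net. -/
theorem denseRange_apply {ξ : H} (hξ : ξ ≠ 0) :
    DenseRange fun A : N.globalAlg => (A : H →L[ℂ] H) ξ := by
  let T : N.globalAlg →ₗ[ℂ] H :=
    { toFun := fun A => (A : H →L[ℂ] H) ξ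
      map_add' := fun A B => rfl
      map_smul' := fun c A => rfl }
  let K := (LinearMap.range T).topologicalClosure
  have hKc : IsClosed (K : Set H) := Submodule.isClosed_topologicalClosure _
  have : CompleteSpace K := hKc.completeSpace_coe
  let P : H →L[ℂ] H := K.starProjection
  have hPK : ∀ x, P x ∈ K := fun x => Submodule.starProjection_apply_mem K x
  have hPid : ∀ x ∈ K, P x = x := fun x hx => Submodule.starProjection_eq_self_iff.2 hx
  have hinv : ∀ A ∈ N.globalAlg, ∀ x ∈ K, A x ∈ K := by
    intro A hA x hx
    have hx' : x ∈ closure (LinearMap.range T : Set H) := hx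
    have : A x ∈ closure (LinearMap.range T : Set H) := by
      refine map_mem_closure A.continuous hx' ?_
      rintro _ ⟨B, rfl⟩
      exact ⟨⟨A, hA⟩ * B, rfl⟩
    exact this
  have hPs : star P = P := (isStarProjection_starProjection (U := K)).isSelfAdjoint
  have h1 : ∀ A ∈ N.globalAlg, P * A * P = A * P := fun A hA =>
    ContinuousLinearMap.ext fun x => hPid _ (hinv A hA _ (hPK x))
  -- The subspace K is invariant under A and under A*, so its projection lies in the commutant. By
  -- irreducibility it is a scalar, and it fixes ξ ≠ 0.
  have hcomm : ∀ A ∈ N.globalAlg, A * P = P * A := by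
    intro A hA
    have h2 := congrArg star (h1 (star A) (star_mem hA))
    rw [star_mul, star_mul, star_mul, star_star, hPs, ← mul_assoc, h1 A hA] at h2
    exact h2
  obtain ⟨c, hc⟩ := one_mem_centralizer_orbit hcomm
  have hξK : ξ ∈ K := Submodule.le_topologicalClosure _ ⟨1, rfl⟩
  have hc1 : c = 1 := by
    have h3 := hPid ξ hξK
    rw [hc] at h3
    have h4 : c • ξ = (1 : ℂ) • ξ := by rw [one_smul]; exact h3
    exact smul_left_injective ℂ hξ h4
  intro x
  have hx : x ∈ K := by
    have := hPK x
    rw [hc, hc1, one_smul] at this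
    exact this
  exact hx

/-- The arrow of the category given by an intertwiner of localized morphisms. -/
def homOfIntertwiner {σ τ : N.Obj} (Y : Matrix τ.ι σ.ι (H →L[ℂ] H))
    (hY : IsIntertwiner (toMor σ.toBimodule) (toMor τ.toBimodule) Y) :
    Bimodule.Hom σ.toBimodule τ.toBimodule :=
  have hmem : ∀ i j, Y i j ∈ N.globalAlg := fun i j => by
    obtain ⟨o, ho⟩ := σ.localized
    obtain ⟨o', ho'⟩ := τ.localized
    obtain ⟨a, ha, ha'⟩ := DoubleCone.exists_union_subset o o'
    exact mem_globalAlg (hY.mem ho ho' ha ha' i j)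
  let V : Matrix τ.ι σ.ι N.globalAlg := Matrix.of fun i j => ⟨Y i j, hmem i j⟩
  ⟨V, ops_injective ((ops_mul V (σ.hom 1)).trans hY.1),
    ops_injective ((ops_mul (τ.hom 1) V).trans hY.2.1),
    fun A => ops_injective ((ops_mul V (σ.hom A)).trans
      ((hY.2.2 A).trans (ops_mul (τ.hom A) V).symm))⟩

/-- A linear map from the matrices over the operators to the operators that is a positive,
normalized left inverse of `ρ` and a bimodule map. The positivity of all its amplifications is
expressed by a dilation. -/
structure Slice (ρ : Bimodule N.globalAlg) where
  toFun : Matrix ρ.ι ρ.ι N.globalAlg →ₗ[ℂ] (H →L[ℂ] H)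
  mul_hom : ∀ X A, toFun (X * ρ.hom A) = toFun X * A
  hom_mul : ∀ X A, toFun (ρ.hom A * X) = A * toFun X
  map_one : toFun (ρ.hom 1) = 1
  dilation : ∃ (K : Type u) (_ : NormedAddCommGroup K) (_ : InnerProductSpace ℂ K)
    (_ : CompleteSpace K) (W : Matrix ρ.ι ρ.ι N.globalAlg → (H →L[ℂ] K)),
    ∀ X Y, toFun (Xᴴ * Y) = (W X).adjoint ∘L W Y

/-- An object as a morphism of C*-algebras. -/
def toCStarMatrix (ρ : Bimodule N.globalAlg) :
    N.globalAlg →⋆ₙₐ[ℂ] CStarMatrix ρ.ι ρ.ι (H →L[ℂ] H) where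
  toFun A := CStarMatrix.ofMatrix (ops (ρ.hom A))
  map_smul' c A := by rw [map_smul]; rfl
  map_zero' := by rw [map_zero]; rfl
  map_add' A B := by rw [map_add]; rfl
  map_mul' A B := by rw [map_mul, ops_mul]; rfl
  map_star' A := by rw [map_star]; rfl

/-- Injective morphisms of C*-algebras are isometric. This bounds a vector state by the norm of
ρ(A), as its extension requires. -/
theorem norm_le_norm_toCStarMatrix (ρ : Bimodule N.globalAlg) (hρ : Bimodule.IsFaithful ρ)
    (A : N.globalAlg) : ‖(A : H →L[ℂ] H)‖ ≤ ‖toCStarMatrix ρ A‖ := by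
  classical
  let _ : CStarAlgebra N.globalAlg :=
    StarSubalgebra.cstarAlgebra N.globalAlg (h_closed := N.isClosed_globalAlg)
  have hφ : Function.Injective (toCStarMatrix ρ) := fun A B h => hρ (ops_injective h)
  exact (NonUnitalStarAlgHom.norm_map (toCStarMatrix ρ) hφ A).ge

theorem exists_slice [Nontrivial H] (ρ : Bimodule N.globalAlg) (hρ : Bimodule.IsFaithful ρ) :
    Nonempty (Slice ρ) := by
  classical
  obtain ⟨ξ, hξ⟩ := exists_norm_eq H zero_le_one
  obtain ⟨Λ, h1, h2, h3, K, i1, i2, i3, W, hW⟩ := exists_conditional_map (toCStarMatrix ρ)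
    (fun A B h => hρ (ops_injective h)) N.globalAlg.subtype
    (norm_le_norm_toCStarMatrix ρ hρ) ξ hξ
    (denseRange_apply (norm_pos_iff.1 (hξ ▸ one_pos)))
  refine ⟨⟨
    { toFun := fun X => Λ (CStarMatrix.ofMatrix (ops X))
      map_add' := fun X Y => map_add Λ (CStarMatrix.ofMatrix (ops X)) (CStarMatrix.ofMatrix (ops Y))
      map_smul' := fun c X => map_smul Λ c (CStarMatrix.ofMatrix (ops X)) },
    fun X A => ?_, fun X A => ?_, h3, ⟨K, i1, i2, i3,
      fun X => W (CStarMatrix.ofMatrix (ops X)), fun X Y => ?_⟩⟩⟩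
  · exact (congrArg (fun M => Λ (CStarMatrix.ofMatrix M)) (ops_mul X (ρ.hom A))).trans (h1 _ A)
  · exact (congrArg (fun M => Λ (CStarMatrix.ofMatrix M)) (ops_mul (ρ.hom A) X)).trans (h2 _ A)
  · exact (congrArg (fun M => Λ (CStarMatrix.ofMatrix M)) (ops_mul Xᴴ Y)).trans (hW _ _)

end LocalNet
end

/-! ### The left inverse defined by a slice -/

noncomputable section

open scoped InnerProductSpace

namespace Bimodule

variable {A : Type*} [Ring A] [StarRing A] [Algebra ℂ A]

/-- A morphism applied to the entries of a matrix. -/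
def lift (ρ : Bimodule A) {l l' : Type} (S : Matrix l' l A) :
    Matrix (ρ.ι × l') (ρ.ι × l) A :=
  Matrix.of fun i j => ρ.hom (S i.2 j.2) i.1 j.1

theorem times_one_left (ρ : Bimodule A) {σ τ : Bimodule A} (T : Hom σ τ) :
    (times (one ρ) T).1 = ρ.lift T.1 := by
  refine block_ext fun i j => (block_times (one ρ) T i j).trans ?_
  show ρ.hom 1 * ρ.hom _ = _
  rw [← map_mul, one_mul]
  rfl

end Bimodule

namespace LocalNet

universe u

variable {H : Type u} [NormedAddCommGroup H] [InnerProductSpace ℂ H] [CompleteSpace H]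
variable {N : LocalNet H}

namespace Slice

variable {ρ : Bimodule N.globalAlg} (Λ : Slice ρ)

/-- The map of a slice applied to the blocks of a matrix. -/
def matrix {l l' : Type} : Matrix (ρ.ι × l') (ρ.ι × l) N.globalAlg →ₗ[ℂ] Matrix l' l (H →L[ℂ] H) where
  toFun X := Matrix.of fun i j => Λ.toFun (Bimodule.block X i j)
  map_add' X Y := Matrix.ext fun i j =>
    map_add Λ.toFun (Bimodule.block X i j) (Bimodule.block Y i j)
  map_smul' c X := Matrix.ext fun i j => map_smul Λ.toFun c (Bimodule.block X i j)

theorem matrix_mul_lift {l l' m : Type} [Fintype l] [Fintype m]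
    (X : Matrix (ρ.ι × l') (ρ.ι × l) N.globalAlg) (S : Matrix l m N.globalAlg) :
    Λ.matrix (X * ρ.lift S) = Λ.matrix X * ops S := by
  ext1 i j
  show Λ.toFun (Bimodule.block (X * ρ.lift S) i j) = _
  rw [Bimodule.block_mul, map_sum, Matrix.mul_apply]
  exact Finset.sum_congr rfl fun k _ => Λ.mul_hom (Bimodule.block X i k) (S k j)

theorem matrix_lift_mul {l l' m : Type} [Fintype l] [Fintype m]
    (S : Matrix l' m N.globalAlg) (X : Matrix (ρ.ι × m) (ρ.ι × l) N.globalAlg) :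
    Λ.matrix (ρ.lift S * X) = ops S * Λ.matrix X := by
  ext1 i j
  show Λ.toFun (Bimodule.block (ρ.lift S * X) i j) = _
  rw [Bimodule.block_mul, map_sum, Matrix.mul_apply]
  exact Finset.sum_congr rfl fun k _ => Λ.hom_mul (Bimodule.block X k j) (S i k)

end Slice

variable {ρ : N.Obj} (Λ : Slice ρ.toBimodule)

/-- The matrix of (ρσ)(A) is ρ applied to the entries of σ(A), so the bimodule property of Λ carries
the intertwining relation of X to its image. A priori that image has entries in all bounded
operators; as an intertwiner of localized morphisms it falls into a local algebra by Haag duality.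
-/
theorem Slice.isIntertwiner {σ τ : N.Obj}
    (X : Bimodule.Hom (Bimodule.tensor ρ.toBimodule σ.toBimodule)
      (Bimodule.tensor ρ.toBimodule τ.toBimodule)) :
    IsIntertwiner (toMor σ.toBimodule) (toMor τ.toBimodule) (Λ.matrix X.1) := by
  have h : ∀ A, Λ.matrix X.1 * ops (σ.hom A) = ops (τ.hom A) * Λ.matrix X.1 := fun A =>
    (Λ.matrix_mul_lift X.1 (σ.hom A)).symm.trans
      ((congrArg (fun M => Λ.matrix M) (X.2.2.2 A)).trans (Λ.matrix_lift_mul (τ.hom A) X.1))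
  have h1 : Λ.matrix X.1 * ops (σ.hom 1) = Λ.matrix X.1 :=
    (Λ.matrix_mul_lift X.1 (σ.hom 1)).symm.trans (congrArg (fun M => Λ.matrix M) X.2.1)
  exact ⟨h1, (h 1).symm.trans h1, h⟩

/-- The arrow of a slice. -/
def Slice.hom {σ τ : N.Obj}
    (X : Bimodule.Hom (Bimodule.tensor ρ.toBimodule σ.toBimodule)
      (Bimodule.tensor ρ.toBimodule τ.toBimodule)) :
    Bimodule.Hom σ.toBimodule τ.toBimodule :=
  homOfIntertwiner (Λ.matrix X.1) (Λ.isIntertwiner X)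

theorem hom_ext_ops {σ τ : Bimodule N.globalAlg} {S T : Bimodule.Hom σ τ}
    (h : ops S.1 = ops T.1) : S = T := Subtype.ext (ops_injective h)

theorem Slice.hom_comp {σ σ' τ τ' : N.Obj} (S : Bimodule.Hom σ'.toBimodule σ.toBimodule)
    (T : Bimodule.Hom τ.toBimodule τ'.toBimodule)
    (X : Bimodule.Hom (Bimodule.tensor ρ.toBimodule σ.toBimodule)
      (Bimodule.tensor ρ.toBimodule τ.toBimodule)) :
    Λ.hom (σ := σ') (τ := τ') (Bimodule.comp (Bimodule.times (Bimodule.one ρ.toBimodule) T)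
      (Bimodule.comp X (Bimodule.times (Bimodule.one ρ.toBimodule) S))) =
    Bimodule.comp T (Bimodule.comp (Λ.hom X) S) := by
  refine hom_ext_ops ?_
  show Λ.matrix ((Bimodule.times (Bimodule.one ρ.toBimodule) T).1 *
    (X.1 *
      (Bimodule.times (Bimodule.one ρ.toBimodule) S).1)) = _
  rw [Bimodule.times_one_left, Bimodule.times_one_left]
  refine (Λ.matrix_lift_mul T.1 _).trans ?_
  refine (congrArg (ops T.1 * ·) (Λ.matrix_mul_lift X.1 S.1)).trans ?_
  refine Eq.trans ?_ (ops_mul T.1 ((Λ.hom X).1 * S.1)).symm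
  exact congrArg (ops T.1 * ·) (ops_mul (Λ.hom X).1 S.1).symm

theorem Slice.hom_times {σ τ : N.Obj} (π : N.Obj)
    (X : Bimodule.Hom (Bimodule.tensor ρ.toBimodule σ.toBimodule)
      (Bimodule.tensor ρ.toBimodule τ.toBimodule)) :
    Λ.hom (σ := σ.tensor π) (τ := τ.tensor π)
      (Bimodule.reassoc (Bimodule.times X (Bimodule.one π.toBimodule))) =
    Bimodule.times (Λ.hom X) (Bimodule.one π.toBimodule) := by
  refine hom_ext_ops ?_
  ext1 ⟨i2, i3⟩ ⟨j2, j3⟩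
  have h1 : Bimodule.block (Bimodule.reassoc (Bimodule.times X (Bimodule.one π.toBimodule))).1
      (i2, i3) (j2, j3) = Bimodule.block (X.1 *
        ρ.lift (σ.hom (π.hom 1 i3 j3))) i2 j2 := by
    ext1 i1 j1
    exact Bimodule.times_apply X (Bimodule.one π.toBimodule) ((i1, i2), i3) ((j1, j2), j3)
  show Λ.toFun (Bimodule.block (Bimodule.reassoc
    (Bimodule.times X (Bimodule.one π.toBimodule))).1 (i2, i3) (j2, j3)) = _
  rw [h1]
  refine (congrFun (congrFun (Λ.matrix_mul_lift X.1 (σ.hom (π.hom 1 i3 j3))) i2) j2).trans ?_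
  refine Eq.trans ?_ (congrArg Subtype.val (Bimodule.times_apply (Λ.hom X)
    (Bimodule.one π.toBimodule) (i2, i3) (j2, j3)).symm)
  exact congrFun (congrFun (ops_mul (Λ.hom X).1 (σ.hom (π.hom 1 i3 j3))).symm i2) j2

/-- The dilation of Λ makes the image of X⁺X a positive operator matrix. It commutes with σ, hence
so does its square root, which is therefore an arrow of the category. -/
theorem Slice.hom_positive {σ τ : N.Obj}
    (X : Bimodule.Hom (Bimodule.tensor ρ.toBimodule σ.toBimodule)
      (Bimodule.tensor ρ.toBimodule τ.toBimodule)) :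
    ∃ Y : Bimodule.Hom σ.toBimodule σ.toBimodule,
      Λ.hom (Bimodule.comp (Bimodule.adj X) X) = Bimodule.comp (Bimodule.adj Y) Y := by
  obtain ⟨K, _, _, _, W, hW⟩ := Λ.dilation
  have hZ := Λ.isIntertwiner (σ := σ) (τ := σ) (Bimodule.comp (Bimodule.adj X) X)
  obtain ⟨Y, hY, hY1, hYA⟩ := OperatorMatrix.exists_sqrt (toMor σ.toBimodule)
    (l := τ.ι) (fun k i => W (Bimodule.block X.1 k i))
    (Λ.matrix (Bimodule.comp (Bimodule.adj X) X).1) (fun i j => by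
      have h1 : Bimodule.block (Bimodule.comp (Bimodule.adj X) X).1 i j =
          ∑ k, (Bimodule.block X.1 k i)ᴴ * Bimodule.block X.1 k j :=
        Bimodule.block_mul (κ' := ρ.ι) (l' := τ.ι) X.1ᴴ X.1 i j
      show Λ.toFun (Bimodule.block (Bimodule.comp (Bimodule.adj X) X).1 i j) = _
      rw [h1, map_sum]
      exact Finset.sum_congr rfl fun k _ => hW _ _) (fun A => hZ.2.2 A) hZ.1
  refine ⟨homOfIntertwiner Y ⟨hY1, (hYA 1).symm.trans hY1, hYA⟩, hom_ext_ops ?_⟩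
  refine hY.symm.trans ?_
  refine Eq.trans ?_ (ops_mul _ _).symm
  rfl

/-- The left inverse of a slice. -/
def Slice.leftInverse : LeftInverse ρ where
  map σ τ :=
    { toFun := Λ.hom
      map_add' := fun X Y => hom_ext_ops (map_add Λ.matrix X.1 Y.1)
      map_smul' := fun c X => hom_ext_ops (map_smul Λ.matrix c X.1) }
  map_comp _ _ _ _ S T X := Λ.hom_comp (Bimodule.adj S) T X
  map_times _ _ π X := Λ.hom_times π X
  positive _ X := Λ.hom_positive X
  normalized := hom_ext_ops (by
    ext1 i j
    exact Λ.map_one)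

/-- The right module property for arbitrary algebra elements, which is more than the axioms of a
left inverse provide. It serves to prove that the determinant is faithful. -/
theorem Slice.leftInverse_mul_eq_zero {σ τ : N.Obj}
    (X : Bimodule.Hom (Bimodule.tensor ρ.toBimodule σ.toBimodule)
      (Bimodule.tensor ρ.toBimodule τ.toBimodule)) (A : N.globalAlg)
    (hX : X.1 * (Bimodule.tensor ρ.toBimodule σ.toBimodule).hom A = 0) : (Λ.leftInverse.map σ τ X).1 * σ.hom A = 0 := by
  refine ops_injective ?_
  refine (ops_mul (Λ.hom X).1 (σ.hom A)).trans ?_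
  refine (Λ.matrix_mul_lift X.1 (σ.hom A)).symm.trans ?_
  refine (congrArg (fun M => Λ.matrix M) hX).trans ?_
  exact map_zero Λ.matrix

end LocalNet
end

/-! ### Permutations acting on the powers of an object -/

noncomputable section

open CategoryTheory MonoidalCategory

section SymmetricPowers

variable {C : Type*} [Category C] [MonoidalCategory C] [SymmetricCategory C]

/-- The exchange of the first two factors of `X ⊗ (X ⊗ Z)`. -/
def exchange (X Z : C) : X ⊗ (X ⊗ Z) ⟶ X ⊗ (X ⊗ Z) :=
  (α_ X X Z).inv ≫ (β_ X X).hom ▷ Z ≫ (α_ X X Z).hom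

theorem exchange_exchange (X Z : C) : exchange X Z ≫ exchange X Z = 𝟙 _ := by
  simp [exchange, ← comp_whiskerRight_assoc]

theorem exchange_whiskerLeft (X : C) {Z Z' : C} (f : Z ⟶ Z') :
    exchange X Z ≫ X ◁ X ◁ f = X ◁ X ◁ f ≫ exchange X Z' := by
  simp only [exchange, Category.assoc]
  rw [← associator_naturality_right, associator_inv_naturality_right_assoc,
    whisker_exchange_assoc]

/-- After the rebracketing φ only the three factors X are involved, and the claim is the Yang-Baxter
equation. -/
theorem exchange_braid (X Z : C) :
    exchange X (X ⊗ Z) ≫ X ◁ exchange X Z ≫ exchange X (X ⊗ Z) =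
      X ◁ exchange X Z ≫ exchange X (X ⊗ Z) ≫ X ◁ exchange X Z := by
  let φ : X ⊗ (X ⊗ (X ⊗ Z)) ≅ (X ⊗ (X ⊗ X)) ⊗ Z :=
    whiskerLeftIso X (α_ X X Z).symm ≪≫ (α_ X (X ⊗ X) Z).symm
  have h1 : exchange X (X ⊗ Z) = φ.hom ≫ exchange X X ▷ Z ≫ φ.inv := by
    simp only [exchange, φ, Iso.trans_hom, Iso.trans_inv, whiskerLeftIso_hom, whiskerLeftIso_inv,
      Iso.symm_hom, Iso.symm_inv]
    monoidal
  have h2 : X ◁ exchange X Z = φ.hom ≫ (X ◁ (β_ X X).hom) ▷ Z ≫ φ.inv := by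
    simp only [exchange, φ, Iso.trans_hom, Iso.trans_inv, whiskerLeftIso_hom, whiskerLeftIso_inv,
      Iso.symm_hom, Iso.symm_inv]
    monoidal
  have h3 := BraidedCategory.yang_baxter X X X
  have h4 : exchange X X ≫ X ◁ (β_ X X).hom ≫ exchange X X =
      X ◁ (β_ X X).hom ≫ exchange X X ≫ X ◁ (β_ X X).hom := by
    simpa only [exchange, Category.assoc] using h3
  rw [h1, h2]
  simp only [Category.assoc, Iso.inv_hom_id_assoc]
  rw [← comp_whiskerRight_assoc, ← comp_whiskerRight_assoc, ← comp_whiskerRight_assoc,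
    ← comp_whiskerRight_assoc]
  simp only [Category.assoc]
  rw [h4]

/-- Conjugation with the exchange of the first two factors. -/
theorem exchange_conj (P : C) {Z Z' : C} (Y : P ⊗ Z ⟶ P ⊗ Z') :
    exchange P Z ≫ P ◁ Y ≫ exchange P Z' =
      P ◁ (β_ P Z).hom ≫ ((α_ P Z P).inv ≫ Y ▷ P ≫ (α_ P Z' P).hom) ≫ P ◁ (β_ Z' P).hom := by
  -- The braiding of P past P ⊗ W begins with the exchange of the two copies of P, which cancels the
  -- given exchange.
  have h : ∀ W : C, exchange P W ≫ (β_ P (P ⊗ W)).hom =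
      P ◁ (β_ P W).hom ≫ (α_ P W P).inv := fun W => by
    rw [BraidedCategory.braiding_tensor_right_hom, exchange]
    simp [← comp_whiskerRight_assoc]
  have h' : (β_ (P ⊗ Z') P).hom ≫ exchange P Z' = (α_ P Z' P).hom ≫ P ◁ (β_ Z' P).hom := by
    have e1 := h Z'
    rw [← cancel_epi (P ◁ (β_ P Z').hom ≫ (α_ P Z' P).inv), ← e1]
    simp only [Category.assoc, SymmetricCategory.symmetry_assoc]
    rw [exchange_exchange, reassoc_of% e1]
    simp [← whiskerLeft_comp]
  have h2 : P ◁ Y = (β_ P (P ⊗ Z)).hom ≫ Y ▷ P ≫ (β_ (P ⊗ Z') P).hom := by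
    rw [← Category.assoc, ← BraidedCategory.braiding_naturality_right, Category.assoc,
      SymmetricCategory.symmetry, Category.comp_id]
  rw [h2]
  simp only [Category.assoc]
  rw [h', reassoc_of% (h Z)]

end SymmetricPowers

namespace LocalNet

variable {H : Type*} [NormedAddCommGroup H] [InnerProductSpace ℂ H] [CompleteSpace H]
variable {N : LocalNet H}

theorem pow_localized (ρ : N.Obj) :
    ∀ n, ∃ o, IsLocalizedIn (toMor (Bimodule.pow ρ.toBimodule n)) o
  | 0 => (Obj.unit N).localized
  | n + 1 => by
    obtain ⟨o, ho⟩ := ρ.localized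
    obtain ⟨o', ho'⟩ := pow_localized ρ n
    obtain ⟨a, ha, ha'⟩ := DoubleCone.exists_union_subset o o'
    exact ⟨a, tensor_localized (ho.mono ha) (ho'.mono ha')⟩

theorem pow_transportable (ρ : N.Obj) :
    ∀ n, IsTransportable (toMor (Bimodule.pow ρ.toBimodule n))
  | 0 => (Obj.unit N).transportable
  | n + 1 => (ρ.tensor ⟨Bimodule.pow ρ.toBimodule n, pow_localized ρ n,
      pow_transportable ρ n⟩).transportable

/-- The powers of an object. -/
def power (ρ : N.Obj) (n : ℕ) : N.Obj :=
  ⟨Bimodule.pow ρ.toBimodule n, pow_localized ρ n, pow_transportable ρ n⟩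

/-- The arrows that represent the transpositions of neighbours. -/
def neighbour (ρ : N.Obj) (d i : ℕ) : End (power ρ d) := adjacent ρ d i

theorem neighbour_zero (ρ : N.Obj) (d : ℕ) :
    neighbour ρ (d + 2) 0 = exchange ρ (power ρ d) := by
  refine (Bimodule.reassoc_eq (ρ := ρ.toBimodule) (σ := ρ.toBimodule)
      (τ := Bimodule.pow ρ.toBimodule d) (ρ' := ρ.toBimodule) (σ' := ρ.toBimodule)
      (τ' := Bimodule.pow ρ.toBimodule d) (Bimodule.times (symmetry ρ ρ) (Bimodule.one _))).trans ?_
  exact (Bimodule.comp_assoc _ _ _).symm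

theorem neighbour_succ (ρ : N.Obj) (d i : ℕ) :
    neighbour ρ (d + 1) (i + 1) = ρ ◁ (neighbour ρ d i : power ρ d ⟶ power ρ d) := by
  cases d <;> rfl

open Equiv.Perm

/-- Relations that avoid the first transposition come from the next lower power by tensoring with ρ.
The others are the involutivity, the braid identity and the naturality of `exchange`. -/
theorem coxeterRelations_neighbour (ρ : N.Obj) :
    ∀ n, CoxeterRelations (neighbour ρ (n + 1)) n
  | 0 => ⟨fun _ h => absurd h (by omega), fun _ h => absurd h (by omega),
      fun _ _ _ h => absurd h (by omega)⟩
  | n + 1 => by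
    have ih := coxeterRelations_neighbour ρ n
    refine ⟨fun i hi => ?_, fun i hi => ?_, fun i j hij hj => ?_⟩
    · cases i with
      | zero => rw [neighbour_zero]; exact exchange_exchange _ _
      | succ i =>
        rw [neighbour_succ]
        refine (whiskerLeft_comp ρ _ _).symm.trans ?_
        exact (congrArg (fun f : power ρ (n + 1) ⟶ power ρ (n + 1) => ρ ◁ f)
          (ih.sq i (by omega))).trans (whiskerLeft_id _ _)
    · cases i with
      | zero =>
        cases n with
        | zero => omega
        | succ n =>
          rw [neighbour_zero, neighbour_succ, neighbour_zero]
          exact exchange_braid ρ (power ρ n)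
      | succ i =>
        rw [neighbour_succ, neighbour_succ]
        have h := congrArg (fun f : power ρ (n + 1) ⟶ power ρ (n + 1) => ρ ◁ f)
          (ih.braid i (by omega))
        simp only [End.mul_def, whiskerLeft_comp] at h ⊢
        exact h
    · obtain ⟨j, rfl⟩ : ∃ k, j = k + 1 := ⟨j - 1, by omega⟩
      cases i with
      | zero =>
        obtain ⟨j, rfl⟩ : ∃ k, j = k + 1 := ⟨j - 1, by omega⟩
        cases n with
        | zero => omega
        | succ n =>
          rw [neighbour_zero, neighbour_succ, neighbour_succ]
          exact (exchange_whiskerLeft ρ (neighbour ρ (n + 1) j :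
            power ρ (n + 1) ⟶ power ρ (n + 1))).symm
      | succ i =>
        rw [neighbour_succ, neighbour_succ]
        have h := congrArg (fun f : power ρ (n + 1) ⟶ power ρ (n + 1) => ρ ◁ f)
          (ih.comm i j (by omega) (by omega)).eq
        simp only [End.mul_def, whiskerLeft_comp] at h
        exact h

/-- The representation of the permutation group on a power of an object. -/
def permHom (ρ : N.Obj) : ∀ d : ℕ, Equiv.Perm (Fin d) →* End (power ρ d)
  | 0 => 1
  | d + 1 =>
    { toFun := rep d (neighbour ρ (d + 1))
      map_one' := rep_one _ _
      map_mul' := rep_mul (coxeterRelations_neighbour ρ d) }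

theorem permHom_swap (ρ : N.Obj) : ∀ (d i : ℕ) (h : i + 1 < d),
    permHom ρ d (Equiv.swap ⟨i, Nat.lt_of_succ_lt h⟩ ⟨i + 1, h⟩) = neighbour ρ d i
  | d + 1, i, h => rep_swap d _ i (by omega)

theorem isPermRep_permHom (ρ : N.Obj) (d : ℕ) : IsPermRep ρ d (permHom ρ d) where
  map_one := _root_.map_one (permHom ρ d)
  map_mul := _root_.map_mul (permHom ρ d)
  map_swap := permHom_swap ρ d

theorem hom_eq_of_swap {M : Type*} [Monoid M] {d : ℕ} {f g : Equiv.Perm (Fin d) →* M}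
    (h : ∀ (i : ℕ) (h : i + 1 < d), f (Equiv.swap ⟨i, Nat.lt_of_succ_lt h⟩ ⟨i + 1, h⟩) =
      g (Equiv.swap ⟨i, Nat.lt_of_succ_lt h⟩ ⟨i + 1, h⟩)) : f = g := by
  cases d with
  | zero =>
    refine MonoidHom.ext fun p => ?_
    rw [Subsingleton.elim p 1, _root_.map_one, _root_.map_one]
  | succ d =>
    refine MonoidHom.eq_of_eqOn_denseM (mclosure_swap_castSucc_succ d) ?_
    rintro _ ⟨i, rfl⟩
    exact h i (by omega)

/-- Transpositions of neighbours generate, so the representation mentioned in the definition of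
finite statistics is unique and may be replaced by the constructed one. -/
theorem IsPermRep.eq_permHom {ρ : N.Obj} {d : ℕ} {R : Equiv.Perm (Fin d) →
    Bimodule.Hom (Bimodule.pow ρ.toBimodule d) (Bimodule.pow ρ.toBimodule d)}
    (h : IsPermRep ρ d R) : R = permHom ρ d := by
  let f : Equiv.Perm (Fin d) →* End (power ρ d) :=
    { toFun := R, map_one' := h.map_one, map_mul' := h.map_mul }
  have : f = permHom ρ d := hom_eq_of_swap fun i hi =>
    (h.map_swap i hi).trans (permHom_swap ρ d i hi).symm
  exact congrArg DFunLike.coe this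

/-- The endomorphisms of an object as endomorphisms of its products with `ρ` from the left. -/
def whiskerLeftEnd (ρ σ : N.Obj) : End σ →* End (ρ ⊗ σ) where
  toFun f := ρ ◁ f
  map_one' := whiskerLeft_id _ _
  map_mul' _ _ := whiskerLeft_comp ρ _ _

/-- The shift of permutations as a morphism. -/
def shiftHom (d : ℕ) : Equiv.Perm (Fin d) →* Equiv.Perm (Fin (d + 1)) where
  toFun := shift
  map_one' := shift_one
  map_mul' := shift_mul

theorem permHom_shift (ρ : N.Obj) (d : ℕ) (e : Equiv.Perm (Fin d)) :
    permHom ρ (d + 1) (shift e) = ρ ◁ (permHom ρ d e : power ρ d ⟶ power ρ d) := by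
  have h : (permHom ρ (d + 1)).comp (shiftHom d) =
      (whiskerLeftEnd ρ (power ρ d)).comp (permHom ρ d) := hom_eq_of_swap fun i hi => by
    have h1 := permHom_swap ρ (d + 1) (i + 1) (by omega)
    rw [neighbour_succ, ← permHom_swap ρ d i hi] at h1
    refine Eq.trans (congrArg (permHom ρ (d + 1)) (shift_swap _ _)) h1
  exact DFunLike.congr_fun h e

/-- Passage to the adjoint as a morphism to the opposite monoid. -/
def dagEnd (σ : N.Obj) : End σ →* (End σ)ᵐᵒᵖ where
  toFun f := MulOpposite.op (dag f)
  map_one' := congrArg MulOpposite.op (dag_id σ)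
  map_mul' f g := congrArg MulOpposite.op (dag_comp g f)

theorem dag_exchange (ρ σ : N.Obj) : dag (exchange ρ σ) = exchange ρ σ := by
  simp only [exchange, dag_comp, dag_associator_hom, dag_associator_inv, dag_whiskerRight,
    dag_braiding, Category.assoc]

theorem dag_neighbour (ρ : N.Obj) : ∀ d i, dag (neighbour ρ d i) = neighbour ρ d i
  | 0, _ => Subtype.ext Matrix.conjTranspose_zero
  | 1, 0 => Subtype.ext Matrix.conjTranspose_zero
  | d + 2, 0 => by rw [neighbour_zero]; exact dag_exchange _ _
  | d + 1, i + 1 => by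
    rw [neighbour_succ]
    refine (dag_whiskerLeft ρ _).trans ?_
    rw [dag_neighbour ρ d i]

/-- Both sides are antihomomorphisms in p, and they agree on the self-adjoint images of the
neighbour transpositions. -/
theorem dag_permHom (ρ : N.Obj) (d : ℕ) (p : Equiv.Perm (Fin d)) :
    dag (permHom ρ d p) = permHom ρ d p⁻¹ := by
  have h : ((dagEnd (power ρ d)).comp (permHom ρ d)) =
      (permHom ρ d).op.comp (MulEquiv.inv' (Equiv.Perm (Fin d))).toMonoidHom :=
    hom_eq_of_swap fun i hi => by
      refine congrArg MulOpposite.op ?_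
      show dag (permHom ρ d _) = permHom ρ d (Equiv.swap _ _)⁻¹
      rw [Equiv.swap_inv, permHom_swap ρ d i hi, dag_neighbour]
  exact congrArg MulOpposite.unop (DFunLike.congr_fun h p)

end LocalNet
end

/-! ### Calculus of left inverses and their statistics parameters -/

noncomputable section

open CategoryTheory MonoidalCategory

section Coherence

variable {C : Type*} [Category C] [MonoidalCategory C]

theorem associator_conj_whiskerRight {A B S T : C} (P : C) (X : (A ⊗ B) ⊗ S ⟶ (A ⊗ B) ⊗ T) :
    (α_ A B (S ⊗ P)).inv ≫ ((α_ (A ⊗ B) S P).inv ≫ X ▷ P ≫ (α_ (A ⊗ B) T P).hom) ≫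
      (α_ A B (T ⊗ P)).hom =
    A ◁ (α_ B S P).inv ≫ ((α_ A (B ⊗ S) P).inv ≫ ((α_ A B S).inv ≫ X ≫ (α_ A B T).hom) ▷ P ≫
      (α_ A (B ⊗ T) P).hom) ≫ A ◁ (α_ B T P).hom := by
  monoidal

variable [SymmetricCategory C]

/-- The self-braiding of A ⊗ B is arranged so that all factors but one exchange of the two copies of
A have the form `A ◁ _`. A left inverse of A then acts on this exchange only. -/
theorem associator_conj_braiding (A B : C) :
    (α_ A B (A ⊗ B)).inv ≫ (β_ (A ⊗ B) (A ⊗ B)).hom ≫ (α_ A B (A ⊗ B)).hom =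
      A ◁ ((β_ B (A ⊗ B)).hom ≫ (α_ A B B).hom) ≫ exchange A (B ⊗ B) ≫
        A ◁ ((α_ A B B).inv ≫ (β_ A B).hom ▷ B ≫ (α_ B A B).hom) := by
  rw [BraidedCategory.braiding_tensor_left_hom A B (A ⊗ B),
    BraidedCategory.braiding_tensor_right_hom A A B, exchange]
  monoidal

/-- What remains of the self-braiding after A is stripped off: the braiding of B with itself,
tensored with A and conjugated by braidings, ready for a left inverse of B. -/
theorem braiding_comp_braiding_whiskerRight (A B : C) :
    (β_ B (A ⊗ B)).hom ≫ (β_ A B).hom ▷ B ≫ (α_ B A B).hom =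
      B ◁ (β_ A B).hom ≫ ((α_ B B A).inv ≫ (β_ B B).hom ▷ A ≫ (α_ B B A).hom) ≫
        B ◁ (β_ B A).hom := by
  rw [← BraidedCategory.braiding_naturality_right_assoc,
    BraidedCategory.braiding_tensor_right_hom]
  simp

theorem conj_braiding {A B : C} (u : B ≅ A) : u.inv ▷ B ≫ (β_ B B).hom ≫ u.hom ▷ B =
      A ◁ u.hom ≫ (β_ A A).hom ≫ A ◁ u.inv := by
  rw [← BraidedCategory.braiding_naturality_right, ← whisker_exchange_assoc,
    BraidedCategory.braiding_naturality_left]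

end Coherence

namespace LocalNet

variable {H : Type*} [NormedAddCommGroup H] [InnerProductSpace ℂ H] [CompleteSpace H]
variable {N : LocalNet H}

namespace LeftInverse

variable {ρ : N.Obj}

/-- A left inverse as a linear map between spaces of arrows of the category. -/
def app (Ψ : LeftInverse ρ) {σ τ : N.Obj} : (ρ ⊗ σ ⟶ ρ ⊗ τ) →ₗ[ℂ] (σ ⟶ τ) := Ψ.map σ τ

variable (Ψ : LeftInverse ρ)

theorem app_whiskerLeft {σ σ' τ τ' : N.Obj} (S : σ' ⟶ σ) (T : τ ⟶ τ') (X : ρ ⊗ σ ⟶ ρ ⊗ τ) :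
    Ψ.app (ρ ◁ S ≫ X ≫ ρ ◁ T) = S ≫ Ψ.app X ≫ T := by
  have h := Ψ.map_comp σ σ' τ τ' (dag S) T X
  rw [show Bimodule.adj (dag S) = S from dag_dag S] at h
  refine Eq.trans ?_ (h.trans ?_)
  · exact congrArg (Ψ.map σ' τ') (Bimodule.comp_assoc _ _ _)
  · exact (Bimodule.comp_assoc _ _ _).symm

theorem app_whiskerLeft_comp {σ σ' τ : N.Obj} (S : σ' ⟶ σ) (X : ρ ⊗ σ ⟶ ρ ⊗ τ) :
    Ψ.app (ρ ◁ S ≫ X) = S ≫ Ψ.app X := by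
  have h := Ψ.app_whiskerLeft S (𝟙 τ) X
  rwa [whiskerLeft_id, Category.comp_id, Category.comp_id] at h

theorem app_comp_whiskerLeft {σ τ τ' : N.Obj} (T : τ ⟶ τ') (X : ρ ⊗ σ ⟶ ρ ⊗ τ) :
    Ψ.app (X ≫ ρ ◁ T) = Ψ.app X ≫ T := by
  have h := Ψ.app_whiskerLeft (𝟙 σ) T X
  rwa [whiskerLeft_id, Category.id_comp, Category.id_comp] at h

theorem app_whiskerRight {σ τ : N.Obj} (π : N.Obj) (X : ρ ⊗ σ ⟶ ρ ⊗ τ) :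
    Ψ.app ((α_ ρ σ π).inv ≫ X ▷ π ≫ (α_ ρ τ π).hom) = Ψ.app X ▷ π := by
  refine Eq.trans ?_ (Ψ.map_times σ τ π X)
  refine congrArg (Ψ.map (σ.tensor π) (τ.tensor π)) ?_
  refine Eq.trans ?_ (Bimodule.reassoc_eq (Bimodule.times X (Bimodule.one π.toBimodule))).symm
  exact Bimodule.comp_assoc _ _ _

/-- Normalization is required at the unit object only. Tensoring with σ from the right and removing
the unit spreads it to all objects. -/
theorem app_id (σ : N.Obj) : Ψ.app (𝟙 (ρ ⊗ σ)) = 𝟙 σ := by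
  have h1 : Ψ.app (𝟙 (ρ ⊗ 𝟙_ N.Obj)) = 𝟙 (𝟙_ N.Obj) := Ψ.normalized
  have h2 := Ψ.app_whiskerRight σ (𝟙 (ρ ⊗ 𝟙_ N.Obj))
  rw [h1, id_whiskerRight, id_whiskerRight, Category.id_comp, Iso.inv_hom_id] at h2
  have h3 := Ψ.app_whiskerLeft (λ_ σ).inv (λ_ σ).hom (𝟙 (ρ ⊗ (𝟙_ N.Obj ⊗ σ)))
  rw [h2, Category.id_comp, Category.id_comp, ← whiskerLeft_comp, Iso.inv_hom_id,
    whiskerLeft_id] at h3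
  exact h3

theorem app_positive {σ : N.Obj} (X : ρ ⊗ σ ⟶ ρ ⊗ σ) :
    ∃ Y : σ ⟶ σ, Ψ.app (X ≫ dag X) = Y ≫ dag Y := Ψ.positive σ X

/-- A left inverse from its properties in the category. -/
def ofApp (F : ∀ σ τ : N.Obj, (ρ ⊗ σ ⟶ ρ ⊗ τ) →ₗ[ℂ] (σ ⟶ τ))
    (hwl : ∀ {σ σ' τ τ' : N.Obj} (S : σ' ⟶ σ) (T : τ ⟶ τ') (X : ρ ⊗ σ ⟶ ρ ⊗ τ),
      F σ' τ' (ρ ◁ S ≫ X ≫ ρ ◁ T) = S ≫ F σ τ X ≫ T)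
    (hwr : ∀ {σ τ : N.Obj} (π : N.Obj) (X : ρ ⊗ σ ⟶ ρ ⊗ τ),
      F (σ ⊗ π) (τ ⊗ π) ((α_ ρ σ π).inv ≫ X ▷ π ≫ (α_ ρ τ π).hom) = F σ τ X ▷ π)
    (hpos : ∀ {σ : N.Obj} (X : ρ ⊗ σ ⟶ ρ ⊗ σ), ∃ Y : σ ⟶ σ, F σ σ (X ≫ dag X) = Y ≫ dag Y)
    (hid : F (𝟙_ N.Obj) (𝟙_ N.Obj) (𝟙 (ρ ⊗ 𝟙_ N.Obj)) = 𝟙 (𝟙_ N.Obj)) : LeftInverse ρ where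
  map := F
  map_comp σ σ' τ τ' S T X := by
    refine Eq.trans ?_ ((hwl (dag S) T X).trans ?_)
    · exact congrArg (F σ' τ') (Bimodule.comp_assoc _ _ _).symm
    · exact Bimodule.comp_assoc _ _ _
  map_times σ τ π X := by
    refine Eq.trans ?_ (hwr π X)
    refine congrArg (F (σ ⊗ π) (τ ⊗ π)) ?_
    refine (Bimodule.reassoc_eq (Bimodule.times X (Bimodule.one π.toBimodule))).trans ?_
    exact (Bimodule.comp_assoc _ _ _).symm
  positive _ X := hpos X
  normalized := hid

/-- The left inverse of the unit object. -/
def unit : LeftInverse (𝟙_ N.Obj) :=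
  ofApp (fun σ τ =>
    { toFun := fun X => (λ_ σ).inv ≫ X ≫ (λ_ τ).hom
      map_add' := fun X Y => by rw [Preadditive.add_comp, Preadditive.comp_add]
      map_smul' := fun c X => by rw [Linear.smul_comp, Linear.comp_smul]; rfl })
    (fun S T X => by simp) (fun π X => by
      show (λ_ _).inv ≫ _ ≫ (λ_ _).hom = ((λ_ _).inv ≫ X ≫ (λ_ _).hom) ▷ π
      simp) (fun {σ} X => ⟨(λ_ σ).inv ≫ X ≫ (λ_ σ).hom, by
      rw [dag_comp, dag_comp, ← dag_leftUnitor_hom, dag_dag, dag_leftUnitor_hom]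
      simp⟩) (by simp)

theorem unit_app {σ τ : N.Obj} (X : 𝟙_ N.Obj ⊗ σ ⟶ 𝟙_ N.Obj ⊗ τ) :
    (unit (N := N)).app X = (λ_ σ).inv ≫ X ≫ (λ_ τ).hom := rfl

/-- The left inverse of a product of two objects. -/
def tensor {ρ' : N.Obj} (Φ : LeftInverse ρ') : LeftInverse (ρ ⊗ ρ') :=
  ofApp (fun σ τ =>
    { toFun := fun X => Φ.app (Ψ.app ((α_ ρ ρ' σ).inv ≫ X ≫ (α_ ρ ρ' τ).hom))
      map_add' := fun X Y => by
        rw [Preadditive.add_comp, Preadditive.comp_add, map_add, map_add]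
      map_smul' := fun c X => by
        rw [Linear.smul_comp, Linear.comp_smul, map_smul, map_smul]; rfl })
    (fun {σ σ' τ τ'} S T X => by
      show Φ.app (Ψ.app _) = S ≫ Φ.app (Ψ.app _) ≫ T
      rw [← Φ.app_whiskerLeft, ← Ψ.app_whiskerLeft]
      simp) (fun {σ τ} π X => by
      show Φ.app (Ψ.app _) = Φ.app (Ψ.app _) ▷ π
      rw [← Φ.app_whiskerRight, ← Ψ.app_whiskerRight, ← Ψ.app_whiskerLeft]
      exact congrArg (fun Z => Φ.app (Ψ.app Z)) (associator_conj_whiskerRight π X)) (fun {σ} X => by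
      obtain ⟨Y, hY⟩ := Ψ.app_positive ((α_ ρ ρ' σ).inv ≫ X ≫ (α_ ρ ρ' σ).hom)
      obtain ⟨Z, hZ⟩ := Φ.app_positive Y
      refine ⟨Z, ?_⟩
      rw [← hZ, ← hY]
      show Φ.app (Ψ.app _) = _
      rw [dag_comp, dag_comp, dag_associator_hom, dag_associator_inv]
      simp) (by
      show Φ.app (Ψ.app _) = _
      rw [Category.id_comp, Iso.inv_hom_id, app_id, app_id])

theorem tensor_app {ρ' : N.Obj} (Φ : LeftInverse ρ') {σ τ : N.Obj}
    (X : (ρ ⊗ ρ') ⊗ σ ⟶ (ρ ⊗ ρ') ⊗ τ) :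
    (Ψ.tensor Φ).app X = Φ.app (Ψ.app ((α_ ρ ρ' σ).inv ≫ X ≫ (α_ ρ ρ' τ).hom)) := rfl

/-- The transport of a left inverse along a unitary. -/
def ofUnitary {ρ' : N.Obj} (u : ρ' ≅ ρ) (hu : dag u.hom = u.inv) : LeftInverse ρ' :=
  ofApp (fun σ τ =>
    { toFun := fun X => Ψ.app (u.inv ▷ σ ≫ X ≫ u.hom ▷ τ)
      map_add' := fun X Y => by rw [Preadditive.add_comp, Preadditive.comp_add, map_add]
      map_smul' := fun c X => by
        rw [Linear.smul_comp, Linear.comp_smul, map_smul]; rfl })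
    (fun {σ σ' τ τ'} S T X => by
      show Ψ.app _ = S ≫ Ψ.app _ ≫ T
      rw [← Ψ.app_whiskerLeft]
      simp only [Category.assoc, whisker_exchange, whisker_exchange_assoc]) (fun {σ τ} π X => by
      show Ψ.app _ = Ψ.app _ ▷ π
      rw [← Ψ.app_whiskerRight]
      congr 1
      simp) (fun {σ} X => by
      obtain ⟨Y, hY⟩ := Ψ.app_positive (u.inv ▷ σ ≫ X ≫ u.hom ▷ σ)
      refine ⟨Y, ?_⟩
      rw [← hY]
      show Ψ.app _ = _
      rw [dag_comp, dag_comp, dag_whiskerRight, dag_whiskerRight, hu, ← hu, dag_dag]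
      simp [hu]) (by
      show Ψ.app _ = _
      rw [Category.id_comp, ← comp_whiskerRight, Iso.inv_hom_id, id_whiskerRight, app_id])

theorem ofUnitary_app {ρ' : N.Obj} (u : ρ' ≅ ρ) (hu : dag u.hom = u.inv) {σ τ : N.Obj}
    (X : ρ' ⊗ σ ⟶ ρ' ⊗ τ) : (Ψ.ofUnitary u hu).app X = Ψ.app (u.inv ▷ σ ≫ X ≫ u.hom ▷ τ) := rfl

theorem app_exchange {c : ℂ} (hc : Ψ.app (β_ ρ ρ).hom = c • 𝟙 ρ) (σ : N.Obj) :
    Ψ.app (exchange ρ σ) = c • 𝟙 (ρ ⊗ σ) := by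
  refine (Ψ.app_whiskerRight σ (β_ ρ ρ).hom).trans ?_
  rw [hc, MonoidalLinear.smul_whiskerRight, id_whiskerRight]

/-- The two exchanges move the spectator copy of ρ to the right end, where Ψ ignores it, and the
braiding then brings it back to the left. -/
theorem app_exchange_conj {σ τ : N.Obj} (Y : ρ ⊗ σ ⟶ ρ ⊗ τ) :
    Ψ.app (exchange ρ σ ≫ ρ ◁ Y ≫ exchange ρ τ) = ρ ◁ Ψ.app Y := by
  rw [exchange_conj, app_whiskerLeft, app_whiskerRight, ← Category.assoc,
    ← BraidedCategory.braiding_naturality_right, Category.assoc, SymmetricCategory.symmetry,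
    Category.comp_id]

theorem unit_app_braiding : (unit (N := N)).app (β_ (𝟙_ N.Obj) (𝟙_ N.Obj)).hom = 𝟙 _ := by
  rw [unit_app, braiding_tensorUnit_left, Category.assoc, Iso.inv_hom_id_assoc, unitors_equal,
    Iso.inv_hom_id]

theorem ofUnitary_app_braiding {ρ' : N.Obj} (u : ρ' ≅ ρ) (hu : dag u.hom = u.inv) {c : ℂ}
    (hc : Ψ.app (β_ ρ ρ).hom = c • 𝟙 ρ) :
    (Ψ.ofUnitary u hu).app (β_ ρ' ρ').hom = c • 𝟙 ρ' := by
  rw [ofUnitary_app, conj_braiding, app_whiskerLeft, hc]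
  simp

theorem tensor_app_braiding {ρ' : N.Obj} (Φ : LeftInverse ρ') {c d : ℂ}
    (hc : Ψ.app (β_ ρ ρ).hom = c • 𝟙 ρ) (hd : Φ.app (β_ ρ' ρ').hom = d • 𝟙 ρ') :
    (Ψ.tensor Φ).app (β_ (ρ ⊗ ρ') (ρ ⊗ ρ')).hom = (c * d) • 𝟙 (ρ ⊗ ρ') := by
  rw [tensor_app, associator_conj_braiding, app_whiskerLeft, app_exchange _ hc, Linear.smul_comp,
    Linear.comp_smul, Category.id_comp, Category.assoc, Iso.hom_inv_id_assoc, map_smul,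
    braiding_comp_braiding_whiskerRight, app_whiskerLeft, app_whiskerRight, hd,
    MonoidalLinear.smul_whiskerRight, id_whiskerRight, Linear.smul_comp,
    Linear.comp_smul, Category.id_comp, SymmetricCategory.symmetry, smul_smul]

end LeftInverse

end LocalNet
end

/-! ### Symmetrizers, antisymmetrizers and their images under a left inverse -/

noncomputable section

namespace Equiv.Perm

/-- The trivial character of the permutation group or the sign. -/
def character (s : ℤˣ) {d : ℕ} : Equiv.Perm (Fin d) →* ℤˣ := if s = 1 then 1 else sign

theorem character_swap (s : ℤˣ) {d : ℕ} {i j : Fin d} (h : i ≠ j) :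
    character s (swap i j) = s := by
  rcases Int.units_eq_one_or s with rfl | rfl
  · simp [character]
  · simp [character, sign_swap h]

theorem character_shift (s : ℤˣ) {d : ℕ} (e : Equiv.Perm (Fin d)) :
    character s (shift e) = character s e := by
  rcases Int.units_eq_one_or s with rfl | rfl
  · simp [character]
  · simp [character, shift, decomposeFin.symm_sign]

theorem character_inv (s : ℤˣ) {d : ℕ} (e : Equiv.Perm (Fin d)) :
    character s e⁻¹ = character s e := by
  rw [map_inv]
  exact Int.units_inv_eq_self _

end Equiv.Perm

open CategoryTheory MonoidalCategory Equiv.Perm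

namespace LocalNet

variable {H : Type*} [NormedAddCommGroup H] [InnerProductSpace ℂ H] [CompleteSpace H]
variable {N : LocalNet H}

/-- The action of a permutation on a power of an object. -/
def permute (ρ : N.Obj) {d : ℕ} (p : Equiv.Perm (Fin d)) : power ρ d ⟶ power ρ d := permHom ρ d p

theorem permute_mul (ρ : N.Obj) {d : ℕ} (p q : Equiv.Perm (Fin d)) :
    permute ρ (p * q) = permute ρ q ≫ permute ρ p := _root_.map_mul (permHom ρ d) p q

theorem permute_one (ρ : N.Obj) {d : ℕ} :
    permute ρ (1 : Equiv.Perm (Fin d)) = 𝟙 (power ρ d) := _root_.map_one (permHom ρ d)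

theorem permute_shift (ρ : N.Obj) {d : ℕ} (p : Equiv.Perm (Fin d)) :
    permute ρ (shift p) = ρ ◁ permute ρ p := permHom_shift ρ d p

theorem permute_swap_zero_one (ρ : N.Obj) (d : ℕ) :
    permute ρ (Equiv.swap (0 : Fin (d + 2)) 1) = exchange ρ (power ρ d) :=
  (permHom_swap ρ (d + 2) 0 (by omega)).trans (neighbour_zero ρ d)

theorem dag_permute (ρ : N.Obj) {d : ℕ} (p : Equiv.Perm (Fin d)) :
    dag (permute ρ p) = permute ρ p⁻¹ := dag_permHom ρ d p

theorem dag_sum {ρ σ : N.Obj} {ι : Type*} (s : Finset ι) (f : ι → (ρ ⟶ σ)) :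
    dag (∑ i ∈ s, f i) = ∑ i ∈ s, dag (f i) :=
  map_sum (AddMonoidHom.mk' (dag (ρ := ρ) (σ := σ)) dag_add) f s

/-- The projection on the part of a power of an object that transforms by a character of the
permutation group. -/
def isotypic (ρ : N.Obj) (s : ℤˣ) (d : ℕ) : power ρ d ⟶ power ρ d :=
  ((d.factorial : ℂ)⁻¹) • ∑ p : Equiv.Perm (Fin d), ((character s p : ℤ) : ℂ) • permute ρ p

theorem isotypic_zero (ρ : N.Obj) (s : ℤˣ) : isotypic ρ s 0 = 𝟙 _ := by
  rw [isotypic, Fintype.sum_unique, Subsingleton.elim (default : Equiv.Perm (Fin 0)) 1,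
    permute_one]
  simp

theorem isotypic_comp_permute (ρ : N.Obj) (s : ℤˣ) {d : ℕ} (q : Equiv.Perm (Fin d)) :
    isotypic ρ s d ≫ permute ρ q = ((character s q : ℤ) : ℂ) • isotypic ρ s d := by
  rw [isotypic, Linear.smul_comp, smul_comm, Preadditive.sum_comp]
  congr 1
  rw [Finset.smul_sum]
  refine Fintype.sum_equiv (Equiv.mulLeft q) _ _ fun p => ?_
  rw [Equiv.coe_mulLeft, permute_mul, Linear.smul_comp, smul_smul, map_mul]
  congr 1
  rcases Int.units_eq_one_or (character s q) with h | h <;> simp [h]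

theorem isotypic_comp_isotypic (ρ : N.Obj) (s : ℤˣ) (d : ℕ) :
    isotypic ρ s d ≫ isotypic ρ s d = isotypic ρ s d := by
  conv_lhs => rhs; rw [isotypic]
  rw [Linear.comp_smul, Preadditive.comp_sum]
  have h : ∀ p : Equiv.Perm (Fin d), isotypic ρ s d ≫ (((character s p : ℤ) : ℂ) • permute ρ p) =
      isotypic ρ s d := fun p => by
    rw [Linear.comp_smul, isotypic_comp_permute, smul_smul]
    rcases Int.units_eq_one_or (character s p) with h | h <;> simp [h]
  rw [Finset.sum_congr rfl fun p _ => h p, Finset.sum_const, Finset.card_univ, Fintype.card_perm,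
    Fintype.card_fin, ← Nat.cast_smul_eq_nsmul ℂ, smul_smul, inv_mul_cancel₀, one_smul]
  exact_mod_cast d.factorial_ne_zero

theorem dag_isotypic (ρ : N.Obj) (s : ℤˣ) (d : ℕ) : dag (isotypic ρ s d) = isotypic ρ s d := by
  rw [isotypic, dag_smul, dag_sum]
  congr 1
  · simp
  · refine Fintype.sum_equiv (Equiv.inv _) _ _ fun p => ?_
    rw [Equiv.inv_apply, dag_smul, dag_permute, character_inv]
    simp

namespace LeftInverse

variable {ρ : N.Obj} (Ψ : LeftInverse ρ)

theorem app_whiskerLeft_self {σ τ : N.Obj} (T : σ ⟶ τ) : Ψ.app (ρ ◁ T) = T := by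
  have h := Ψ.app_comp_whiskerLeft T (𝟙 _)
  rwa [Category.id_comp, app_id, Category.id_comp] at h

variable {c : ℂ} (hc : Ψ.app (β_ ρ ρ).hom = c • 𝟙 ρ)
include hc

/-- A permutation that moves the first element is the exchange of the first two factors between
shifted permutations. Ψ releases the latter and takes the exchange to c, and the two copies of `swap
0 j` cancel. -/
theorem app_permute {d : ℕ} (j : Fin d) (e : Equiv.Perm (Fin d)) :
    Ψ.app (σ := power ρ d) (τ := power ρ d) (permute ρ (Equiv.swap 0 j.succ * shift e)) =
      c • permute ρ e := by
  cases d with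
  | zero => exact j.elim0
  | succ d =>
    rw [swap_zero_succ, permute_mul, permute_mul, permute_mul, permute_shift, permute_shift,
      permute_swap_zero_one]
    have h1 := Ψ.app_whiskerLeft (permute ρ (Equiv.swap 0 j)) (permute ρ (Equiv.swap 0 j))
      (exchange ρ (power ρ d))
    have h3 : Ψ.app (σ := power ρ (d + 1)) (τ := power ρ (d + 1)) (exchange ρ (power ρ d)) =
      c • 𝟙 (power ρ (d + 1)) := Ψ.app_exchange hc (power ρ d)
    refine (Ψ.app_whiskerLeft_comp (permute ρ e) _).trans ?_
    refine (congrArg (permute ρ e ≫ ·) (h1.trans (congrArg (fun T => _ ≫ T ≫ _) h3))).trans ?_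
    have h2 : permute ρ (Equiv.swap 0 j) ≫ permute ρ (Equiv.swap 0 j) = 𝟙 _ := by
      rw [← permute_mul, Equiv.swap_mul_self, permute_one]
    rw [Linear.smul_comp, Linear.comp_smul, Category.id_comp, h2, Linear.comp_smul,
      Category.comp_id]

/-- Of the d + 1 cosets of the stabilizer of the first element, the stabilizer itself contributes 1
and each of the others s c. -/
theorem app_isotypic (s : ℤˣ) (d : ℕ) :
    Ψ.app (σ := power ρ d) (τ := power ρ d) (isotypic ρ s (d + 1)) =
      ((1 + d * ((s : ℤ) * c)) / (d + 1)) • isotypic ρ s d := by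
  have h0 : ∀ e : Equiv.Perm (Fin d), Ψ.app (σ := power ρ d) (τ := power ρ d)
      (permute ρ (shift e)) = permute ρ e := fun e => by
    rw [permute_shift]
    exact Ψ.app_whiskerLeft_self _
  have h1 : Ψ.app (σ := power ρ d) (τ := power ρ d) (isotypic ρ s (d + 1)) =
      (((d + 1).factorial : ℂ)⁻¹) • ∑ p : Equiv.Perm (Fin (d + 1)), ((character s p : ℤ) : ℂ) •
        Ψ.app (σ := power ρ d) (τ := power ρ d) (permute ρ p) := by
    rw [isotypic]
    refine (map_smul Ψ.app _ _).trans ?_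
    congr 1
    refine (map_sum Ψ.app _ _).trans ?_
    exact Finset.sum_congr rfl fun p _ => map_smul Ψ.app _ _
  have h2 : ∑ p : Equiv.Perm (Fin (d + 1)), ((character s p : ℤ) : ℂ) •
        Ψ.app (σ := power ρ d) (τ := power ρ d) (permute ρ p) =
      (1 + d * ((s : ℤ) * c)) • ∑ e : Equiv.Perm (Fin d), ((character s e : ℤ) : ℂ) • permute ρ e := by
    rw [← Equiv.sum_comp decomposeFin.symm, Fintype.sum_prod_type, Fin.sum_univ_succ, add_smul,
      one_smul]
    congr 1
    · refine Finset.sum_congr rfl fun e _ => ?_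
      rw [show decomposeFin.symm (0, e) = shift e from rfl, character_shift, h0]
    · have h3 : ∀ j : Fin d, ∑ e : Equiv.Perm (Fin d),
          ((character s (decomposeFin.symm (j.succ, e)) : ℤ) : ℂ) •
            Ψ.app (σ := power ρ d) (τ := power ρ d) (permute ρ (decomposeFin.symm (j.succ, e))) =
          ((s : ℤ) * c : ℂ) • ∑ e : Equiv.Perm (Fin d), ((character s e : ℤ) : ℂ) • permute ρ e := by
        intro j
        rw [Finset.smul_sum]
        refine Finset.sum_congr rfl fun e _ => ?_
        rw [decomposeFin_symm_eq, Ψ.app_permute hc, map_mul,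
          character_swap s (Fin.succ_ne_zero j).symm, character_shift, smul_smul, smul_smul]
        congr 1
        push_cast
        ring
      rw [Finset.sum_congr rfl fun j _ => h3 j, Finset.sum_const, Finset.card_univ,
        Fintype.card_fin, ← Nat.cast_smul_eq_nsmul ℂ, smul_smul]
  rw [h1, h2, isotypic, smul_smul, smul_smul]
  congr 1
  rw [Nat.factorial_succ, Nat.cast_mul, mul_inv]
  push_cast
  ring

end LeftInverse

theorem IsPermRep.antisymmetrizer_eq {ρ : N.Obj} {d : ℕ} {R : Equiv.Perm (Fin d) →
    Bimodule.Hom (Bimodule.pow ρ.toBimodule d) (Bimodule.pow ρ.toBimodule d)}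
    (h : IsPermRep ρ d R) : antisymmetrizer R = isotypic ρ (-1) d := by
  rw [h.eq_permHom]
  rfl

theorem IsPermRep.symmetrizer_eq {ρ : N.Obj} {d : ℕ} {R : Equiv.Perm (Fin d) →
    Bimodule.Hom (Bimodule.pow ρ.toBimodule d) (Bimodule.pow ρ.toBimodule d)}
    (h : IsPermRep ρ d R) : symmetrizer R = isotypic ρ 1 d := by
  have e : isotypic ρ 1 d = ((d.factorial : ℂ)⁻¹) • ∑ p : Equiv.Perm (Fin d), permute ρ p := by
    rw [isotypic]
    congr 1
    exact Finset.sum_congr rfl fun p _ => by simp [character]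
  rw [h.eq_permHom, e]
  rfl

end LocalNet
end

/-! ### Finite statistics implies faithfulness and a nonzero parameter -/

noncomputable section

open CategoryTheory MonoidalCategory

namespace LocalNet

variable {H : Type*} [NormedAddCommGroup H] [InnerProductSpace ℂ H] [CompleteSpace H]
variable {N : LocalNet H}

namespace LeftInverse

variable {ρ : N.Obj} (Ψ : LeftInverse ρ)

/-- The left inverse of the powers of an object. -/
def iterate : ∀ d : ℕ, LeftInverse (power ρ d)
  | 0 => unit
  | d + 1 => Ψ.tensor (iterate d)

/-- The value of the left inverse of a power on the projections `isotypic`. -/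
def weight (s : ℤˣ) (c : ℂ) (d : ℕ) : ℂ :=
  ∏ k ∈ Finset.range d, (1 + k * ((s : ℤ) * c)) / (k + 1)

section

variable {c : ℂ} (hc : Ψ.app (β_ ρ ρ).hom = c • 𝟙 ρ)
include hc

theorem iterate_app_braiding : ∀ d : ℕ,
    (Ψ.iterate d).app (β_ (power ρ d) (power ρ d)).hom = c ^ d • 𝟙 (power ρ d)
  | 0 => by
    rw [pow_zero, one_smul]
    exact unit_app_braiding
  | d + 1 => by
    rw [pow_succ']
    exact Ψ.tensor_app_braiding (Ψ.iterate d) hc (iterate_app_braiding d)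

theorem iterate_app_isotypic (s : ℤˣ) (σ : N.Obj) : ∀ d : ℕ,
    (Ψ.iterate d).app (isotypic ρ s d ▷ σ) = weight s c d • 𝟙 σ
  | 0 => by
    rw [isotypic_zero, id_whiskerRight, app_id, weight, Finset.prod_range_zero, one_smul]
  | d + 1 => by
    have h1 : (Ψ.iterate (d + 1)).app (isotypic ρ s (d + 1) ▷ σ) =
        (Ψ.iterate d).app (Ψ.app (σ := power ρ d) (τ := power ρ d) (isotypic ρ s (d + 1)) ▷ σ) :=
      congrArg (Ψ.iterate d).app (Ψ.app_whiskerRight (σ := power ρ d) (τ := power ρ d) σ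
        (isotypic ρ s (d + 1)))
    rw [h1, Ψ.app_isotypic hc, MonoidalLinear.smul_whiskerRight, map_smul, iterate_app_isotypic,
      smul_smul, weight, weight, Finset.prod_range_succ, mul_comm]

end

theorem app_tensorHom {σ τ : N.Obj} (E : ρ ⟶ ρ) (T : σ ⟶ τ) :
    Ψ.app (E ⊗ₘ T) = Ψ.app (E ▷ σ) ≫ T := by
  rw [MonoidalCategory.tensorHom_def, app_comp_whiskerLeft]

/-- Naturality carries the left factor E through the braiding to the second place, so both copies of
E act outside Ψ. -/
theorem app_tensorHom_comp_braiding {c : ℂ} (hc : Ψ.app (β_ ρ ρ).hom = c • 𝟙 ρ) (E : ρ ⟶ ρ) :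
    Ψ.app ((E ⊗ₘ E) ≫ (β_ ρ ρ).hom) = c • (E ≫ E) := by
  rw [tensorHom_def', Category.assoc, BraidedCategory.braiding_naturality_left,
    app_whiskerLeft, hc, Linear.smul_comp, Linear.comp_smul, Category.id_comp]

end LeftInverse

theorem IsSimple.braiding {γ : N.Obj} (h : IsSimple γ) :
    ∃ χ : ℂ, (χ = 1 ∨ χ = -1) ∧ (β_ γ γ).hom = χ • 𝟙 (γ ⊗ γ) := h

theorem tensorHom_dag_comp_braiding {ρ γ : N.Obj} {χ : ℂ} (hχ : (β_ γ γ).hom = χ • 𝟙 (γ ⊗ γ))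
    (V : γ ⟶ ρ) : ((dag V ≫ V) ⊗ₘ (dag V ≫ V)) ≫ (β_ ρ ρ).hom =
      χ • ((dag V ≫ V) ⊗ₘ (dag V ≫ V)) := by
  rw [← tensorHom_comp_tensorHom, Category.assoc, BraidedCategory.braiding_naturality,
    hχ, Linear.smul_comp, Linear.comp_smul, Category.id_comp]

theorem HasDeterminant.exists_isotypic {ρ : N.Obj} (h : HasDeterminant ρ) :
    ∃ (d : ℕ) (s : ℤˣ) (γ : N.Obj) (V : γ ⟶ power ρ d), 0 < d ∧
      Bimodule.IsFaithful γ.toBimodule ∧ IsSimple γ ∧ V ≫ dag V = 𝟙 γ ∧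
      dag V ≫ V = isotypic ρ s d := by
  obtain ⟨d, γ, V, R, hd, hγ, hγs, hV, hR, hE | hE⟩ := h
  · exact ⟨d, -1, γ, V, hd, hγ, hγs, hV, hE.trans hR.antisymmetrizer_eq⟩
  · exact ⟨d, 1, γ, V, hd, hγ, hγs, hV, hE.trans hR.symmetrizer_eq⟩

theorem id_ne_zero_of_isFaithful [Nontrivial H] {γ : N.Obj}
    (hγ : Bimodule.IsFaithful γ.toBimodule) : 𝟙 γ ≠ 0 := fun h => by
  have h1 : γ.hom 1 = γ.hom 0 := (congrArg Subtype.val h).trans (map_zero γ.hom).symm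
  exact one_ne_zero (hγ h1)

/-- The statistics parameter of an object with determinant does not vanish. -/
theorem HasDeterminant.parameter_ne_zero [Nontrivial H] {ρ : N.Obj} (h : HasDeterminant ρ)
    (Ψ : LeftInverse ρ) {c : ℂ} (hc : Ψ.app (β_ ρ ρ).hom = c • 𝟙 ρ) : c ≠ 0 := by
  rintro rfl
  obtain ⟨d, s, γ, V, hd, hγ, hγs, hV, hE⟩ := h.exists_isotypic
  obtain ⟨χ, hχ, hγχ⟩ := hγs.braiding
  have h1 := tensorHom_dag_comp_braiding hγχ V
  rw [hE] at h1
  -- The left side becomes c^d E = 0, because d > 0; the right side becomes χ times the weight times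
  -- E.
  have h2 := congrArg (Ψ.iterate d).app h1
  rw [(Ψ.iterate d).app_tensorHom_comp_braiding (Ψ.iterate_app_braiding hc d), map_smul,
    LeftInverse.app_tensorHom, Ψ.iterate_app_isotypic hc, zero_pow hd.ne', zero_smul,
    Linear.smul_comp, Category.id_comp, smul_smul] at h2
  -- At c = 0 the weight is 1/d!.
  have hw : LeftInverse.weight s 0 d ≠ 0 :=
    Finset.prod_ne_zero_iff.2 fun k _ => by
      rw [mul_zero, mul_zero, add_zero]
      exact div_ne_zero one_ne_zero (by exact_mod_cast k.succ_ne_zero)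
  have hχ0 : χ ≠ 0 := by rcases hχ with rfl | rfl <;> norm_num
  have h3 : isotypic ρ s d = 0 := (smul_eq_zero.1 h2.symm).resolve_left (mul_ne_zero hχ0 hw)
  refine id_ne_zero_of_isFaithful hγ ?_
  have h4 : V ≫ (dag V ≫ V) ≫ dag V = 𝟙 γ := by
    rw [Category.assoc, hV, Category.comp_id, hV]
  rw [← h4, hE, h3, Limits.zero_comp, Limits.comp_zero]

/-- The exponent is positive, since ρ^0 is the identity morphism and annihilates nothing. -/
theorem pow_hom_eq_zero {ρ : N.Obj} {A : N.globalAlg} (hA : ρ.hom A = 0) :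
    ∀ d : ℕ, (power ρ (d + 1)).hom A = 0
  | 0 => by
    ext1 i j
    exact congrFun (congrFun hA i.1) j.1
  | d + 1 => by
    ext1 i j
    have h : ρ.hom ((power ρ (d + 1)).hom A i.2 j.2) i.1 j.1 = 0 := by
      rw [pow_hom_eq_zero hA d]
      exact congrFun (congrFun (map_zero ρ.hom) i.1) j.1
    exact h

/-- As γ(A) = V⁺ ρ^d(A) V with d ≥ 1, the kernel of ρ is contained in the kernel of the faithful γ.
-/
theorem HasDeterminant.isFaithful {ρ : N.Obj} (h : HasDeterminant ρ) :
    Bimodule.IsFaithful ρ.toBimodule := by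
  obtain ⟨d, s, γ, V, hd, hγ, -, hV, -⟩ := h.exists_isotypic
  refine (injective_iff_map_eq_zero ρ.hom).2 fun A hA => ?_
  obtain ⟨d, rfl⟩ : ∃ k, d = k + 1 := ⟨d - 1, by omega⟩
  refine (injective_iff_map_eq_zero γ.hom).1 hγ A ?_
  have h1 : (Bimodule.adj V).1 * V.1 = γ.hom 1 := congrArg Subtype.val hV
  have h2 : V.1 * γ.hom A = (power ρ (d + 1)).hom A * V.1 := V.2.2.2 A
  rw [pow_hom_eq_zero hA, Matrix.zero_mul] at h2
  rw [← one_mul A, map_mul, ← h1, Matrix.mul_assoc, h2, Matrix.mul_zero]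

/-- One of the summands of an irreducible object with finite statistics is unitarily
equivalent to it. -/
theorem HasFiniteStatistics.exists_iso [Nontrivial H] {ρ : N.Obj}
    (hρ : Bimodule.IsIrreducible ρ.toBimodule) (h : HasFiniteStatistics ρ) :
    ∃ (τ : N.Obj) (u : τ ≅ ρ), dag u.hom = u.inv ∧ HasDeterminant τ := by
  obtain ⟨k, τ, W, hk, hτ, hW, -⟩ := h
  let i : Fin k := ⟨0, hk⟩
  let w : τ i ⟶ ρ := W i
  have hw : w ≫ dag w = 𝟙 (τ i) := hW i
  -- The range projection of the isometry is a scalar by irreducibility. The scalar is 1 because the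
  -- summand is faithful and hence nonzero, so the isometry is unitary.
  obtain ⟨c, hc⟩ : ∃ c : ℂ, dag w ≫ w = c • 𝟙 ρ := hρ (dag w ≫ w)
  have h1 : 𝟙 (τ i) ≠ 0 := by
    exact id_ne_zero_of_isFaithful (hτ i).2.isFaithful
  have h2 : w = c • w := by
    have : w ≫ dag w ≫ w = w := by rw [← Category.assoc, hw, Category.id_comp]
    rw [hc, Linear.comp_smul, Category.comp_id] at this
    exact this.symm
  have h3 : w ≠ 0 := fun h => h1 (by rw [← hw, h, Limits.zero_comp])
  have h4 : c = 1 := by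
    have h5 : (1 - c) • w = 0 := by rw [sub_smul, one_smul, ← h2, sub_self]
    exact (sub_eq_zero.1 ((smul_eq_zero.1 h5).resolve_right h3)).symm
  rw [h4, one_smul] at hc
  exact ⟨τ i, ⟨w, dag w, hw, hc⟩, rfl, (hτ i).2⟩

theorem isFaithful_of_iso {ρ τ : N.Obj} (u : τ ≅ ρ) (h : Bimodule.IsFaithful τ.toBimodule) :
    Bimodule.IsFaithful ρ.toBimodule := by
  refine (injective_iff_map_eq_zero ρ.hom).2 fun A hA => ?_
  refine (injective_iff_map_eq_zero τ.hom).1 h A ?_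
  have h1 : u.inv.1 * u.hom.1 = τ.hom 1 := congrArg Subtype.val u.hom_inv_id
  have h2 : u.hom.1 * τ.hom A = ρ.hom A * u.hom.1 := u.hom.2.2.2 A
  rw [hA, Matrix.zero_mul] at h2
  rw [← one_mul A, map_mul, ← h1, Matrix.mul_assoc, h2, Matrix.mul_zero]

theorem HasFiniteStatistics.faithful_and_parameter_ne_zero [Nontrivial H] {ρ : N.Obj}
    (hρ : Bimodule.IsIrreducible ρ.toBimodule) (h : HasFiniteStatistics ρ) :
    Bimodule.IsFaithful ρ.toBimodule ∧ ∀ Ψ : LeftInverse ρ, ∃ c : ℂ, c ≠ 0 ∧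
      Ψ.map ρ ρ (symmetry ρ ρ) = c • Bimodule.one ρ.toBimodule := by
  obtain ⟨τ, u, hu, hτ⟩ := h.exists_iso hρ
  refine ⟨isFaithful_of_iso u hτ.isFaithful, fun Ψ => ?_⟩
  obtain ⟨c, hc⟩ := hρ (Ψ.map ρ ρ (symmetry ρ ρ))
  exact ⟨c, hτ.parameter_ne_zero (Ψ.ofUnitary u hu) (Ψ.ofUnitary_app_braiding u hu hc), hc⟩

end LocalNet
end

/-! ### Subobjects, and faithfulness of left inverses -/

noncomputable section

namespace Bimodule

variable {A : Type*} [Ring A] [StarRing A] [Algebra ℂ A]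

/-- The subobject given by a projection. -/
def restrict (P : Bimodule A) (E : Hom P P) (hE : comp E E = E) (hE' : adj E = E) :
    Bimodule A where
  ι := P.ι
  hom :=
    { toFun := fun a => E.1 * P.hom a
      map_smul' := fun c a => by rw [map_smul, Matrix.mul_smul]; rfl
      map_zero' := by rw [map_zero, Matrix.mul_zero]
      map_add' := fun a b => by rw [map_add, Matrix.mul_add]
      map_mul' := fun a b => by
        have h : E.1 * E.1 = E.1 := congrArg Subtype.val hE
        rw [Matrix.mul_assoc E.1 (P.hom a), ← Matrix.mul_assoc (P.hom a) E.1, ← E.2.2.2 a,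
          Matrix.mul_assoc E.1 (P.hom a), ← Matrix.mul_assoc E.1 E.1, h, map_mul]
      map_star' := fun a => by
        have h : E.1ᴴ = E.1 := congrArg Subtype.val hE'
        rw [map_star, Matrix.star_eq_conjTranspose, Matrix.star_eq_conjTranspose,
          Matrix.conjTranspose_mul, h, ← Matrix.star_eq_conjTranspose, ← map_star, E.2.2.2] }

variable {P : Bimodule A} {E : Hom P P} (hE : comp E E = E) (hE' : adj E = E)

/-- The isometry of a subobject. -/
def inclusion : Hom (restrict P E hE hE') P :=
  have h : E.1 * E.1 = E.1 := congrArg Subtype.val hE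
  ⟨E.1, by
    show E.1 * (E.1 * P.hom 1) = E.1
    rw [E.2.1, h], E.2.2.1, fun a => by
    show E.1 * (E.1 * P.hom a) = P.hom a * E.1
    rw [← Matrix.mul_assoc, h, E.2.2.2]⟩

theorem adj_inclusion_comp : comp (adj (inclusion hE hE')) (inclusion hE hE') = one _ := by
  refine Subtype.ext ?_
  have h : E.1 * E.1 = E.1 := congrArg Subtype.val hE
  have h' : E.1ᴴ = E.1 := congrArg Subtype.val hE'
  show E.1ᴴ * E.1 = E.1 * P.hom 1
  rw [h', h, E.2.1]

theorem inclusion_comp_adj : comp (inclusion hE hE') (adj (inclusion hE hE')) = E := by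
  refine Subtype.ext ?_
  have h : E.1 * E.1 = E.1 := congrArg Subtype.val hE
  have h' : E.1ᴴ = E.1 := congrArg Subtype.val hE'
  show E.1 * E.1ᴴ = E.1
  rw [h', h]

section Conjugate

variable {P' : Bimodule A} {U : Hom P P'} (hU : IsUnitary U)
include hU hE

theorem conjugate_comp : comp (comp U (comp E (adj U))) (comp U (comp E (adj U))) =
    comp U (comp E (adj U)) := by
  rw [comp_assoc, comp_assoc, ← comp_assoc (adj U) U, hU.1, one_comp, ← comp_assoc E E, hE]

end Conjugate

include hE' in
theorem adj_conjugate {P' : Bimodule A} (U : Hom P P') :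
    adj (comp U (comp E (adj U))) = comp U (comp E (adj U)) := by
  rw [adj_comp, adj_comp, adj_adj, hE', comp_assoc]

/-- U restricts to a unitary between the ranges of E and U E U⁺, so a transport of P induces a
transport of its subobject. -/
theorem isUnitary_conjugate {P' : Bimodule A} {U : Hom P P'} (hU : IsUnitary U) :
    IsUnitary (comp (adj (inclusion (conjugate_comp hE hU) (adj_conjugate hE' U)))
      (comp U (inclusion hE hE'))) := by
  have h1 := inclusion_comp_adj hE hE'
  have h2 := inclusion_comp_adj (conjugate_comp hE hU) (adj_conjugate hE' U)
  have h3 := adj_inclusion_comp hE hE'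
  have h4 := adj_inclusion_comp (conjugate_comp hE hU) (adj_conjugate hE' U)
  generalize inclusion hE hE' = V at *
  generalize inclusion (conjugate_comp hE hU) (adj_conjugate hE' U) = V' at *
  have h5 : comp (adj U) (comp (comp V' (adj V')) U) = comp V (adj V) := by
    rw [h1, h2]
    simp only [comp_assoc]
    rw [hU.1, comp_one, ← comp_assoc, hU.1, one_comp]
  have h6 : comp U (comp (comp V (adj V)) (adj U)) = comp V' (adj V') := by
    rw [h1]
    exact h2.symm
  constructor
  · calc _ = comp (adj V) (comp (comp (adj U) (comp (comp V' (adj V')) U)) V) := by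
          simp only [adj_comp, adj_adj, comp_assoc]
      _ = comp (comp (adj V) V) (comp (adj V) V) := by rw [h5]; simp only [comp_assoc]
      _ = _ := by rw [h3, one_comp]
  · calc _ = comp (adj V') (comp (comp U (comp (comp V (adj V)) (adj U))) V') := by
          simp only [adj_comp, adj_adj, comp_assoc]
      _ = comp (comp (adj V') V') (comp (adj V') V') := by
          rw [h6]; simp only [comp_assoc]
      _ = _ := by rw [h4, one_comp]

end Bimodule

open CategoryTheory MonoidalCategory

namespace LocalNet

variable {H : Type*} [NormedAddCommGroup H] [InnerProductSpace ℂ H] [CompleteSpace H]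
variable {N : LocalNet H}

theorem restrict_localized {P : Bimodule N.globalAlg} {o : DoubleCone}
    (h : IsLocalizedIn (toMor P) o) {E : Bimodule.Hom P P} (hE : Bimodule.comp E E = E)
    (hE' : Bimodule.adj E = E) : IsLocalizedIn (toMor (P.restrict E hE hE')) o := by
  intro a ha A hA i j
  have h1 : (P.hom A * E.1) i j = A * E.1 i j := by
    have h2 : ∑ k, P.hom 1 i k * E.1 k j = E.1 i j :=
      (Matrix.mul_apply (M := P.hom 1) (N := E.1)).symm.trans (congrFun (congrFun E.2.2.1 i) j)
    refine (Matrix.mul_apply (M := P.hom A) (N := E.1)).trans ?_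
    refine Eq.trans ?_ ((Finset.mul_sum _ _ A).symm.trans (congrArg (A * ·) h2))
    refine Finset.sum_congr rfl fun k _ => ?_
    exact (congrArg (· * E.1 k j) (hom_mem h ha A hA i k)).trans (mul_assoc _ _ _)
  have h3 : (P.restrict E hE hE').hom A i j = A * (P.restrict E hE hE').hom 1 i j := by
    show (E.1 * P.hom A) i j = A * (E.1 * P.hom 1) i j
    rw [E.2.2.2, h1, E.2.1]
  exact congrArg Subtype.val h3

/-- The subobject given by a projection. -/
def Obj.restrict (P : N.Obj) (E : Bimodule.Hom P.toBimodule P.toBimodule)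
    (hE : Bimodule.comp E E = E) (hE' : Bimodule.adj E = E) : N.Obj where
  toBimodule := P.toBimodule.restrict E hE hE'
  localized := by
    obtain ⟨o, ho⟩ := P.localized
    exact ⟨o, restrict_localized ho hE hE'⟩
  transportable := fun o => by
    obtain ⟨P', U, hP', hU⟩ := P.transport o
    have hW := Bimodule.isUnitary_conjugate hE hE' hU
    refine ⟨_, _, toMor (P'.toBimodule.restrict _ (Bimodule.conjugate_comp hE hU)
      (Bimodule.adj_conjugate hE' U)), ops _, restrict_localized hP' _ _,
      isIntertwiner_ops (Bimodule.comp (Bimodule.adj (Bimodule.inclusion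
        (Bimodule.conjugate_comp hE hU) (Bimodule.adj_conjugate hE' U)))
        (Bimodule.comp U (Bimodule.inclusion hE hE'))), ?_, ?_⟩
    · rw [← ops_conjTranspose, ← ops_mul]
      exact congrArg (fun x => ops x.1) hW.1
    · rw [← ops_conjTranspose, ← ops_mul]
      exact congrArg (fun x => ops x.1) hW.2

open scoped InnerProductSpace

theorem inner_comp_dag {ρ σ : N.Obj} (X : ρ ⟶ σ) (j : ρ.ι) (ξ : H) :
    ⟪ξ, ((X ≫ dag X).1 j j : H →L[ℂ] H) ξ⟫_ℂ =
      ((∑ i, ‖(X.1 i j : H →L[ℂ] H) ξ‖ ^ 2 : ℝ) : ℂ) := by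
  have h : ((X ≫ dag X).1 j j : H →L[ℂ] H) =
      ∑ i, (X.1 i j : H →L[ℂ] H).adjoint * (X.1 i j : H →L[ℂ] H) := by
    show ((X.1ᴴ * X.1) j j : N.globalAlg).1 = _
    rw [Matrix.mul_apply, AddSubmonoidClass.coe_finsetSum]
    rfl
  rw [h, sum_apply, inner_sum, Complex.ofReal_sum]
  refine Finset.sum_congr rfl fun i _ => ?_
  rw [mul_apply_eq_comp, ContinuousLinearMap.adjoint_inner_right, inner_self_eq_norm_sq_to_K]
  simp

/-- Vector expectations of the diagonal entries are sums of the squared norms of the columns of Y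
and X applied to the vector, so each of these norms vanishes. -/
theorem eq_zero_of_add_eq_zero {ρ σ τ : N.Obj} (Y : ρ ⟶ σ) (X : ρ ⟶ τ)
    (h : Y ≫ dag Y + X ≫ dag X = 0) : X = 0 := by
  refine Subtype.ext (Matrix.ext fun i j => Subtype.ext (ContinuousLinearMap.ext fun ξ => ?_))
  have h1 : ((Y ≫ dag Y).1 j j : H →L[ℂ] H) + ((X ≫ dag X).1 j j : H →L[ℂ] H) = 0 :=
    congrArg (fun T : Bimodule.Hom ρ.toBimodule ρ.toBimodule => (T.1 j j : H →L[ℂ] H)) h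
  have h2 := congrArg (fun T => ⟪ξ, T ξ⟫_ℂ) h1
  simp only [add_apply, inner_add_right, inner_comp_dag, zero_apply, inner_zero_right] at h2
  have h3 : ∑ i, ‖(Y.1 i j : H →L[ℂ] H) ξ‖ ^ 2 + ∑ i, ‖(X.1 i j : H →L[ℂ] H) ξ‖ ^ 2 = 0 := by
    exact_mod_cast h2
  have h4 : ∑ i, ‖(X.1 i j : H →L[ℂ] H) ξ‖ ^ 2 = 0 := by
    have a := Finset.sum_nonneg fun i (_ : i ∈ Finset.univ) =>
      sq_nonneg ‖(Y.1 i j : H →L[ℂ] H) ξ‖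
    have b := Finset.sum_nonneg fun i (_ : i ∈ Finset.univ) =>
      sq_nonneg ‖(X.1 i j : H →L[ℂ] H) ξ‖
    linarith
  have h5 := (Finset.sum_eq_zero_iff_of_nonneg fun i _ => sq_nonneg _).1 h4 i (Finset.mem_univ i)
  exact norm_eq_zero.1 (pow_eq_zero_iff two_ne_zero |>.1 h5)

open scoped ComplexOrder in
theorem nonneg_of_smul_id_eq [Nontrivial H] {c : ℂ} {Y : 𝟙_ N.Obj ⟶ 𝟙_ N.Obj}
    (h : c • 𝟙 (𝟙_ N.Obj) = Y ≫ dag Y) : 0 ≤ c := by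
  obtain ⟨ξ, hξ⟩ := exists_norm_eq H zero_le_one
  have h1 : c • (1 : H →L[ℂ] H) = ((Y ≫ dag Y).1 () () : H →L[ℂ] H) :=
    congrArg (fun T : Bimodule.Hom (Bimodule.unit N.globalAlg) (Bimodule.unit N.globalAlg) =>
      (T.1 () () : H →L[ℂ] H)) h
  have h2 := congrArg (fun T => ⟪ξ, T ξ⟫_ℂ) h1
  simp only [smul_apply, one_apply_eq_self, inner_smul_right] at h2
  rw [inner_self_eq_norm_sq_to_K, hξ] at h2
  replace h2 := h2.trans (inner_comp_dag Y () ξ)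
  have h3 : c = ((∑ i, ‖(Y.1 i () : H →L[ℂ] H) ξ‖ ^ 2 : ℝ) : ℂ) := by simpa using h2
  rw [h3, Complex.zero_le_real]
  exact Finset.sum_nonneg fun i _ => sq_nonneg _

namespace LeftInverse

variable {ρ : N.Obj} (Ψ : LeftInverse ρ)

/-- A left inverse is faithful if the parameter does not vanish. -/
theorem eq_zero_of_app_eq_zero {r : ℝ} (hr : r ≠ 0)
    (hc : Ψ.app (β_ ρ ρ).hom = (r : ℂ) • 𝟙 ρ) {σ : N.Obj} (X : ρ ⊗ σ ⟶ ρ ⊗ σ)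
    (hX : Ψ.app (X ≫ dag X) = 0) : X = 0 := by
  -- In T⁺T the term with two exchanges goes to 1 × Ψ(X⁺X) = 0, the two mixed terms to -2 r² X⁺X and
  -- the last one to r² X⁺X. Thus Ψ(T⁺T) = -r² X⁺X, and positivity forces X = 0.
  let T := exchange ρ σ ≫ ρ ◁ X - (r : ℂ) • ρ ◁ X
  have hT : dag T = ρ ◁ dag X ≫ exchange ρ σ - (r : ℂ) • ρ ◁ dag X := by
    simp only [T]
    rw [sub_eq_add_neg, ← neg_one_smul ℂ, dag_add, dag_smul, dag_smul, dag_comp, dag_exchange,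
      dag_whiskerLeft, Complex.conj_ofReal]
    simp [sub_eq_add_neg]
  have hTT : T ≫ dag T = exchange ρ σ ≫ ρ ◁ (X ≫ dag X) ≫ exchange ρ σ -
      (r : ℂ) • (exchange ρ σ ≫ ρ ◁ (X ≫ dag X)) -
      (r : ℂ) • (ρ ◁ (X ≫ dag X) ≫ exchange ρ σ) + ((r : ℂ) * r) • ρ ◁ (X ≫ dag X) := by
    rw [hT]
    simp only [T, Preadditive.sub_comp, Preadditive.comp_sub, Linear.smul_comp, Linear.comp_smul,
      whiskerLeft_comp, Category.assoc, smul_smul, smul_sub]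
    abel
  obtain ⟨Y, hY⟩ := Ψ.app_positive T
  refine (smul_eq_zero.1 (eq_zero_of_add_eq_zero Y ((r : ℂ) • X) ?_)).resolve_left
    (Complex.ofReal_ne_zero.2 hr)
  rw [← hY, hTT, map_add, map_sub, map_sub, map_smul, map_smul, map_smul, app_exchange_conj,
    app_comp_whiskerLeft, app_whiskerLeft_comp, app_exchange _ hc, app_whiskerLeft_self, hX,
    dag_smul, Complex.conj_ofReal]
  simp only [Linear.smul_comp, Linear.comp_smul, Category.id_comp, Category.comp_id, smul_smul,
    MonoidalPreadditive.whiskerLeft_zero]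
  abel

open scoped ComplexOrder in
-- The weight is the value of a positive map on the projection E_d tensored with the unit object.
theorem weight_nonneg [Nontrivial H] {c : ℂ} (hc : Ψ.app (β_ ρ ρ).hom = c • 𝟙 ρ) (s : ℤˣ)
    (d : ℕ) : 0 ≤ weight s c d := by
  have h1 : isotypic ρ s d ▷ 𝟙_ N.Obj = (isotypic ρ s d ▷ 𝟙_ N.Obj) ≫
      dag (isotypic ρ s d ▷ 𝟙_ N.Obj) := by
    rw [dag_whiskerRight, dag_isotypic, ← comp_whiskerRight, isotypic_comp_isotypic]
  obtain ⟨Y, hY⟩ := (Ψ.iterate d).app_positive (isotypic ρ s d ▷ 𝟙_ N.Obj)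
  rw [← h1, Ψ.iterate_app_isotypic hc] at hY
  exact nonneg_of_smul_id_eq hY

end LeftInverse

end LocalNet
end

/-! ### Quantization of the parameter and construction of the determinant -/

noncomputable section

open CategoryTheory MonoidalCategory

/-- At the first n with n y ≥ 1 all earlier factors are positive, so the product with one further
factor can be nonnegative only if 1 - n y = 0. -/
theorem exists_nat_mul_eq_one {y : ℝ} (hy : 0 < y)
    (h : ∀ n : ℕ, 0 ≤ ∏ k ∈ Finset.range n, (1 - k * y) / (k + 1)) :
    ∃ d : ℕ, 0 < d ∧ d * y = 1 := by
  classical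
  obtain ⟨m, hm⟩ := Archimedean.arch 1 hy
  have hex : ∃ n : ℕ, 1 ≤ n * y := ⟨m, by simpa using hm⟩
  let n := Nat.find hex
  have hn : 1 ≤ n * y := Nat.find_spec hex
  have hlt : ∀ k < n, k * y < 1 := fun k hk => not_le.1 (Nat.find_min hex hk)
  refine ⟨n, Nat.pos_of_ne_zero fun h0 => ?_, ?_⟩
  · rw [h0, Nat.cast_zero, zero_mul] at hn
    linarith
  · by_contra hne
    have hn' : 1 < n * y := lt_of_le_of_ne hn (Ne.symm hne)
    have hpos : 0 < ∏ k ∈ Finset.range n, (1 - k * y) / ((k : ℝ) + 1) :=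
      Finset.prod_pos fun k hk => div_pos (by linarith [hlt k (Finset.mem_range.1 hk)])
        (by positivity)
    have h1 := h (n + 1)
    rw [Finset.prod_range_succ] at h1
    have h2 : (1 - n * y) / ((n : ℝ) + 1) < 0 := div_neg_of_neg_of_pos (by linarith) (by positivity)
    nlinarith

namespace LocalNet

variable {H : Type*} [NormedAddCommGroup H] [InnerProductSpace ℂ H] [CompleteSpace H]
variable {N : LocalNet H}

namespace LeftInverse

theorem weight_ofReal (s : ℤˣ) (r : ℝ) (d : ℕ) : weight s r d =
    ((∏ k ∈ Finset.range d, (1 + k * ((s : ℤ) * r)) / (k + 1) : ℝ) : ℂ) := by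
  rw [weight]
  push_cast
  rfl

open scoped ComplexOrder in
/-- The parameter of a left inverse is zero or, up to the sign, the inverse of an integer. -/
theorem exists_parameter_eq [Nontrivial H] {ρ : N.Obj} (Ψ : LeftInverse ρ) {c : ℂ}
    (hc : Ψ.app (β_ ρ ρ).hom = c • 𝟙 ρ) (hc0 : c ≠ 0) :
    ∃ (d : ℕ) (s : ℤˣ), 0 < d ∧ c = -((s : ℤ) : ℂ) / d := by
  obtain ⟨r, rfl⟩ : ∃ r : ℝ, c = r := by
    -- The weight of the symmetrizer of two factors is (1 + c)/2. Its being real makes c real.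
    have h := (Complex.nonneg_iff.1 (Ψ.weight_nonneg hc 1 2)).2
    rw [weight, Finset.prod_range_succ, Finset.prod_range_one] at h
    refine ⟨c.re, Complex.ext rfl ?_⟩
    rw [Complex.ofReal_im]
    have e : ((1 + (0 : ℕ) * (((1 : ℤˣ) : ℤ) * c)) / ((0 : ℕ) + 1) *
        ((1 + (1 : ℕ) * (((1 : ℤˣ) : ℤ) * c)) / ((1 : ℕ) + 1)) : ℂ) =
        ((1 / 2 : ℝ) : ℂ) * (1 + c) := by
      push_cast; ring
    rw [e, Complex.im_ofReal_mul, Complex.add_im, Complex.one_im] at h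
    linarith
  have hr0 : r ≠ 0 := fun h => hc0 (by rw [h, Complex.ofReal_zero])
  -- With this sign the numerators 1 + k s r eventually become negative unless one of them is
  -- exactly zero.
  obtain ⟨s, hs⟩ : ∃ s : ℤˣ, ((s : ℤ) : ℝ) * r < 0 := by
    rcases lt_or_gt_of_ne hr0 with h | h
    · exact ⟨1, by simpa using h⟩
    · exact ⟨-1, by simpa using h⟩
  obtain ⟨d, hd, hdr⟩ := exists_nat_mul_eq_one (y := -(((s : ℤ) : ℝ) * r)) (by linarith) fun n => by
    have h := Ψ.weight_nonneg hc s n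
    rw [weight_ofReal, Complex.zero_le_real] at h
    refine h.trans_eq (Finset.prod_congr rfl fun k _ => ?_)
    ring
  refine ⟨d, s, hd, ?_⟩
  have hd' : (d : ℝ) ≠ 0 := by positivity
  have h1 : r = -((s : ℤ) : ℝ) / d := by
    rw [eq_div_iff hd']
    rcases Int.units_eq_one_or s with rfl | rfl <;> simp at hdr ⊢ <;> linarith
  rw [h1]
  push_cast
  rfl

/-- The factors are (d - k)/(d (k + 1)), and both (d - k) and (k + 1) multiply up to d!. The result
has the modulus of c^d, the value taken on the braiding. -/
theorem weight_parameter (s : ℤˣ) {d : ℕ} (hd : 0 < d) :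
    weight s (-((s : ℤ) : ℂ) / d) d = ((d : ℂ)⁻¹) ^ d := by
  have hs : ((s : ℤ) : ℂ) * (s : ℤ) = 1 := by
    rcases Int.units_eq_one_or s with rfl | rfl <;> simp
  have hd' : (d : ℂ) ≠ 0 := by exact_mod_cast hd.ne'
  have h1 : ∀ k ∈ Finset.range d, (1 + k * (((s : ℤ) : ℂ) * (-((s : ℤ) : ℂ) / d))) / (k + 1) =
      (d : ℂ)⁻¹ * (((d - 1 - k : ℕ) : ℂ) + 1) / ((k : ℂ) + 1) := by
    intro k hk
    have hk' := Finset.mem_range.1 hk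
    have e : (((d - 1 - k : ℕ) : ℂ) + 1) = d - k := by
      rw [Nat.sub_sub, Nat.cast_sub (by omega)]
      push_cast; ring
    rw [e]
    congr 1
    field_simp
    linear_combination (-(k : ℂ)) * hs
  rw [weight, Finset.prod_congr rfl h1, Finset.prod_div_distrib, Finset.prod_mul_distrib,
    Finset.prod_const, Finset.card_range,
    Finset.prod_range_reflect (fun k : ℕ => (k : ℂ) + 1) d, mul_div_assoc, div_self, mul_one]
  exact Finset.prod_ne_zero_iff.2 fun k _ => by exact_mod_cast k.succ_ne_zero

variable {ρ : N.Obj} (Ψ : LeftInverse ρ)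

/-- On the range of `isotypic` the braiding is a scalar for the critical power. -/
theorem isotypic_comp_braiding {d : ℕ} (hd : 0 < d) {s : ℤˣ}
    (hc : Ψ.app (β_ ρ ρ).hom = (-((s : ℤ) : ℂ) / d) • 𝟙 ρ) :
    ∃ χ : ℂ, (χ = 1 ∨ χ = -1) ∧ (isotypic ρ s d ⊗ₘ isotypic ρ s d) ≫
      (β_ (power ρ d) (power ρ d)).hom = χ • (isotypic ρ s d ⊗ₘ isotypic ρ s d) := by
  -- Here t is the sign of the parameter t/d, so the sign of c^d, and thus the sign χ of γ, is t^d.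
  let t : ℝ := -((s : ℤ) : ℝ)
  have ht : t = 1 ∨ t = -1 := by
    rcases Int.units_eq_one_or s with rfl | rfl <;> simp [t]
  have htt : t * t = 1 := by rcases ht with h | h <;> rw [h] <;> norm_num
  have hχχ : (((t ^ d : ℝ) : ℂ)) * ((t ^ d : ℝ) : ℂ) = 1 := by
    rw [← Complex.ofReal_mul, ← mul_pow, htt, one_pow, Complex.ofReal_one]
  have hχ : t ^ d = 1 ∨ t ^ d = -1 := mul_self_eq_one_iff.1 (by exact_mod_cast hχχ)
  have hpow : (-((s : ℤ) : ℂ) / d) ^ d = ((t ^ d * ((d : ℝ)⁻¹) ^ d : ℝ) : ℂ) := by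
    rw [div_eq_mul_inv, mul_pow]
    push_cast [t]
    rfl
  have hb := Ψ.iterate_app_braiding hc d
  rw [hpow] at hb
  have hne : t ^ d * ((d : ℝ)⁻¹) ^ d ≠ 0 := by
    refine mul_ne_zero (fun h => ?_) (by positivity)
    rw [h] at hχ
    norm_num at hχ
  generalize hχt : t ^ d = χ at *
  set P := power ρ d
  set E := isotypic ρ s d
  have hEE : E ≫ E = E := isotypic_comp_isotypic ρ s d
  have hEd : dag E = E := dag_isotypic ρ s d
  set p := E ⊗ₘ E
  have hpp : p ≫ p = p := by rw [tensorHom_comp_tensorHom, hEE]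
  have hpd : dag p = p := by rw [dag_tensorHom, hEd]
  set b := (β_ P P).hom
  have hpb : p ≫ b = b ≫ p := BraidedCategory.braiding_naturality E E
  have hbb : b ≫ b = 𝟙 _ := SymmetricCategory.symmetry P P
  have hbd : dag b = b := dag_braiding P P
  refine ⟨(χ : ℂ), by rcases hχ with h | h <;> simp [h], ?_⟩
  -- As p and b commute and χ² = 1, this element is twice a projection, so X⁺X is twice X. The
  -- iterated left inverse gives (d⁻ᵈ - χ c^d) E = 0 on it, and faithfulness applies.
  have hX : p - (χ : ℂ) • (p ≫ b) = 0 := by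
    refine (Ψ.iterate d).eq_zero_of_app_eq_zero hne hb _ ?_
    have hd1 : dag (p - (χ : ℂ) • (p ≫ b)) = p - (χ : ℂ) • (p ≫ b) := by
      rw [sub_eq_add_neg, ← neg_one_smul ℂ, dag_add, dag_smul, dag_smul, dag_comp, hpd, hbd,
        Complex.conj_ofReal, ← hpb]
      simp
    have h1 : p ≫ p ≫ b = p ≫ b := by rw [← Category.assoc, hpp]
    have h2 : (p ≫ b) ≫ p = p ≫ b := by rw [Category.assoc, ← hpb, h1]
    have h3 : (p ≫ b) ≫ p ≫ b = p := by
      rw [← Category.assoc, h2, Category.assoc, hbb, Category.comp_id]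
    have h4 : (p - (χ : ℂ) • (p ≫ b)) ≫ dag (p - (χ : ℂ) • (p ≫ b)) =
        (2 : ℂ) • (p - (χ : ℂ) • (p ≫ b)) := by
      rw [hd1, two_smul]
      simp only [Preadditive.sub_comp, Preadditive.comp_sub, Linear.smul_comp, Linear.comp_smul,
        smul_sub, smul_smul, hpp, h1, h2, h3, hχχ, one_smul]
      abel
    rw [h4, map_smul, map_sub, map_smul]
    have h5 : (Ψ.iterate d).app (p ≫ b) = _ := (Ψ.iterate d).app_tensorHom_comp_braiding hb E
    have h6 : (Ψ.iterate d).app p = _ := (Ψ.iterate d).app_tensorHom E E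
    rw [h5, h6, Ψ.iterate_app_isotypic hc, weight_parameter s hd, hEE, Linear.smul_comp,
      Category.id_comp, smul_smul]
    have h7 : (χ : ℂ) * ((χ * ((d : ℝ)⁻¹) ^ d : ℝ) : ℂ) = ((d : ℂ)⁻¹) ^ d := by
      push_cast
      rw [← mul_assoc, hχχ, one_mul]
    rw [h7, sub_self, smul_zero]
  have h8 := sub_eq_zero.1 hX
  conv_rhs => rw [h8]
  rw [smul_smul, hχχ, one_smul]

end LeftInverse

/-- Each application of the slice lowers the power by one and multiplies E_d ρ^d(A) by a nonzero
number. At the power zero only A is left. -/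
theorem mul_hom_eq_zero_imp {ρ : N.Obj} (Λ : Slice ρ.toBimodule) {c : ℂ}
    (hc : Λ.leftInverse.app (β_ ρ ρ).hom = c • 𝟙 ρ) (s : ℤˣ) (A : N.globalAlg) :
    ∀ d : ℕ, (∀ k < d, 1 + k * ((s : ℤ) * c) ≠ 0) →
      (isotypic ρ s d).1 * (power ρ d).hom A = 0 → A = 0
  | 0, _, h => by
    rw [isotypic_zero] at h
    have h1 : (Bimodule.one (Bimodule.unit N.globalAlg)).1 * (Bimodule.unit N.globalAlg).hom A =
      0 := h
    have h2 : (Bimodule.unit N.globalAlg).hom (1 * A) = 0 := (map_mul _ _ _).trans h1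
    rw [one_mul] at h2
    exact congrFun (congrFun h2 ()) ()
  | d + 1, hk, h => by
    have h1 := Λ.leftInverse_mul_eq_zero (σ := power ρ d) (τ := power ρ d)
      (isotypic ρ s (d + 1)) A h
    have h2 : Λ.leftInverse.map (power ρ d) (power ρ d) (isotypic ρ s (d + 1)) = _ :=
      Λ.leftInverse.app_isotypic hc s d
    rw [h2] at h1
    have h3 : ((1 + d * ((s : ℤ) * c)) / (d + 1) : ℂ) •
        ((isotypic ρ s d).1 * (power ρ d).hom A) = 0 := (Matrix.smul_mul _ _ _).symm.trans h1
    refine mul_hom_eq_zero_imp Λ hc s A d (fun k hkd => hk k (by omega)) ?_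
    exact (smul_eq_zero.1 h3).resolve_left (div_ne_zero (hk d (by omega))
      (by exact_mod_cast d.succ_ne_zero))

theorem exists_hasDeterminant [Nontrivial H] {ρ : N.Obj} (Λ : Slice ρ.toBimodule) {c : ℂ}
    (hc : Λ.leftInverse.app (β_ ρ ρ).hom = c • 𝟙 ρ) (hc0 : c ≠ 0) : HasDeterminant ρ := by
  obtain ⟨d, s, hd, rfl⟩ := Λ.leftInverse.exists_parameter_eq hc hc0
  obtain ⟨χ, hχ, hb⟩ := Λ.leftInverse.isotypic_comp_braiding hd hc
  have hE : Bimodule.comp (isotypic ρ s d) (isotypic ρ s d) = isotypic ρ s d :=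
    isotypic_comp_isotypic ρ s d
  have hE' : Bimodule.adj (isotypic ρ s d) = isotypic ρ s d := dag_isotypic ρ s d
  let γ : N.Obj := (power ρ d).restrict (isotypic ρ s d) hE hE'
  let V : γ ⟶ power ρ d := Bimodule.inclusion hE hE'
  have hV : V ≫ dag V = 𝟙 γ := Bimodule.adj_inclusion_comp hE hE'
  have hVE : dag V ≫ V = isotypic ρ s d := Bimodule.inclusion_comp_adj hE hE'
  refine ⟨d, γ, V, permHom ρ d, hd, ?_, ⟨χ, hχ, ?_⟩, hV, isPermRep_permHom ρ d, ?_⟩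
  · refine (injective_iff_map_eq_zero γ.hom).2 fun A hA => ?_
    -- The numerators are 1 - k/d, which vanish only for k = d; the factors met on the way down have
    -- k < d.
    refine mul_hom_eq_zero_imp Λ hc s A d (fun k hk h0 => ?_) hA
    have hd' : (d : ℂ) ≠ 0 := by exact_mod_cast hd.ne'
    have hs : ((s : ℤ) : ℂ) * (s : ℤ) = 1 := by
      rcases Int.units_eq_one_or s with rfl | rfl <;> simp
    have h1 : (d : ℂ) = k := by
      field_simp at h0
      linear_combination h0 + (k : ℂ) * hs
    have h2 : d = k := by exact_mod_cast h1
    omega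
  · have h1 : (V ⊗ₘ V) ≫ (dag V ⊗ₘ dag V) = 𝟙 (γ ⊗ γ) := by
      rw [tensorHom_comp_tensorHom, hV, id_tensorHom_id]
    -- By naturality the self-braiding of γ is the compression of that of ρ^d to the range of E_d ×
    -- E_d, where it is the sign χ.
    have h2 : (β_ γ γ).hom = (V ⊗ₘ V) ≫ ((isotypic ρ s d ⊗ₘ isotypic ρ s d) ≫
        (β_ (power ρ d) (power ρ d)).hom) ≫ (dag V ⊗ₘ dag V) := by
      rw [← hVE, ← tensorHom_comp_tensorHom]
      simp only [Category.assoc]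
      rw [reassoc_of% h1, BraidedCategory.braiding_naturality_assoc, h1, Category.comp_id]
    refine h2.trans ?_
    rw [hb, ← hVE, ← tensorHom_comp_tensorHom]
    simp only [Linear.smul_comp, Linear.comp_smul, Category.assoc]
    rw [h1, Category.comp_id, h1]
    rfl
  · rcases Int.units_eq_one_or s with rfl | rfl
    · exact Or.inr (hVE.trans (isPermRep_permHom ρ d).symmetrizer_eq.symm)
    · exact Or.inl (hVE.trans (isPermRep_permHom ρ d).antisymmetrizer_eq.symm)

theorem hasFiniteStatistics_of_hasDeterminant {ρ : N.Obj}
    (hρ : Bimodule.IsIrreducible ρ.toBimodule) (h : HasDeterminant ρ) : HasFiniteStatistics ρ := by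
  have h1 := Bimodule.isUnitary_one ρ.toBimodule
  refine ⟨1, fun _ => ρ, fun _ => Bimodule.one ρ.toBimodule, one_pos, fun _ => ⟨hρ, h⟩,
    fun _ => h1.1, ?_⟩
  rw [Fin.sum_univ_one]
  exact h1.2

end LocalNet
end

theorem proposition3p16 {H : Type*} [NormedAddCommGroup H] [InnerProductSpace ℂ H]
    [CompleteSpace H] [TopologicalSpace.SeparableSpace H] (hH : ¬ FiniteDimensional ℂ H)
    (N : LocalNet H) (ρ : N.Obj) (hρ : Bimodule.IsIrreducible ρ.toBimodule) :
    LocalNet.HasFiniteStatistics ρ ↔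
      (Bimodule.IsFaithful ρ.toBimodule ∧
        ∀ Ψ : LocalNet.LeftInverse ρ, ∃ c : ℂ, c ≠ 0 ∧
          Ψ.map ρ ρ (LocalNet.symmetry ρ ρ) = c • Bimodule.one ρ.toBimodule) := by
  -- Of the infinite dimension only H ≠ 0 is needed: it provides unit vectors and makes faithful
  -- objects nonzero.
  have : Nontrivial H := by
    by_contra h
    rw [not_nontrivial_iff_subsingleton] at h
    exact hH inferInstance
  refine ⟨fun h => h.faithful_and_parameter_ne_zero hρ, fun ⟨h, hΨ⟩ => ?_⟩
  obtain ⟨Λ⟩ := LocalNet.exists_slice ρ.toBimodule h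
  obtain ⟨c, hc0, hc⟩ := hΨ Λ.leftInverse
  exact LocalNet.hasFiniteStatistics_of_hasDeterminant hρ (LocalNet.exists_hasDeterminant Λ hc hc0)
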